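/- **Setting.** Fix a set $\mathbf{Ind}$ of indices and for each $i\in\mathbf{Ind}$ a finite set $[i]$, its domain, such that for every index $i$ there are infinitely many indices $j$ with $|[j]|=|[i]|$ (so that fresh indices are always available). A tensor $A$ over a finite set of indices $\mathcal I(A)$ is a function from the assignments $[\mathcal I(A)]=\prod_{i\in\mathcal I(A)}[i]$ to $\mathbb C$; its rank is $|\mathcal I(A)|$. A tensor network $N$ is a nonempty finite set of tensors across which no index appears more than twice; $\mathcal F(N)$ is the set of its free indices (appearing once) and $\mathcal B(N)$ the set of its bond indices (appearing twice). Its bond dimension is the maximum of $|[i]|$ over $i\in\mathcal B(N)$ ($0$ if $\mathcal B(N)=\emptyset$). Its contraction $\mathcal T(N)$ is the tensor over $\mathcal F(N)$ with $\mathcal T(N)(\tau)=\sum_{\rho\in[\mathcal B(N)]}\prod_{A\in N}A((\rho\cup\tau)|_{\mathcal I(A)})$. The structure graph of $N$ is the multigraph whose vertices are the tensors of $N$ and a free vertex $z$, whose edges are the indices of $N$, each tensor being incident to its indices and $z$ to the free indices. A tree decomposition of a multigraph $G$ is a tree $T$ in which every vertex has degree one or three (or which has a single vertex), with labels $\chi(n)\subseteq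 V(G)$ for the nodes $n$ of $T$, such that every vertex of $G$ is in a label, the two ends of every edge of $G$ lie in a common label, and $\chi(n)\cap\chi(o)\subseteq\chi(p)$ whenever $p$ is on the path from $n$ to $o$; its width is $\max_n|\chi(n)|-1$. A tensor $A$ is tree factorable if for every finite tree $T$ whose leaves (vertices of degree one) are the indices of $A$ there are a tensor network $N_A$ and a bijection $g_A:V(T)\to N_A$ such that: (1) $\mathcal T(N_A)=A$; (2) $g_A$ is an isomorphism between $T$ and the structure graph of $N_A$ with the free vertex and its incident edges removed; (3) every index $i$ of $A$ is an index of $g_A(i)$; (4) if $A$ has an index, then for some index $i$ of $A$ the bond dimension of $N_A$ is at most $|[i]|$. A contraction tree of a network $M$ is a rooted binary tree whose leaves are the tensors of $M$, each once. It computes a tensor recursively: a single leaf yields its tensor, and otherwise the results of the two immediate subtrees are contracted with each other, i.e. their common indices are summed out. Its max rank is the maximal rank of the result of a recursive call. **Theorem.** Let $N$ be a tensor network of tree-factorable tensors such that $|\mathcal F(N)|\le 3$ and the structure graph of $N$ has a tree decomposition of width $w\ge 1$. Then for each $A\in N$ there is a tensor network $N_A$ consisting only of tensors of rank at most $3$ whose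 contraction is $A$, such that the sets $N_A$ are pairwise disjoint and their union $M=\bigcup_{A\in N}N_A$ is a tensor network with the following properties: 1. $\mathcal T(M)=\mathcal T(N)$; 2. $M$ has the same bond dimension as $N$, provided that $|[i]|$ is at most the bond dimension of $N$ for every free index $i$ of $N$ that belongs to a tensor of $N$ of rank at least $4$ (in particular whenever $N$ has no free index); in any case, the bond dimension of $M$ is at least that of $N$ and at most the maximum of the bond dimension of $N$ and of the sizes $|[i]|$, $i\in\mathcal F(N)$; 3. $M$ has a contraction tree of max rank at most $\lceil 4(w+1)/3\rceil$. -/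

import Mathlib

/-- A tensor over a finite set `idx` of indices: a complex-valued function on the assignments to
`idx`.  Indices are elements of `Ind`, and `dom i` is the (finite) domain of the index `i`. -/
@[ext]
structure Tensor {Ind : Type*} (dom : Ind → Type*) where
  /-- The indices of the tensor. -/
  idx : Finset Ind
  /-- The entries of the tensor. -/
  val : ((i : idx) → dom i) → ℂ

/-- The rank of a tensor is its number of indices. -/
def Tensor.rank {Ind : Type*} {dom : Ind → Type*} (A : Tensor dom) : ℕ := A.idx.card

open Classical in
/-- A tensor network: a nonempty (finite) set of tensors across which no index appears more than
twice. -/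
@[ext]
structure TensorNetwork {Ind : Type*} (dom : Ind → Type*) where
  tensors : Finset (Tensor dom)
  nonempty : tensors.Nonempty
  le_two : ∀ i : Ind, (tensors.filter (fun A => i ∈ A.idx)).card ≤ 2

namespace TensorNetwork

open Classical in
/-- The number of tensors of `N` in which the index `i` appears. -/
noncomputable def mult {Ind : Type*} {dom : Ind → Type*} (N : TensorNetwork dom) (i : Ind) : ℕ :=
  (N.tensors.filter (fun A => i ∈ A.idx)).card

open Classical in
/-- All indices appearing in `N`. -/
noncomputable def indices {Ind : Type*} {dom : Ind → Type*} (N : TensorNetwork dom) : Finset Ind :=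
  N.tensors.biUnion (fun A => A.idx)

/-- The free indices of `N`: those that appear once. -/
noncomputable def free {Ind : Type*} {dom : Ind → Type*} (N : TensorNetwork dom) : Finset Ind :=
  N.indices.filter (fun i => N.mult i = 1)

/-- The bond indices of `N`: those that appear twice. -/
noncomputable def bond {Ind : Type*} {dom : Ind → Type*} (N : TensorNetwork dom) : Finset Ind :=
  N.indices.filter (fun i => N.mult i = 2)

/-- The bond dimension of `N`: the largest size of the domain of a bond index (`0` if there is no
bond index). -/
noncomputable def bondDim {Ind : Type*} {dom : Ind → Type*} [∀ i, Fintype (dom i)]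
    (N : TensorNetwork dom) : ℕ :=
  N.bond.sup (fun i => Fintype.card (dom i))

theorem mem_indices {Ind : Type*} {dom : Ind → Type*} (N : TensorNetwork dom) {A : Tensor dom}
    (hA : A ∈ N.tensors) {i : Ind} (hi : i ∈ A.idx) : i ∈ N.indices := by
  classical
  exact Finset.mem_biUnion.2 ⟨A, hA, hi⟩

theorem mult_eq_one_or_two {Ind : Type*} {dom : Ind → Type*} (N : TensorNetwork dom) {i : Ind}
    (hi : i ∈ N.indices) : N.mult i = 1 ∨ N.mult i = 2 := by
  classical
  obtain ⟨A, hA, hiA⟩ := Finset.mem_biUnion.1 hi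
  have h2 := N.le_two i
  have h1 : 0 < (N.tensors.filter (fun A => i ∈ A.idx)).card :=
    Finset.card_pos.2 ⟨A, Finset.mem_filter.2 ⟨hA, hiA⟩⟩
  unfold mult
  omega

theorem mem_bond_of_not_mem_free {Ind : Type*} {dom : Ind → Type*} (N : TensorNetwork dom)
    {A : Tensor dom} (hA : A ∈ N.tensors) {i : Ind} (hi : i ∈ A.idx) (hf : i ∉ N.free) :
    i ∈ N.bond := by
  have h := N.mem_indices hA hi
  have := N.mult_eq_one_or_two h
  simp only [free, bond, Finset.mem_filter] at *
  tauto

open Classical in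
/-- The restriction to the indices of `A ∈ N` of the assignment `ρ ∪ τ`, where `ρ` assigns the bond
indices and `τ` the free indices of `N`. -/
noncomputable def glue {Ind : Type*} {dom : Ind → Type*} (N : TensorNetwork dom)
    (ρ : (i : N.bond) → dom i) (τ : (i : N.free) → dom i) (A : N.tensors) :
    (i : A.1.idx) → dom i :=
  fun i => if h : i.1 ∈ N.free then τ ⟨i.1, h⟩
    else ρ ⟨i.1, N.mem_bond_of_not_mem_free A.2 i.2 h⟩

open Classical in
/-- The contraction of `N`: the tensor over the free indices of `N` obtained by summing over all
assignments to the bond indices. -/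
noncomputable def contraction {Ind : Type*} {dom : Ind → Type*} [∀ i, Fintype (dom i)]
    (N : TensorNetwork dom) : Tensor dom where
  idx := N.free
  val τ := ∑ ρ : (i : N.bond) → dom i, ∏ A : N.tensors, A.1.val (N.glue ρ τ A)

/-- Incidence in the structure graph; `none` is the free vertex and `some A` is the tensor `A`. -/
def Incident {Ind : Type*} {dom : Ind → Type*} (N : TensorNetwork dom) (i : Ind) :
    Option (Tensor dom) → Prop
  | none => i ∈ N.free
  | some A => A ∈ N.tensors ∧ i ∈ A.idx

theorem Incident.eq_or_eq {Ind : Type*} {dom : Ind → Type*} (N : TensorNetwork dom) {i : Ind}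
    {x v w : Option (Tensor dom)} (hvw : v ≠ w) (hx : N.Incident i x) (hv : N.Incident i v)
    (hw : N.Incident i w) : x = v ∨ x = w := by
  classical
  by_contra! hne
  have two : ∀ A B : Tensor dom, A ≠ B → i ∈ N.free → (A ∈ N.tensors ∧ i ∈ A.idx) →
      (B ∈ N.tensors ∧ i ∈ B.idx) → False := by
    intro A B hAB hf hA hB
    have h1 : (N.tensors.filter (fun A => i ∈ A.idx)).card = 1 := (Finset.mem_filter.1 hf).2
    exact hAB (Finset.card_le_one.1 h1.le A (Finset.mem_filter.2 hA) B (Finset.mem_filter.2 hB))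
  have three : ∀ A B C : Tensor dom, A ≠ B → A ≠ C → B ≠ C → N.Incident i (some A) →
      N.Incident i (some B) → N.Incident i (some C) → False := by
    intro A B C hAB hAC hBC hA hB hC
    have := N.le_two i
    have h3 : 2 < (N.tensors.filter (fun A => i ∈ A.idx)).card :=
      Finset.two_lt_card.2 ⟨A, Finset.mem_filter.2 hA, B, Finset.mem_filter.2 hB, C,
        Finset.mem_filter.2 hC, hAB, hAC, hBC⟩
    omega
  have inj : ∀ {A B : Tensor dom}, some A ≠ some B → A ≠ B := fun h h' => h (congrArg some h')
  rcases x with _ | x <;> rcases v with _ | v <;> rcases w with _ | w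
  · exact hvw rfl
  · exact hne.1 rfl
  · exact hne.2 rfl
  · exact two _ _ (inj hvw) hx hv hw
  · exact hvw rfl
  · exact two _ _ (inj hne.2) hv hx hw
  · exact two _ _ (inj hne.1) hw hx hv
  · exact three _ _ _ (inj hne.1) (inj hne.2) (inj hvw) hx hv hw

theorem exists_incident_pair {Ind : Type*} {dom : Ind → Type*} (N : TensorNetwork dom) {i : Ind}
    (hi : i ∈ N.indices) : ∃ x y, x ≠ y ∧ N.Incident i x ∧ N.Incident i y := by
  classical
  rcases N.mult_eq_one_or_two hi with h | h
  · obtain ⟨A, hA, hiA⟩ := Finset.mem_biUnion.1 hi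
    exact ⟨none, some A, by simp, Finset.mem_filter.2 ⟨hi, h⟩, hA, hiA⟩
  · obtain ⟨A, B, hAB, hs⟩ := Finset.card_eq_two.1 h
    have hA : A ∈ N.tensors.filter (fun A => i ∈ A.idx) := by rw [hs]; simp
    have hB : B ∈ N.tensors.filter (fun A => i ∈ A.idx) := by rw [hs]; simp
    exact ⟨some A, some B, by simpa using hAB, Finset.mem_filter.1 hA, Finset.mem_filter.1 hB⟩

theorem Incident.mem_indices {Ind : Type*} {dom : Ind → Type*} (N : TensorNetwork dom) {i : Ind}
    {x : Option (Tensor dom)} (hx : N.Incident i x) : i ∈ N.indices := by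
  rcases x with _ | A
  · exact (Finset.mem_filter.1 hx).1
  · exact N.mem_indices hx.1 hx.2

/-- The structure graph of `N`, a multigraph: the vertices are the tensors of `N` and a free vertex
`none`, the edges are the indices of `N`, each tensor is incident to its indices, and the free
vertex is incident to the free indices. -/
def structureGraph {Ind : Type*} {dom : Ind → Type*} (N : TensorNetwork dom) :
    Graph (Option (Tensor dom)) Ind where
  vertexSet := insert none (some '' (N.tensors : Set (Tensor dom)))
  IsLink i x y := x ≠ y ∧ N.Incident i x ∧ N.Incident i y
  edgeSet := N.indices
  isLink_symm _ _ := ⟨fun _ _ h => ⟨h.1.symm, h.2.2, h.2.1⟩⟩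
  eq_or_eq_of_isLink_of_isLink _ _ _ _ _ h h' :=
    Incident.eq_or_eq N h'.1 h.2.1 h'.2.1 h'.2.2
  edge_mem_iff_exists_isLink _ :=
    ⟨fun h => N.exists_incident_pair h, fun ⟨_, _, h⟩ => Incident.mem_indices N h.2.1⟩
  left_mem_of_isLink := by
    rintro i (_ | A) y ⟨_, h, _⟩
    · exact Or.inl rfl
    · exact Or.inr ⟨A, h.1, rfl⟩

end TensorNetwork

/-- A leaf of a tree is a vertex of degree one. -/
def IsTreeLeaf {V : Type*} (T : SimpleGraph V) (v : V) : Prop := (T.neighborSet v).ncard = 1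

/-- An unrooted binary tree: a tree in which every vertex has degree one or three (or which consists
of a single vertex). -/
def IsUnrootedBinaryTree {V : Type*} (T : SimpleGraph V) : Prop :=
  T.IsTree ∧
    (Subsingleton V ∨ ∀ v, (T.neighborSet v).ncard = 1 ∨ (T.neighborSet v).ncard = 3)

/-- A tree decomposition of the multigraph `G`. -/
structure TreeDecomposition {α β : Type*} (G : Graph α β) where
  node : Type
  [fintypeNode : Fintype node]
  tree : SimpleGraph node
  isBinary : IsUnrootedBinaryTree tree
  /-- The labels of the nodes. -/
  label : node → Finset α
  label_subset : ∀ n, (label n : Set α) ⊆ G.vertexSet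
  vertex_mem : ∀ v ∈ G.vertexSet, ∃ n, v ∈ label n
  edge_mem : ∀ e ∈ G.edgeSet, ∃ n, ∀ v, G.Inc e v → v ∈ label n
  path_mem : ∀ (n o p : node) (q : tree.Walk n o), q.IsPath → p ∈ q.support →
    ∀ v, v ∈ label n → v ∈ label o → v ∈ label p

/-- The width of a tree decomposition: the maximum size of a label, minus one. -/
def TreeDecomposition.width {α β : Type*} {G : Graph α β} (D : TreeDecomposition G) : ℕ :=
  letI := D.fintypeNode
  (Finset.univ.sup fun n => (D.label n).card) - 1

/-- `g` is (the vertex part of) an isomorphism between the simple graph `T` and the multigraph `G`: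
it is a bijection between the vertices, adjacent vertices of `T` are mapped to vertices joined by
exactly one edge, and non-adjacent ones to vertices that are not joined by any edge. -/
def IsGraphIso {V α β : Type*} (T : SimpleGraph V) (G : Graph α β) (g : V → α) : Prop :=
  Set.BijOn g Set.univ G.vertexSet ∧
    (∀ u v, T.Adj u v → ∃! e, G.IsLink e (g u) (g v)) ∧
    (∀ u v, ¬ T.Adj u v → ∀ e, ¬ G.IsLink e (g u) (g v))

/-- `A` is tree factorable: for every (finite) tree `T` whose leaves are the indices of `A`, via
`leaf`, the tensor `A` is the contraction of a network with the shape of `T`, in which each index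
`i` of `A` appears at the node `i`, and whose bond dimension is at most the size of the domain of
some index of `A`.  (The last requirement is void for a tensor without indices, which is the only
tensor of every such network.) -/
def Tensor.TreeFactorable {Ind : Type*} {dom : Ind → Type*} [∀ i, Fintype (dom i)]
    (A : Tensor dom) : Prop :=
  ∀ (V : Type) [Fintype V] (T : SimpleGraph V), T.IsTree →
    ∀ leaf : A.idx ≃ {v : V // IsTreeLeaf T v},
      ∃ (NA : TensorNetwork dom) (g : V → Tensor dom),
        NA.contraction = A ∧
        IsGraphIso T (NA.structureGraph.deleteVerts {none}) (fun v => some (g v)) ∧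
        (∀ i : A.idx, i.1 ∈ (g (leaf i).1).idx) ∧
        (A.idx.Nonempty → ∃ i ∈ A.idx, NA.bondDim ≤ Fintype.card (dom i))

open Classical in
/-- The contraction `A · B` of two tensors: the common indices are summed out. -/
noncomputable def Tensor.mul {Ind : Type*} {dom : Ind → Type*} [∀ i, Fintype (dom i)]
    (A B : Tensor dom) : Tensor dom where
  idx := symmDiff A.idx B.idx
  val τ := ∑ ρ : (i : (A.idx ∩ B.idx : Finset Ind)) → dom i,
    A.val (fun i => if h : i.1 ∈ B.idx then ρ ⟨i.1, Finset.mem_inter.2 ⟨i.2, h⟩⟩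
      else τ ⟨i.1, Finset.mem_symmDiff.2 (Or.inl ⟨i.2, h⟩)⟩) *
    B.val (fun i => if h : i.1 ∈ A.idx then ρ ⟨i.1, Finset.mem_inter.2 ⟨h, i.2⟩⟩
      else τ ⟨i.1, Finset.mem_symmDiff.2 (Or.inr ⟨i.2, h⟩)⟩)

/-- Rooted binary trees with leaves labelled by elements of `α`. -/
inductive RootedBinaryTree (α : Type*) where
  | leaf : α → RootedBinaryTree α
  | node : RootedBinaryTree α → RootedBinaryTree α → RootedBinaryTree α

namespace RootedBinaryTree

/-- The leaves of a rooted binary tree. -/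
def leaves {α : Type*} : RootedBinaryTree α → Multiset α
  | leaf a => {a}
  | node l r => l.leaves + r.leaves

/-- A contraction tree for `N`: a rooted binary tree whose leaves are the tensors of `N` (each of
them once). -/
def IsContractionTree {Ind : Type*} {dom : Ind → Type*} (t : RootedBinaryTree (Tensor dom))
    (N : TensorNetwork dom) : Prop :=
  t.leaves = N.tensors.val

/-- The recursive contraction algorithm: contract the two immediate subtrees and then contract
the two results with each other. -/
noncomputable def contract {Ind : Type*} {dom : Ind → Type*} [∀ i, Fintype (dom i)] :
    RootedBinaryTree (Tensor dom) → Tensor dom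
  | leaf A => A
  | node l r => l.contract.mul r.contract

/-- The max rank of a contraction tree: the maximal rank of the result of a recursive call of
`contract`. -/
noncomputable def maxRank {Ind : Type*} {dom : Ind → Type*} [∀ i, Fintype (dom i)] :
    RootedBinaryTree (Tensor dom) → ℕ
  | leaf A => A.rank
  | node l r => max (node l r).contract.rank (max l.maxRank r.maxRank)

end RootedBinaryTree

/-! The rank of a contracted set of tensors depends only on index sets, and contraction takes
symmetric differences. So index sets become indicator vectors over `ZMod 2`, and the rank is the
support size of a sum of vectors, whatever the order of contraction. Entries matter only for showing
that replacing each tensor by a network with fresh bonds preserves the contraction; this is a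
distributive law (`IsFactoring.exists_union`).

A tree decomposition of width `w` yields a rooted binary tree `R` whose leaves are the indices, such
that at each inner node the vertices with edges both inside and outside one of the two subtrees lie
in a common set of at most `w + 1` vertices (`TreeDecomposition.isBranchDecomposable`). A tensor of
rank at least four is factored along the tree that `R` induces on its indices. Smaller tensors stay
whole, and the free vertex is treated as one more tensor of rank at most three. Either way a vertex
`v` is spread over `R` (`IsSpread`): its pieces inside a subtree `S` have at most one connection `b
v S` besides the indices of `v` that are leaves of `S`, and this connection vanishes unless `v` has
edges inside and outside `S`. Contracting all pieces inside `S` cancels the leaves of `S` and leaves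
at most one index for each boundary vertex.

The core is the passage from subtrees `l` and `r` to their parent (`contractible_of_isSpread`). A
vertex has at most one piece at the parent itself. It is expensive only if it is connected to `l`,
to `r` and upwards: absorbing the piece into one side trades one index for two, and joining the
sides without it also leaves two. These at most `w + 1` vertices are split into three groups of size
at most `⌈(w + 1) / 3⌉`: one is absorbed on the left, one on the right, one after the two sides are
joined. Only one group at a time pays a second index, so the rank stays below `w + 1 + ⌈(w + 1) / 3⌉
= ⌈4 (w + 1) / 3⌉`, or equals it.

Finally, all vectors, that of the free vertex included, add up to zero. A set and its complement
thus have the same vector, so the contraction tree can be rerooted at the free vertex and this leaf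
cut off without increasing the bound (`exists_reroot`). -/

/-! ### Tensors as functions of partial assignments, and iterated summation. -/

section Evaluation

variable {Ind : Type*} {dom : Ind → Type*}

/-- Overwrite a partial assignment `σ` on the indices in `s` by the assignment `ρ`. -/
noncomputable def overwrite (s : Finset Ind) (ρ : (i : s) → dom i) (σ : ∀ i, Option (dom i)) :
    ∀ i, Option (dom i) :=
  open Classical in fun i => if h : i ∈ s then some (ρ ⟨i, h⟩) else σ i

theorem overwrite_of_mem {s : Finset Ind} {ρ : (i : s) → dom i} {σ : ∀ i, Option (dom i)} {i : Ind}
    (h : i ∈ s) : overwrite s ρ σ i = some (ρ ⟨i, h⟩) := by simp [overwrite, h]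

theorem overwrite_of_notMem {s : Finset Ind} {ρ : (i : s) → dom i} {σ : ∀ i, Option (dom i)}
    {i : Ind} (h : i ∉ s) : overwrite s ρ σ i = σ i := by simp [overwrite, h]

/-- Sum a function of partial assignments over all values of the indices in `s`. -/
noncomputable def sumOut [∀ i, Fintype (dom i)] (s : Finset Ind)
    (f : (∀ i, Option (dom i)) → ℂ) (σ : ∀ i, Option (dom i)) : ℂ :=
  open Classical in ∑ ρ : (i : s) → dom i, f (overwrite s ρ σ)

theorem sumOut_congr [∀ i, Fintype (dom i)] {s : Finset Ind} {f g : (∀ i, Option (dom i)) → ℂ}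
    (h : ∀ σ, f σ = g σ) (σ : ∀ i, Option (dom i)) : sumOut s f σ = sumOut s g σ := by
  rw [funext h]

theorem sumOut_empty [∀ i, Fintype (dom i)] (f : (∀ i, Option (dom i)) → ℂ)
    (σ : ∀ i, Option (dom i)) : sumOut ∅ f σ = f σ := by
  classical
  have h : ∀ ρ : (i : (∅ : Finset Ind)) → dom i, overwrite ∅ ρ σ = σ := fun ρ =>
    funext fun i => overwrite_of_notMem (Finset.notMem_empty i)
  simp [sumOut, h]

theorem sumOut_union [inst : DecidableEq Ind] [∀ i, Fintype (dom i)] {s t : Finset Ind}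
    (hst : Disjoint s t) (f : (∀ i, Option (dom i)) → ℂ) (σ : ∀ i, Option (dom i)) :
    sumOut (s ∪ t) f σ = sumOut s (sumOut t f) σ := by
  obtain rfl : inst = Classical.decEq Ind := Subsingleton.elim _ _
  let := Classical.decEq Ind
  unfold sumOut
  rw [← Fintype.sum_prod_type' (f := fun ρ ρ' => f (overwrite t ρ' (overwrite s ρ σ)))]
  symm
  apply Fintype.sum_equiv (Equiv.piFinsetUnion dom hst)
  rintro ⟨ρ, ρ'⟩
  congr 1
  funext i
  by_cases hi : i ∈ t
  · rw [overwrite_of_mem hi, overwrite_of_mem (Finset.mem_union_right _ hi)]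
    congr 1
    exact (Equiv.piFinsetUnion_right dom hst hi _).symm
  · by_cases hi' : i ∈ s
    · rw [overwrite_of_notMem hi, overwrite_of_mem hi',
        overwrite_of_mem (Finset.mem_union_left _ hi')]
      congr 1
      exact (Equiv.piFinsetUnion_left dom hst hi' _).symm
    · rw [overwrite_of_notMem hi, overwrite_of_notMem hi', overwrite_of_notMem (by simp [hi, hi'])]

theorem sumOut_mul_left [∀ i, Fintype (dom i)] {s : Finset Ind}
    {f g : (∀ i, Option (dom i)) → ℂ} {u : Set Ind} (hg : DependsOn g u)
    (hu : ∀ i ∈ s, i ∉ u) (σ : ∀ i, Option (dom i)) :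
    sumOut s (fun σ => g σ * f σ) σ = g σ * sumOut s f σ := by
  unfold sumOut
  rw [Finset.mul_sum]
  refine Finset.sum_congr rfl fun ρ _ => ?_
  change g _ * _ = _
  congr 1
  exact hg fun i hi => overwrite_of_notMem fun h => hu i h hi

theorem sumOut_mul_right [∀ i, Fintype (dom i)] {s : Finset Ind}
    {f g : (∀ i, Option (dom i)) → ℂ} {u : Set Ind} (hg : DependsOn g u)
    (hu : ∀ i ∈ s, i ∉ u) (σ : ∀ i, Option (dom i)) :
    sumOut s (fun σ => f σ * g σ) σ = sumOut s f σ * g σ := by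
  rw [mul_comm, ← sumOut_mul_left hg hu]
  simp only [mul_comm]

theorem dependsOn_sumOut [∀ i, Fintype (dom i)] {s : Finset Ind}
    {f : (∀ i, Option (dom i)) → ℂ} {u : Set Ind} (hf : DependsOn f u) :
    DependsOn (sumOut s f) u := by
  intro σ σ' h
  refine Finset.sum_congr rfl fun ρ _ => hf fun i hi => ?_
  by_cases hs : i ∈ s
  · rw [overwrite_of_mem hs, overwrite_of_mem hs]
  · rw [overwrite_of_notMem hs, overwrite_of_notMem hs, h i hi]

theorem dependsOn_prod {ι : Type*} {s : Finset ι} {f : ι → (∀ i, Option (dom i)) → ℂ}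
    {u : ι → Set Ind} (hf : ∀ a ∈ s, DependsOn (f a) (u a)) {v : Set Ind}
    (hv : ∀ a ∈ s, u a ⊆ v) :
    DependsOn (fun σ => ∏ a ∈ s, f a σ) v :=
  fun _ _ h => Finset.prod_congr rfl fun a ha => hf a ha fun i hi => h i (hv a ha hi)

/-- Distributive law: summation over `B a` passes through each factor `f b` with `b ≠ a`, because
this factor does not depend on the indices in `B a`. -/
theorem sumOut_biUnion_prod [DecidableEq Ind] [∀ i, Fintype (dom i)] {ι : Type*} (s : Finset ι)
    (B : ι → Finset Ind) (f : ι → (∀ i, Option (dom i)) → ℂ) (u : ι → Set Ind)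
    (hf : ∀ a ∈ s, DependsOn (f a) (u a))
    (hu : ∀ a ∈ s, ∀ b ∈ s, a ≠ b → ∀ i ∈ B a, i ∉ u b)
    (hB : ∀ a ∈ s, ∀ b ∈ s, a ≠ b → Disjoint (B a) (B b)) (σ : ∀ i, Option (dom i)) :
    sumOut (s.biUnion B) (fun σ => ∏ a ∈ s, f a σ) σ = ∏ a ∈ s, sumOut (B a) (f a) σ := by
  classical
  induction s using Finset.induction_on generalizing σ with
  | empty => simp [sumOut_empty]
  | insert a s ha ih =>
    have hne : ∀ b ∈ s, a ≠ b := fun b hb h => ha (h ▸ hb)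
    have hd : Disjoint (B a) (s.biUnion B) := by
      rw [Finset.disjoint_biUnion_right]
      exact fun b hb => hB a (by simp) b (by simp [hb]) (hne b hb)
    simp only [Finset.biUnion_insert, Finset.prod_insert ha]
    rw [sumOut_union hd]
    rw [sumOut_congr (g := fun σ => f a σ * ∏ b ∈ s, sumOut (B b) (f b) σ)]
    · refine sumOut_mul_right (u := ⋃ b ∈ s, u b) ?_ ?_ σ
      · exact dependsOn_prod (f := fun b => sumOut (B b) (f b)) (u := u)
          (fun b hb => dependsOn_sumOut (hf b (Finset.mem_insert_of_mem hb)))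
          fun b hb => Set.subset_biUnion_of_mem (u := u) hb
      · intro i hi h
        simp only [Set.mem_iUnion] at h
        obtain ⟨b, hb, hib⟩ := h
        exact hu a (by simp) b (by simp [hb]) (hne b hb) i hi hib
    · intro σ
      rw [sumOut_mul_left (hf a (by simp))]
      · rw [ih (fun b hb => hf b (by simp [hb]))
          (fun b hb c hc => hu b (by simp [hb]) c (by simp [hc]))
          (fun b hb c hc => hB b (by simp [hb]) c (by simp [hc]))]
      · intro i hi
        obtain ⟨b, hb, hib⟩ := Finset.mem_biUnion.1 hi
        exact hu b (by simp [hb]) a (by simp) (hne b hb).symm i hib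

/-- The value of a tensor at a partial assignment (zero if one of its indices is unassigned). -/
noncomputable def Tensor.ev (A : Tensor dom) (σ : ∀ i, Option (dom i)) : ℂ :=
  open Classical in
  if h : ∀ i : A.idx, (σ i).isSome then A.val (fun i => (σ i).get (h i)) else 0

theorem Tensor.dependsOn_ev (A : Tensor dom) : DependsOn A.ev (A.idx : Set Ind) := by
  intro σ σ' h
  have h' : ∀ i : A.idx, σ i = σ' i := fun i => h i i.2
  unfold Tensor.ev
  simp only [h']

theorem Tensor.ev_of_eq_some (A : Tensor dom) {σ : ∀ i, Option (dom i)} {τ : (i : A.idx) → dom i}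
    (h : ∀ i : A.idx, σ i = some (τ i)) : A.ev σ = A.val τ := by
  unfold Tensor.ev
  rw [dif_pos (fun i => by simp [h i])]
  congr 1
  funext i
  simp [h i]

theorem Tensor.ev_of_eq_none (A : Tensor dom) {σ : ∀ i, Option (dom i)} {i : Ind} (hi : i ∈ A.idx)
    (h : σ i = none) : A.ev σ = 0 :=
  dif_neg fun h' => by simpa [h] using h' ⟨i, hi⟩

/-- Partial assignments serve here because some domains may be empty, and then there is no total
assignment to test on. -/
theorem Tensor.ext_ev {A B : Tensor dom} (h : A.idx = B.idx) (hev : ∀ σ, A.ev σ = B.ev σ) :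
    A = B := by
  obtain ⟨s, f⟩ := A
  obtain ⟨t, g⟩ := B
  obtain rfl : s = t := h
  congr 1
  funext τ
  classical
  let σ : ∀ i, Option (dom i) := overwrite s τ fun _ => none
  have hσ : ∀ i : s, σ i = some (τ i) := fun i => overwrite_of_mem i.2
  have := hev σ
  rwa [Tensor.ev_of_eq_some _ hσ, Tensor.ev_of_eq_some _ hσ] at this

namespace TensorNetwork

theorem mem_free {N : TensorNetwork dom} {i : Ind} : i ∈ N.free ↔ N.mult i = 1 := by
  classical
  refine ⟨fun h => (Finset.mem_filter.1 h).2, fun h => Finset.mem_filter.2 ⟨?_, h⟩⟩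
  obtain ⟨A, hA⟩ := Finset.card_pos.1 (show 0 < N.mult i by omega)
  exact N.mem_indices (Finset.mem_filter.1 hA).1 (Finset.mem_filter.1 hA).2

theorem mem_bond {N : TensorNetwork dom} {i : Ind} : i ∈ N.bond ↔ N.mult i = 2 := by
  classical
  refine ⟨fun h => (Finset.mem_filter.1 h).2, fun h => Finset.mem_filter.2 ⟨?_, h⟩⟩
  obtain ⟨A, hA⟩ := Finset.card_pos.1 (show 0 < N.mult i by omega)
  exact N.mem_indices (Finset.mem_filter.1 hA).1 (Finset.mem_filter.1 hA).2

theorem exists_of_mem_indices {N : TensorNetwork dom} {i : Ind} (hi : i ∈ N.indices) :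
    ∃ A ∈ N.tensors, i ∈ A.idx := by
  classical
  exact Finset.mem_biUnion.1 hi

theorem free_subset (N : TensorNetwork dom) : N.free ⊆ N.indices := Finset.filter_subset _ _

theorem bond_subset (N : TensorNetwork dom) : N.bond ⊆ N.indices := Finset.filter_subset _ _

theorem notMem_bond_of_mem_free {N : TensorNetwork dom} {i : Ind} (hi : i ∈ N.free) :
    i ∉ N.bond := by
  rw [mem_free] at hi
  rw [mem_bond]
  omega

theorem mem_free_or_mem_bond {N : TensorNetwork dom} {i : Ind} (hi : i ∈ N.indices) :
    i ∈ N.free ∨ i ∈ N.bond := by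
  rw [mem_free, mem_bond]
  exact N.mult_eq_one_or_two hi

/-- Replaces the gluing of dependent functions by overwriting, so that sums over different bond sets
can be nested and compared. -/
theorem ev_contraction [∀ i, Fintype (dom i)] (N : TensorNetwork dom) (σ : ∀ i, Option (dom i)) :
    N.contraction.ev σ = sumOut N.bond (fun σ => ∏ A ∈ N.tensors, A.ev σ) σ := by
  classical
  by_cases h : ∀ i : N.free, ∃ x : dom i, σ i = some x
  · choose τ hτ using h
    rw [Tensor.ev_of_eq_some N.contraction (τ := τ) hτ]
    simp only [contraction, sumOut]
    refine Finset.sum_congr (by congr) fun ρ _ => ?_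
    rw [← Finset.prod_coe_sort N.tensors]
    refine Finset.prod_congr rfl fun A _ => ?_
    refine (Tensor.ev_of_eq_some _ fun i => ?_).symm
    by_cases hi : i.1 ∈ N.free
    · rw [overwrite_of_notMem (notMem_bond_of_mem_free hi), glue, dif_pos hi]
      exact hτ ⟨i, hi⟩
    · rw [overwrite_of_mem (N.mem_bond_of_not_mem_free A.2 i.2 hi), glue, dif_neg hi]
  -- With a free index unassigned both sides vanish: summing over bonds does not assign it, and some
  -- factor carries it.
  · push Not at h
    obtain ⟨i, hi⟩ := h
    have hn : σ i = none := Option.eq_none_iff_forall_ne_some.2 fun x hx => hi x hx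
    rw [Tensor.ev_of_eq_none N.contraction (i := i) i.2 hn]
    obtain ⟨A, hA, hiA⟩ := exists_of_mem_indices (N.free_subset i.2)
    symm
    refine Finset.sum_eq_zero fun ρ _ => Finset.prod_eq_zero hA (A.ev_of_eq_none hiA ?_)
    rw [overwrite_of_notMem (notMem_bond_of_mem_free i.2), hn]

end TensorNetwork

end Evaluation

/-! ### Renaming bond indices to fresh ones. -/

section Rename

variable {Ind : Type*} {dom : Ind → Type*} {σ : Ind ≃ Ind}

/-- Pull a partial assignment back along a permutation `σ` of the indices and bijections between the
domains. -/
def pullback (e : ∀ i, dom (σ i) ≃ dom i) (s : ∀ i, Option (dom i)) : ∀ i, Option (dom i) :=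
  fun i => (s (σ i)).map (e i)

theorem pullback_surjective (e : ∀ i, dom (σ i) ≃ dom i) : Function.Surjective (pullback e) := by
  intro s
  refine ⟨Equiv.piCongrLeft (fun j => Option (dom j)) σ fun i => (s i).map (e i).symm, ?_⟩
  funext i
  simp [pullback, Equiv.piCongrLeft_apply_apply]

/-- Rename the indices of a tensor along a permutation of the indices. -/
def Tensor.rename (e : ∀ i, dom (σ i) ≃ dom i) (A : Tensor dom) : Tensor dom where
  idx := A.idx.map σ.toEmbedding
  val τ := A.val fun i => e i (τ ⟨σ i, Finset.mem_map_of_mem σ.toEmbedding i.2⟩)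

theorem Tensor.ev_rename (e : ∀ i, dom (σ i) ≃ dom i) (A : Tensor dom)
    (s : ∀ i, Option (dom i)) : (A.rename e).ev s = A.ev (pullback e s) := by
  by_cases h : ∀ j : (A.rename e).idx, ∃ x : dom j, s j = some x
  · choose τ hτ using h
    rw [(A.rename e).ev_of_eq_some hτ]
    refine (A.ev_of_eq_some fun i => ?_).symm
    have := hτ ⟨σ i, Finset.mem_map_of_mem σ.toEmbedding i.2⟩
    simp only at this
    simp only [pullback, this, Option.map_some]
    rfl
  · push Not at h
    obtain ⟨⟨j, hj⟩, h⟩ := h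
    have hn : s j = none := Option.eq_none_iff_forall_ne_some.2 fun x hx => h x hx
    rw [(A.rename e).ev_of_eq_none hj hn]
    obtain ⟨i, hi, rfl⟩ := Finset.mem_map.1 hj
    refine (A.ev_of_eq_none hi ?_).symm
    simp only [Equiv.coe_toEmbedding] at hn
    simp [pullback, hn]

theorem Tensor.rename_injective (e : ∀ i, dom (σ i) ≃ dom i) :
    Function.Injective (Tensor.rename e) := by
  intro A B h
  refine Tensor.ext_ev (Finset.map_injective _ (congrArg Tensor.idx h)) fun s => ?_
  obtain ⟨s, rfl⟩ := pullback_surjective e s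
  rw [← Tensor.ev_rename, ← Tensor.ev_rename, h]

theorem sumOut_map [∀ i, Fintype (dom i)] (e : ∀ i, dom (σ i) ≃ dom i) (B : Finset Ind)
    (f : (∀ i, Option (dom i)) → ℂ) (s : ∀ i, Option (dom i)) :
    sumOut (B.map σ.toEmbedding) (fun s => f (pullback e s)) s = sumOut B f (pullback e s) := by
  classical
  refine Fintype.sum_bijective (fun ρ (i : B) =>
    e i (ρ ⟨σ i, Finset.mem_map_of_mem σ.toEmbedding i.2⟩)) ⟨?_, ?_⟩ _ _ ?_
  · intro ρ ρ' h
    funext ⟨j, hj⟩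
    obtain ⟨i, hi, rfl⟩ := Finset.mem_map.1 hj
    exact (e i).injective (congrFun h ⟨i, hi⟩)
  · intro ρ
    let E : B ≃ (B.map σ.toEmbedding : Finset Ind) := σ.subtypeEquiv fun i => by simp
    refine ⟨Equiv.piCongrLeft (fun j : (B.map σ.toEmbedding : Finset Ind) => dom j) E
      fun i : B => (e i).symm (ρ i), ?_⟩
    funext i
    have := Equiv.piCongrLeft_apply_apply (fun j : (B.map σ.toEmbedding : Finset Ind) => dom j) E
      (fun i : B => (e i).symm (ρ i)) i
    exact (congrArg (e i) this).trans ((e i).apply_symm_apply _)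
  · intro ρ
    refine congrArg f (funext fun i => ?_)
    unfold pullback
    by_cases hi : i ∈ B
    · rw [overwrite_of_mem hi, overwrite_of_mem (i := σ i) (Finset.mem_map_of_mem σ.toEmbedding hi)]
      rfl
    · rw [overwrite_of_notMem hi, overwrite_of_notMem (by simpa using hi)]

namespace TensorNetwork

open Classical in
theorem card_filter_rename (e : ∀ i, dom (σ i) ≃ dom i) (N : TensorNetwork dom) (i : Ind) :
    ((N.tensors.map ⟨_, Tensor.rename_injective e⟩).filter (fun A => σ i ∈ A.idx)).card =
      N.mult i := by
  rw [Finset.filter_map, Finset.card_map]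
  unfold mult
  congr 1
  refine Finset.filter_congr fun A _ => ?_
  simp [Tensor.rename]

/-- Rename the indices of a tensor network along a permutation of the indices. -/
def rename (e : ∀ i, dom (σ i) ≃ dom i) (N : TensorNetwork dom) : TensorNetwork dom where
  tensors := N.tensors.map ⟨_, Tensor.rename_injective e⟩
  nonempty := N.nonempty.map
  le_two i := by
    obtain ⟨i, rfl⟩ := σ.surjective i
    rw [card_filter_rename]
    exact N.le_two i

theorem mult_rename (e : ∀ i, dom (σ i) ≃ dom i) (N : TensorNetwork dom) (i : Ind) :
    (N.rename e).mult (σ i) = N.mult i :=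
  N.card_filter_rename e i

theorem free_rename (e : ∀ i, dom (σ i) ≃ dom i) (N : TensorNetwork dom) :
    (N.rename e).free = N.free.map σ.toEmbedding := by
  ext i
  obtain ⟨i, rfl⟩ := σ.surjective i
  simp [mem_free, mult_rename]

theorem bond_rename (e : ∀ i, dom (σ i) ≃ dom i) (N : TensorNetwork dom) :
    (N.rename e).bond = N.bond.map σ.toEmbedding := by
  ext i
  obtain ⟨i, rfl⟩ := σ.surjective i
  simp [mem_bond, mult_rename]

variable [∀ i, Fintype (dom i)]

theorem bondDim_rename (e : ∀ i, dom (σ i) ≃ dom i) (N : TensorNetwork dom) :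
    (N.rename e).bondDim = N.bondDim := by
  unfold bondDim
  rw [bond_rename, Finset.sup_map]
  exact Finset.sup_congr rfl fun i _ => Fintype.card_congr (e i)

/-- The condition `he` says that `e i` is the identity for free `i`. It is phrased through
assignments because `σ i = i` is not a definitional equality. -/
theorem contraction_rename (e : ∀ i, dom (σ i) ≃ dom i) (N : TensorNetwork dom)
    (hσ : ∀ i ∈ N.free, σ i = i)
    (he : ∀ i ∈ N.free, ∀ s : ∀ i, Option (dom i), (s (σ i)).map (e i) = s i) :
    (N.rename e).contraction = N.contraction := by
  refine Tensor.ext_ev ?_ fun s => ?_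
  · change (N.rename e).free = N.free
    rw [free_rename]
    ext j
    simp only [Finset.mem_map, Equiv.coe_toEmbedding]
    refine ⟨?_, fun hj => ⟨j, hj, hσ j hj⟩⟩
    rintro ⟨i, hi, rfl⟩
    rwa [hσ i hi]
  · have : N.contraction.ev s = N.contraction.ev (pullback e s) :=
      Tensor.dependsOn_ev _ fun i hi => (he i hi s).symm
    rw [this, ev_contraction, ev_contraction, bond_rename, ← sumOut_map]
    refine sumOut_congr (fun s => ?_) s
    simp only [rename, Finset.prod_map, Function.Embedding.coeFn_mk, Tensor.ev_rename]

end TensorNetwork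

/-- A permutation of all indices makes pulling back assignments surjective, hence renaming injective
on tensors. It is built as a product of swaps with fresh indices of equal domain size. -/
theorem exists_perm_disjoint [∀ i, Fintype (dom i)]
    (fresh : ∀ i : Ind, {j : Ind | Fintype.card (dom j) = Fintype.card (dom i)}.Infinite)
    (B F X : Finset Ind) (hBF : Disjoint B F) :
    ∃ σ : Ind ≃ Ind, (∀ i, Fintype.card (dom (σ i)) = Fintype.card (dom i)) ∧
      (∀ i ∈ F, σ i = i) ∧ ∀ i ∈ B, σ i ∉ X := by
  classical
  induction B using Finset.induction_on with
  | empty => exact ⟨Equiv.refl _, fun _ => rfl, fun _ _ => rfl, by simp⟩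
  | insert b B hb ih =>
    rw [Finset.disjoint_insert_left] at hBF
    obtain ⟨σ, hc, hF, hX⟩ := ih hBF.2
    -- As `j` also avoids `F` and the image of `B`, the swap disturbs nothing already arranged.
    obtain ⟨j, hj, hjn⟩ := (fresh b).exists_notMem_finset (X ∪ F ∪ B.map σ.toEmbedding)
    simp only [Finset.mem_union, Finset.mem_map, Equiv.coe_toEmbedding, not_or, not_exists,
      not_and] at hjn
    have hswap : ∀ i, i ≠ b → σ i ≠ j → Equiv.swap (σ b) j (σ i) = σ i := fun i h h' =>
      Equiv.swap_apply_of_ne_of_ne (fun h'' => h (σ.injective h'')) h'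
    refine ⟨σ.trans (Equiv.swap (σ b) j), fun i => ?_, fun i hi => ?_, fun i hi => ?_⟩
    · rw [Equiv.trans_apply, ← hc i, Equiv.swap_apply_def]
      have hj : Fintype.card (dom j) = Fintype.card (dom (σ b)) := hj.trans (hc b).symm
      split_ifs with h1 h2
      · rw [h1, hj]
      · rw [h2, hj]
      · rfl
    · rw [Equiv.trans_apply, hswap i (fun h => hBF.1 (h ▸ hi)), hF i hi]
      rw [hF i hi]
      exact fun h => hjn.1.2 (h ▸ hi)
    · rcases Finset.mem_insert.1 hi with rfl | hi
      · simpa using hjn.1.1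
      · rw [Equiv.trans_apply, hswap i (fun h => hb (h ▸ hi)) (hjn.2 i hi)]
        exact hX i hi

namespace TensorNetwork

theorem exists_rename_disjoint [∀ i, Fintype (dom i)]
    (fresh : ∀ i : Ind, {j : Ind | Fintype.card (dom j) = Fintype.card (dom i)}.Infinite)
    (N : TensorNetwork dom) (X : Finset Ind) :
    ∃ (σ : Ind ≃ Ind) (e : ∀ i, dom (σ i) ≃ dom i), (∀ i ∈ N.free, σ i = i) ∧
      (N.rename e).contraction = N.contraction ∧ Disjoint (N.rename e).bond X := by
  classical
  obtain ⟨σ, hc, hF, hX⟩ := exists_perm_disjoint fresh N.bond N.free X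
    (Finset.disjoint_right.2 fun i => notMem_bond_of_mem_free)
  -- On fixed indices the bijection must be the cast; an arbitrary one could permute the entries
  -- along free indices.
  let e : ∀ i, dom (σ i) ≃ dom i := fun i =>
    if h : σ i = i then Equiv.cast (congrArg dom h) else Fintype.equivOfCardEq (hc i)
  refine ⟨σ, e, hF, N.contraction_rename e hF fun i hi s => ?_, ?_⟩
  · have key : ∀ (j : Ind) (h : j = i), (s j).map (Equiv.cast (congrArg dom h)) = s i := by
      rintro _ rfl
      simp
    simp only [e, dif_pos (hF i hi)]
    exact key _ (hF i hi)
  · rw [bond_rename, Finset.disjoint_left]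
    intro j hj
    obtain ⟨i, hi, rfl⟩ := Finset.mem_map.1 hj
    exact hX i hi

end TensorNetwork

end Rename

/-- If suitable objects can be chosen with supports avoiding any given finite set, then they can be
chosen with pairwise disjoint supports. -/
theorem exists_pairwise_disjoint_choice {ι β γ : Type*} [Inhabited β] (s : Finset ι)
    (P : ι → β → Prop) (supp : β → Finset γ)
    (h : ∀ a ∈ s, ∀ X : Finset γ, ∃ b, P a b ∧ Disjoint (supp b) X) :
    ∃ f : ι → β, (∀ a ∈ s, P a (f a)) ∧
      ∀ a ∈ s, ∀ b ∈ s, a ≠ b → Disjoint (supp (f a)) (supp (f b)) := by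
  classical
  induction s using Finset.induction_on with
  | empty => exact ⟨fun _ => default, by simp, by simp⟩
  | insert a s ha ih =>
    obtain ⟨f, hf, hd⟩ := ih fun b hb => h b (Finset.mem_insert_of_mem hb)
    obtain ⟨x, hx, hxd⟩ := h a (Finset.mem_insert_self _ _) (s.biUnion fun b => supp (f b))
    rw [Finset.disjoint_biUnion_right] at hxd
    have hne : ∀ b ∈ s, b ≠ a := fun b hb h => ha (h ▸ hb)
    refine ⟨Function.update f a x, fun b hb => ?_, fun b hb c hc hbc => ?_⟩
    · rcases Finset.mem_insert.1 hb with rfl | hb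
      · simpa using hx
      · simpa [hne b hb] using hf b hb
    · rcases Finset.mem_insert.1 hb with rfl | hb' <;> rcases Finset.mem_insert.1 hc with rfl | hc'
      · exact absurd rfl hbc
      · simpa [hne c hc'] using hxd c hc'
      · simpa [hne b hb'] using (hxd b hb').symm
      · simpa [hne b hb', hne c hc'] using hd b hb' c hc' hbc

/-! ### The union of the factor networks. -/

section Union

variable {Ind : Type*} {dom : Ind → Type*}

namespace TensorNetwork

theorem mem_indices_of_mult_ne_zero {N : TensorNetwork dom} {i : Ind} (h : N.mult i ≠ 0) :
    i ∈ N.indices := by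
  classical
  obtain ⟨A, hA⟩ := Finset.card_pos.1 (Nat.pos_of_ne_zero h)
  exact N.mem_indices (Finset.mem_filter.1 hA).1 (Finset.mem_filter.1 hA).2

variable [∀ i, Fintype (dom i)]

/-- `F` factors each tensor of `N` into a network with fresh bond indices. -/
structure IsFactoring (N : TensorNetwork dom) (F : Tensor dom → TensorNetwork dom) : Prop where
  contraction_eq : ∀ A ∈ N.tensors, (F A).contraction = A
  disjoint_indices : ∀ A ∈ N.tensors, Disjoint (F A).bond N.indices
  disjoint_bond : ∀ A ∈ N.tensors, ∀ B ∈ N.tensors, A ≠ B → Disjoint (F A).bond (F B).bond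
  eq_or_exists_bond : ∀ A ∈ N.tensors, (F A).tensors = {A} ∨
    ∀ B ∈ (F A).tensors, ∃ i ∈ B.idx, i ∈ (F A).bond

namespace IsFactoring

variable {N : TensorNetwork dom} {F : Tensor dom → TensorNetwork dom}

theorem free_eq (h : N.IsFactoring F) {A : Tensor dom} (hA : A ∈ N.tensors) : (F A).free = A.idx :=
  congrArg Tensor.idx (h.contraction_eq A hA)

theorem mem_idx_or_mem_bond (h : N.IsFactoring F) {A : Tensor dom} (hA : A ∈ N.tensors) {i : Ind}
    (hi : i ∈ (F A).indices) : i ∈ A.idx ∨ i ∈ (F A).bond := by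
  rw [← h.free_eq hA]
  exact mem_free_or_mem_bond hi

theorem eq_of_mem_bond (h : N.IsFactoring F) {A B : Tensor dom} (hA : A ∈ N.tensors)
    (hB : B ∈ N.tensors) {i : Ind}
    (hi : i ∈ (F A).bond) (hi' : i ∈ (F B).indices) : A = B := by
  by_contra hne
  rcases h.mem_idx_or_mem_bond hB hi' with h' | h'
  · exact Finset.disjoint_left.1 (h.disjoint_indices A hA) hi (N.mem_indices hB h')
  · exact Finset.disjoint_left.1 (h.disjoint_bond A hA B hB hne) hi h'

/-- Networks are sets, so different factors must not share a tensor. A bond index of `F A` occurs in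
no other factor and tells its tensors apart; tensors left whole are distinct as members of `N`. -/
theorem disjoint_tensors (h : N.IsFactoring F) {A B : Tensor dom} (hA : A ∈ N.tensors)
    (hB : B ∈ N.tensors)
    (hne : A ≠ B) : Disjoint (F A).tensors (F B).tensors := by
  rw [Finset.disjoint_left]
  intro C hC hC'
  rcases h.eq_or_exists_bond A hA with hA' | hA'
  · rcases h.eq_or_exists_bond B hB with hB' | hB'
    · rw [hA', Finset.mem_singleton] at hC
      rw [hB', Finset.mem_singleton] at hC'
      exact hne (hC.symm.trans hC')
    · obtain ⟨i, hi, hib⟩ := hB' C hC'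
      exact hne (h.eq_of_mem_bond hB hA hib ((F A).mem_indices hC hi)).symm
  · obtain ⟨i, hi, hib⟩ := hA' C hC
    exact hne (h.eq_of_mem_bond hA hB hib ((F B).mem_indices hC' hi))

open Classical in
theorem card_filter_biUnion (h : N.IsFactoring F) (i : Ind) :
    ((N.tensors.biUnion fun A => (F A).tensors).filter fun B => i ∈ B.idx).card =
      ∑ A ∈ N.tensors, (F A).mult i := by
  rw [Finset.filter_biUnion, Finset.card_biUnion]
  · rfl
  · exact fun A hA B hB hne => Finset.disjoint_filter_filter (h.disjoint_tensors hA hB hne)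

theorem sum_mult_of_mem_bond (h : N.IsFactoring F) {A : Tensor dom} (hA : A ∈ N.tensors) {i : Ind}
    (hi : i ∈ (F A).bond) : ∑ A ∈ N.tensors, (F A).mult i = 2 := by
  rw [Finset.sum_eq_single_of_mem A hA, mem_bond.1 hi]
  intro B hB hne
  by_contra h0
  exact hne (h.eq_of_mem_bond hA hB hi (mem_indices_of_mult_ne_zero h0)).symm

theorem sum_mult_of_notMem_bond (h : N.IsFactoring F) {i : Ind} (hi : ∀ A ∈ N.tensors, i ∉
    (F A).bond) :
    ∑ A ∈ N.tensors, (F A).mult i = N.mult i := by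
  classical
  unfold mult
  rw [Finset.card_filter]
  refine Finset.sum_congr rfl fun A hA => ?_
  change (F A).mult i = _
  split_ifs with hiA
  · rw [← mem_free, h.free_eq hA]
    exact hiA
  · by_contra h0
    rcases h.mem_idx_or_mem_bond hA (mem_indices_of_mult_ne_zero h0) with h' | h'
    · exact hiA h'
    · exact hi A hA h'

-- A bond index of some `F A` appears twice there and nowhere else, and all other indices keep their
-- multiplicity in `N`. Summing out the new bonds first turns each factor network back into its
-- tensor by the distributive law.
open Classical in
theorem exists_union (h : N.IsFactoring F) : ∃ M : TensorNetwork dom,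
    M.tensors = (N.tensors.biUnion fun A => (F A).tensors) ∧
    M.bond = N.bond ∪ N.tensors.biUnion (fun A => (F A).bond) ∧
    M.contraction = N.contraction := by
  have two (i : Ind) : ∑ A ∈ N.tensors, (F A).mult i ≤ 2 := by
    by_cases hi : ∃ A ∈ N.tensors, i ∈ (F A).bond
    · obtain ⟨A, hA, hi⟩ := hi
      exact (h.sum_mult_of_mem_bond hA hi).le
    · push Not at hi
      rw [h.sum_mult_of_notMem_bond hi]
      exact N.le_two i
  let M : TensorNetwork dom :=
    { tensors := N.tensors.biUnion fun A => (F A).tensors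
      nonempty := N.nonempty.biUnion fun A _ => (F A).nonempty
      le_two := fun i => by
        have := h.card_filter_biUnion i
        have h2 := two i
        rw [← this] at h2
        convert h2 }
  have hM (i : Ind) : M.mult i = ∑ A ∈ N.tensors, (F A).mult i := by
    rw [← h.card_filter_biUnion i]
    rfl
  have hbond : M.bond = N.bond ∪ N.tensors.biUnion fun A => (F A).bond := by
    ext i
    simp only [Finset.mem_union, Finset.mem_biUnion]
    rw [mem_bond, mem_bond, hM]
    by_cases hi : ∃ A ∈ N.tensors, i ∈ (F A).bond
    · obtain ⟨A, hA, hi⟩ := hi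
      simp only [h.sum_mult_of_mem_bond hA hi, true_iff]
      exact Or.inr ⟨A, hA, hi⟩
    · simp only [hi, or_false]
      push Not at hi
      rw [h.sum_mult_of_notMem_bond hi]
  refine ⟨M, rfl, hbond, Tensor.ext_ev ?_ fun σ => ?_⟩
  · change M.free = N.free
    ext i
    rw [mem_free, mem_free, hM]
    by_cases hi : ∃ A ∈ N.tensors, i ∈ (F A).bond
    · obtain ⟨A, hA, hi⟩ := hi
      have : i ∉ N.indices := Finset.disjoint_left.1 (h.disjoint_indices A hA) hi
      rw [h.sum_mult_of_mem_bond hA hi]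
      refine ⟨fun h => by omega, fun h1 => absurd ?_ this⟩
      exact mem_indices_of_mult_ne_zero (by omega)
    · push Not at hi
      rw [h.sum_mult_of_notMem_bond hi]
  · rw [ev_contraction, ev_contraction, hbond, sumOut_union]
    · refine sumOut_congr (fun σ => ?_) σ
      have hp (σ : ∀ i, Option (dom i)) : ∏ B ∈ M.tensors, B.ev σ =
          ∏ A ∈ N.tensors, ∏ B ∈ (F A).tensors, B.ev σ :=
        Finset.prod_biUnion fun A hA B hB hne => h.disjoint_tensors hA hB hne
      rw [sumOut_congr hp, sumOut_biUnion_prod (f := fun A σ => ∏ B ∈ (F A).tensors, B.ev σ)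
        (u := fun A => ((F A).indices : Set Ind))]
      · refine Finset.prod_congr rfl fun A hA => ?_
        rw [← ev_contraction, h.contraction_eq A hA]
      · exact fun A hA => dependsOn_prod (f := fun B : Tensor dom => B.ev)
          (fun B _ => B.dependsOn_ev) fun B hB i hi => (F A).mem_indices hB hi
      · exact fun A hA B hB hne i hi hi' => hne (h.eq_of_mem_bond hA hB hi hi')
      · exact h.disjoint_bond
    · rw [Finset.disjoint_biUnion_right]
      exact fun A hA => ((h.disjoint_indices A hA).mono_right N.bond_subset).symm

end IsFactoring

end TensorNetwork

end Union

/-! ### Rooted binary trees and their graphs. -/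

namespace RootedBinaryTree

variable {α : Type*}

open Classical in
/-- The subtrees of a rooted binary tree. -/
noncomputable def subtrees : RootedBinaryTree α → Finset (RootedBinaryTree α)
  | leaf a => {leaf a}
  | node l r => insert (node l r) (l.subtrees ∪ r.subtrees)

/-- `c` is one of the two immediate subtrees of `p`. -/
def IsChild (c p : RootedBinaryTree α) : Prop := ∃ d, p = node c d ∨ p = node d c

theorem mem_subtrees_leaf {S : RootedBinaryTree α} {a : α} :
    S ∈ (leaf a).subtrees ↔ S = leaf a := by simp [subtrees]

theorem mem_subtrees_node {S l r : RootedBinaryTree α} :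
    S ∈ (node l r).subtrees ↔ S = node l r ∨ S ∈ l.subtrees ∨ S ∈ r.subtrees := by
  simp [subtrees]

theorem self_mem_subtrees (S : RootedBinaryTree α) : S ∈ S.subtrees := by
  cases S <;> simp [subtrees]

theorem subtrees_subset {S R : RootedBinaryTree α} (h : S ∈ R.subtrees) :
    S.subtrees ⊆ R.subtrees := by
  induction R with
  | leaf a => rw [mem_subtrees_leaf.1 h]
  | node l r ihl ihr =>
    rcases mem_subtrees_node.1 h with rfl | h | h
    · exact subset_rfl
    · exact fun T hT => mem_subtrees_node.2 (Or.inr (Or.inl (ihl h hT)))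
    · exact fun T hT => mem_subtrees_node.2 (Or.inr (Or.inr (ihr h hT)))

theorem left_mem_subtrees {l r R : RootedBinaryTree α} (h : node l r ∈ R.subtrees) :
    l ∈ R.subtrees :=
  subtrees_subset h (mem_subtrees_node.2 (Or.inr (Or.inl l.self_mem_subtrees)))

theorem right_mem_subtrees {l r R : RootedBinaryTree α} (h : node l r ∈ R.subtrees) :
    r ∈ R.subtrees :=
  subtrees_subset h (mem_subtrees_node.2 (Or.inr (Or.inr r.self_mem_subtrees)))

theorem IsChild.mem_subtrees {c p R : RootedBinaryTree α} (h : IsChild c p) (hp : p ∈ R.subtrees) :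
    c ∈ R.subtrees := by
  obtain ⟨d, rfl | rfl⟩ := h
  · exact left_mem_subtrees hp
  · exact right_mem_subtrees hp

theorem leaves_le {S R : RootedBinaryTree α} (h : S ∈ R.subtrees) : S.leaves ≤ R.leaves := by
  induction R with
  | leaf a => rw [mem_subtrees_leaf.1 h]
  | node l r ihl ihr =>
    rcases mem_subtrees_node.1 h with rfl | h | h
    · exact le_rfl
    · exact (ihl h).trans (Multiset.le_add_right _ _)
    · exact (ihr h).trans (Multiset.le_add_left _ _)

theorem card_leaves_pos (S : RootedBinaryTree α) : 0 < S.leaves.card := by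
  induction S with
  | leaf a => simp [leaves]
  | node l r ihl ihr => simp [leaves, ihl]

theorem IsChild.card_lt {c p : RootedBinaryTree α} (h : IsChild c p) :
    c.leaves.card < p.leaves.card := by
  obtain ⟨d, rfl | rfl⟩ := h <;> have := d.card_leaves_pos <;> simp [leaves] <;> omega

theorem leaf_mem_subtrees {R : RootedBinaryTree α} {a : α} :
    leaf a ∈ R.subtrees ↔ a ∈ R.leaves := by
  induction R with
  | leaf b => simp [subtrees, leaves]
  | node l r ihl ihr => simp [subtrees, leaves, ihl, ihr]

theorem false_of_leaves_le {S l r : RootedBinaryTree α} (hd : (node l r).leaves.Nodup)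
    (hl : S.leaves ≤ l.leaves) (hr : S.leaves ≤ r.leaves) : False := by
  obtain ⟨a, ha⟩ := Multiset.card_pos_iff_exists_mem.1 S.card_leaves_pos
  exact Multiset.disjoint_left.1 (Multiset.nodup_add.1 hd).2.2 (Multiset.mem_of_le hl ha)
    (Multiset.mem_of_le hr ha)

theorem exists_isChild {S R : RootedBinaryTree α} (h : S ∈ R.subtrees) (hne : S ≠ R) :
    ∃ p ∈ R.subtrees, IsChild S p := by
  induction R with
  | leaf a => exact absurd (mem_subtrees_leaf.1 h) hne
  | node l r ihl ihr =>
    rcases mem_subtrees_node.1 h with h | h | h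
    · exact absurd h hne
    · by_cases hl : S = l
      · exact ⟨node l r, self_mem_subtrees _, r, Or.inl (by rw [hl])⟩
      · obtain ⟨p, hp, hc⟩ := ihl h hl
        exact ⟨p, mem_subtrees_node.2 (Or.inr (Or.inl hp)), hc⟩
    · by_cases hl : S = r
      · exact ⟨node l r, self_mem_subtrees _, l, Or.inr (by rw [hl])⟩
      · obtain ⟨p, hp, hc⟩ := ihr h hl
        exact ⟨p, mem_subtrees_node.2 (Or.inr (Or.inr hp)), hc⟩

theorem IsChild.leaves_le {c p : RootedBinaryTree α} (h : IsChild c p) : c.leaves ≤ p.leaves :=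
  RootedBinaryTree.leaves_le (h.mem_subtrees p.self_mem_subtrees)

theorem not_isChild_of_mem {c l r p : RootedBinaryTree α} (hd : (node l r).leaves.Nodup)
    (hp : p ∈ l.subtrees ∨ p ∈ r.subtrees) (hc : IsChild c p) : ¬ IsChild c (node l r) := by
  rintro ⟨d, h | h⟩ <;> cases h <;> rcases hp with hp | hp
  · exact absurd hc.card_lt (not_lt.2 (Multiset.card_le_card (RootedBinaryTree.leaves_le hp)))
  · exact false_of_leaves_le hd le_rfl (hc.leaves_le.trans (RootedBinaryTree.leaves_le hp))
  · exact false_of_leaves_le hd (hc.leaves_le.trans (RootedBinaryTree.leaves_le hp)) le_rfl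
  · exact absurd hc.card_lt (not_lt.2 (Multiset.card_le_card (RootedBinaryTree.leaves_le hp)))

/-- With distinct leaves a subtree occurs at only one place, so the set of subtrees faithfully
represents the nodes. -/
theorem isChild_unique {c p p' R : RootedBinaryTree α} (hd : R.leaves.Nodup)
    (hp : p ∈ R.subtrees) (hp' : p' ∈ R.subtrees) (hc : IsChild c p) (hc' : IsChild c p') :
    p = p' := by
  induction R with
  | leaf a => rw [mem_subtrees_leaf.1 hp, mem_subtrees_leaf.1 hp']
  | node l r ihl ihr =>
    have hd' := Multiset.nodup_add.1 hd
    rcases mem_subtrees_node.1 hp with h | h <;> rcases mem_subtrees_node.1 hp' with h' | h'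
    · rw [h, h']
    · exact absurd (h ▸ hc) (not_isChild_of_mem hd h' hc')
    · exact absurd (h' ▸ hc') (not_isChild_of_mem hd h hc)
    · rcases h with h | h <;> rcases h' with h' | h'
      · exact ihl hd'.1 h h'
      · exact (false_of_leaves_le hd (hc.leaves_le.trans (RootedBinaryTree.leaves_le h))
          (hc'.leaves_le.trans (RootedBinaryTree.leaves_le h'))).elim
      · exact (false_of_leaves_le hd (hc'.leaves_le.trans (RootedBinaryTree.leaves_le h'))
          (hc.leaves_le.trans (RootedBinaryTree.leaves_le h))).elim
      · exact ihr hd'.2.1 h h'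

/-- The graph of a rooted binary tree: the vertices are the subtrees, and each is adjacent to its
immediate subtrees. -/
def graph (R : RootedBinaryTree α) : SimpleGraph {S // S ∈ R.subtrees} where
  Adj u v := IsChild u.1 v.1 ∨ IsChild v.1 u.1
  symm := ⟨fun _ _ h => h.symm⟩
  loopless := ⟨fun _ h => by rcases h with h | h <;> exact lt_irrefl _ h.card_lt⟩

theorem graph_reachable (R : RootedBinaryTree α) (T : RootedBinaryTree α) (hT : T ∈ R.subtrees)
    (S : RootedBinaryTree α) (hS : S ∈ T.subtrees) :
    R.graph.Reachable ⟨S, subtrees_subset hT hS⟩ ⟨T, hT⟩ := by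
  induction T with
  | leaf a =>
    obtain rfl := mem_subtrees_leaf.1 hS
    rfl
  | node l r ihl ihr =>
    rcases mem_subtrees_node.1 hS with rfl | h | h
    · rfl
    · exact (ihl (left_mem_subtrees hT) h).trans (SimpleGraph.Adj.reachable (Or.inl ⟨r, Or.inl rfl⟩))
    · exact (ihr (right_mem_subtrees hT) h).trans
        (SimpleGraph.Adj.reachable (Or.inl ⟨l, Or.inr rfl⟩))

theorem graph_connected (R : RootedBinaryTree α) : R.graph.Connected := by
  have h (S : {S // S ∈ R.subtrees}) : R.graph.Reachable S ⟨R, R.self_mem_subtrees⟩ :=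
    R.graph_reachable R R.self_mem_subtrees S S.2
  exact { preconnected := fun u v => (h u).trans (h v).symm, nonempty := ⟨⟨R, R.self_mem_subtrees⟩⟩ }

/-- By counting: each edge joins a node other than the root to its unique parent, so there are fewer
edges than vertices, and the graph is connected. -/
theorem graph_isTree {R : RootedBinaryTree α} (hd : R.leaves.Nodup) : R.graph.IsTree := by
  classical
  rw [SimpleGraph.isTree_iff_connected_and_card]
  refine ⟨R.graph_connected, le_antisymm ?_ R.graph_connected.card_vert_le_card_edgeSet_add_one⟩
  have hp (S : {S // S ∈ R.subtrees}) : ∃ p : {S // S ∈ R.subtrees}, S.1 ≠ R → IsChild S.1 p.1 := by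
    by_cases h : S.1 = R
    · exact ⟨S, fun h' => absurd h h'⟩
    · obtain ⟨p, hp, hc⟩ := exists_isChild S.2 h
      exact ⟨⟨p, hp⟩, fun _ => hc⟩
  choose p hp using hp
  let r : {S // S ∈ R.subtrees} := ⟨R, R.self_mem_subtrees⟩
  have key {u v : {S // S ∈ R.subtrees}} (h : IsChild u.1 v.1) : u ≠ r ∧ v = p u := by
    have hu : u.1 ≠ R := fun hu => by
      have := h.card_lt
      have := Multiset.card_le_card (RootedBinaryTree.leaves_le v.2)
      rw [hu] at *
      omega
    exact ⟨fun h' => hu (congrArg Subtype.val h'),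
      Subtype.ext (isChild_unique hd v.2 (p u).2 h (hp u hu))⟩
  have hsub : R.graph.edgeSet ⊆ (fun v => s(v, p v)) '' ({r}ᶜ : Set _) := by
    rintro ⟨u, v⟩ h
    rcases (h : IsChild u.1 v.1 ∨ IsChild v.1 u.1) with h | h
    · obtain ⟨hu, hv⟩ := key h
      exact ⟨u, hu, congrArg (fun x => s(u, x)) hv.symm⟩
    · obtain ⟨hu, hv⟩ := key h
      exact ⟨v, hu, (congrArg (fun x => s(v, x)) hv.symm).trans Sym2.eq_swap⟩
  have h1 := (Set.ncard_le_ncard hsub (Set.toFinite _)).trans (Set.ncard_image_le (Set.toFinite _))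
  have h2 := Set.ncard_add_ncard_compl ({r} : Set {S // S ∈ R.subtrees})
  rw [Set.ncard_singleton] at h2
  change R.graph.edgeSet.ncard + 1 ≤ _
  omega

/-- An inner node has two distinct children, so even the root has degree two; tree factorability
admits trees with such vertices. A lone leaf would have degree zero, hence the bound on the number
of leaves. -/
theorem isTreeLeaf_graph_iff {R : RootedBinaryTree α} (hd : R.leaves.Nodup)
    (hR : 1 < R.leaves.card) {v : {S // S ∈ R.subtrees}} :
    IsTreeLeaf R.graph v ↔ ∃ a, v.1 = leaf a := by
  obtain ⟨S, hS⟩ := v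
  unfold IsTreeLeaf
  rcases S with a | ⟨l, r⟩
  · refine iff_of_true ?_ ⟨a, rfl⟩
    obtain ⟨p, hp, hc⟩ := exists_isChild hS (by rintro rfl; simp [leaves] at hR)
    rw [Set.ncard_eq_one]
    refine ⟨⟨p, hp⟩, Set.eq_singleton_iff_unique_mem.2 ⟨Or.inl hc, ?_⟩⟩
    rintro ⟨q, hq⟩ (h | ⟨d, h | h⟩)
    · exact Subtype.ext (isChild_unique hd hq hp h hc)
    · cases h
    · cases h
  · refine iff_of_false ?_ (by simp)
    intro h
    rw [Set.ncard_eq_one] at h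
    obtain ⟨x, hx⟩ := h
    have h1 : (⟨l, left_mem_subtrees hS⟩ : {S // S ∈ R.subtrees}) ∈
      R.graph.neighborSet ⟨node l r, hS⟩ := Or.inr ⟨r, Or.inl rfl⟩
    have h2 : (⟨r, right_mem_subtrees hS⟩ : {S // S ∈ R.subtrees}) ∈
      R.graph.neighborSet ⟨node l r, hS⟩ := Or.inr ⟨l, Or.inr rfl⟩
    rw [hx] at h1 h2
    have : l = r := congrArg Subtype.val (h1.trans h2.symm)
    subst this
    have hd' := Multiset.nodup_of_le (RootedBinaryTree.leaves_le hS) hd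
    exact false_of_leaves_le hd' le_rfl le_rfl

end RootedBinaryTree

/-! ### Index sets modulo two. -/

section Chi

variable {Ind : Type*}

/-- The indicator vector modulo two of a set of indices. -/
noncomputable def chi (s : Finset Ind) : Ind →₀ ZMod 2 := Finsupp.indicator s fun _ _ => 1

open Classical in
theorem chi_apply (s : Finset Ind) (i : Ind) : chi s i = if i ∈ s then 1 else 0 := by
  simp [chi, Finsupp.indicator_apply]

theorem support_chi (s : Finset Ind) : (chi s).support = s := by
  classical
  ext i
  simp [chi_apply]

theorem chi_empty : chi (∅ : Finset Ind) = 0 := by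
  classical
  ext i
  simp [chi_apply]

/-- This makes contraction additive on index vectors. -/
theorem chi_symmDiff [DecidableEq Ind] (s t : Finset Ind) :
    chi (symmDiff s t) = chi s + chi t := by
  classical
  ext i
  simp only [Finsupp.add_apply, chi_apply, Finset.mem_symmDiff]
  by_cases hs : i ∈ s <;> by_cases ht : i ∈ t <;> simp [hs, ht, CharTwo.add_self_eq_zero]

theorem chi_union [DecidableEq Ind] {s t : Finset Ind} (h : Disjoint s t) :
    chi (s ∪ t) = chi s + chi t := by
  rw [← chi_symmDiff, h.symmDiff_eq_sup]
  rfl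

theorem add_self_finsupp_zmod_two (x : Ind →₀ ZMod 2) : x + x = 0 := by
  ext i
  simp [CharTwo.add_self_eq_zero]

end Chi

/-! ### Factoring a tensor along a rooted binary tree. -/

section Factorization

variable {Ind : Type*} {dom : Ind → Type*}

open TensorNetwork

theorem SimpleGraph.Iso.ncard_neighborSet {V W : Type*} {G : SimpleGraph V} {H : SimpleGraph W}
    (e : G ≃g H) (v : V) : (H.neighborSet (e v)).ncard = (G.neighborSet v).ncard := by
  have : H.neighborSet (e v) = e '' G.neighborSet v := by
    ext w
    obtain ⟨w, rfl⟩ := e.surjective w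
    simp [e.map_adj_iff]
  rw [this, Set.ncard_image_of_injective _ e.injective]

/-- A network of the shape of the tree `T`, with the tensors given by `g`, in which each index `i`
appears at the node `leaf i`. -/
structure IsTreeShaped {V ι : Type*} (T : SimpleGraph V) (M : TensorNetwork dom)
    (g : V → Tensor dom) (j : ι → Ind) (leaf : ι → V) : Prop where
  injective : Function.Injective g
  mem_tensors : ∀ B, B ∈ M.tensors ↔ ∃ v, g v = B
  existsUnique : ∀ u v, T.Adj u v → ∃! i, i ∈ (g u).idx ∧ i ∈ (g v).idx
  adj : ∀ u v, u ≠ v → ∀ i, i ∈ (g u).idx → i ∈ (g v).idx → T.Adj u v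
  mem_leaf : ∀ i, j i ∈ (g (leaf i)).idx

/-- Tree factorability in terms of incidences alone, with the bonds made fresh for `X`. -/
theorem Tensor.TreeFactorable.exists_isTreeShaped [∀ i, Fintype (dom i)]
    (fresh : ∀ i : Ind, {j : Ind | Fintype.card (dom j) = Fintype.card (dom i)}.Infinite)
    {A : Tensor dom} (hA : A.TreeFactorable) {V : Type*} [Fintype V] {T : SimpleGraph V}
    (hT : T.IsTree) (leaf : A.idx ≃ {v : V // IsTreeLeaf T v}) (X : Finset Ind) :
    ∃ (M : TensorNetwork dom) (g : V → Tensor dom), M.contraction = A ∧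
      IsTreeShaped T M g (fun i : A.idx => i.1) (fun i => (leaf i).1) ∧
      (A.idx.Nonempty → ∃ i ∈ A.idx, M.bondDim ≤ Fintype.card (dom i)) ∧ Disjoint M.bond X := by
  classical
  -- Tree factorability speaks of vertex types in `Type` only, so the tree is transported to some
  -- `Fin n`.
  let φ := T.overFinIso rfl
  let leaf' : A.idx ≃ {v // IsTreeLeaf (T.overFin rfl) v} := leaf.trans
    (φ.toEquiv.subtypeEquiv fun v => by
      unfold IsTreeLeaf
      rw [← φ.ncard_neighborSet v]
      rfl)
  obtain ⟨M, g, hM, hg, hl, hb⟩ := hA _ _ (φ.isTree_iff.1 hT) leaf'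
  obtain ⟨σ, e, hσ, hc, hd⟩ := M.exists_rename_disjoint fresh X
  have hfree : M.free = A.idx := congrArg Tensor.idx hM
  have hlink (u v) (huv : u ≠ v) (hinj : Function.Injective g) (i : Ind) :
      (M.structureGraph.deleteVerts {none}).IsLink i (some (g u)) (some (g v)) ↔
      (g u ∈ M.tensors ∧ i ∈ (g u).idx) ∧ g v ∈ M.tensors ∧ i ∈ (g v).idx := by
    rw [Graph.deleteVerts_isLink]
    have : some (g u) ≠ some (g v) := fun h => huv (hinj (Option.some.inj h))
    simp [structureGraph, Incident, this]
  obtain ⟨⟨hmaps, hinjOn, hsurj⟩, hadj, hnadj⟩ := hg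
  rw [Graph.vertexSet_deleteVerts] at hmaps hsurj
  have hinj : Function.Injective g := fun u v h =>
    hinjOn (Set.mem_univ u) (Set.mem_univ v) (congrArg some h)
  have hmem (v) : g v ∈ M.tensors := by
    have := (hmaps (Set.mem_univ v)).1
    simpa [structureGraph] using this
  refine ⟨M.rename e, fun v => (g (φ v)).rename e, hc.trans hM, ⟨?_, ?_, ?_, ?_, ?_⟩, ?_, hd⟩
  · exact (Tensor.rename_injective e).comp (hinj.comp φ.injective)
  · intro B
    rw [show B ∈ (M.rename e).tensors ↔ ∃ C ∈ M.tensors, C.rename e = B from Finset.mem_map]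
    constructor
    · rintro ⟨C, hC, rfl⟩
      obtain ⟨v, -, hv⟩ := hsurj (show some C ∈ _ by simp [structureGraph, hC])
      obtain ⟨v, rfl⟩ := φ.surjective v
      exact ⟨v, by rw [Option.some.inj hv]⟩
    · rintro ⟨v, rfl⟩
      exact ⟨_, hmem _, rfl⟩
  · intro u v huv
    obtain ⟨i, hi, hu⟩ := hadj _ _ (φ.map_adj_iff.2 huv)
    have hne : φ u ≠ φ v := φ.injective.ne huv.ne
    simp only [hlink _ _ hne hinj, hmem, true_and] at hi hu
    refine ⟨σ i, by simpa [Tensor.rename] using hi, ?_⟩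
    intro k hk
    obtain ⟨k, rfl⟩ := σ.surjective k
    rw [hu k (by simpa [Tensor.rename] using hk)]
  · intro u v huv i hi hi'
    obtain ⟨i, rfl⟩ := σ.surjective i
    by_contra h
    have hne : φ u ≠ φ v := φ.injective.ne huv
    refine hnadj _ _ (fun h' => h (φ.map_adj_iff.1 h')) i ((hlink _ _ hne hinj i).2 ?_)
    simp [Tensor.rename] at hi hi'
    exact ⟨⟨hmem _, hi⟩, hmem _, hi'⟩
  · intro i
    have := hl i
    have h2 : σ i.1 = i.1 := hσ i.1 (by rw [hfree]; exact i.2)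
    rw [← h2]
    simp only [Tensor.rename]
    exact Finset.mem_map_of_mem _ this
  · rwa [bondDim_rename]

namespace IsTreeShaped

variable {V ι : Type*} {T : SimpleGraph V} {M : TensorNetwork dom} {g : V → Tensor dom}
  {j : ι → Ind} {leaf : ι → V}

theorem mem (h : IsTreeShaped T M g j leaf) (v : V) : g v ∈ M.tensors :=
    (h.mem_tensors _).2 ⟨v, rfl⟩

theorem mem_bond_of_mem (h : IsTreeShaped T M g j leaf) {u v : V} (huv : u ≠ v) {i : Ind}
    (hu : i ∈ (g u).idx)
    (hv : i ∈ (g v).idx) : i ∈ M.bond := by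
  classical
  rw [mem_bond]
  refine le_antisymm (M.le_two i) ?_
  exact Finset.one_lt_card.2 ⟨g u, Finset.mem_filter.2 ⟨h.mem u, hu⟩, g v,
    Finset.mem_filter.2 ⟨h.mem v, hv⟩, h.injective.ne huv⟩

theorem eq_of_mem (h : IsTreeShaped T M g j leaf) {u v w : V} (huv : u ≠ v) (huw : u ≠ w)
    {i : Ind} (hu : i ∈ (g u).idx)
    (hv : i ∈ (g v).idx) (hw : i ∈ (g w).idx) : v = w := by
  classical
  by_contra hvw
  exact absurd (M.le_two i) (not_le.2 (Finset.two_lt_card.2 ⟨g u,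
    Finset.mem_filter.2 ⟨h.mem u, hu⟩, g v, Finset.mem_filter.2 ⟨h.mem v, hv⟩, g w,
    Finset.mem_filter.2 ⟨h.mem w, hw⟩, h.injective.ne huv, h.injective.ne huw,
    h.injective.ne hvw⟩))

/-- A bond index has a second carrier, which must be adjacent to `v`. A free index sits at its
assigned leaf, and appearing anywhere else as well would make it a bond. -/
theorem mem_idx_cases (h : IsTreeShaped T M g j leaf) (hj : ∀ i ∈ M.free, ∃ a, j a = i) {v : V}
    {i : Ind} (hi : i ∈ (g v).idx) :
    (∃ u, T.Adj v u ∧ i ∈ (g u).idx) ∨ ∃ a, leaf a = v ∧ i = j a := by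
  classical
  rcases mem_free_or_mem_bond (M.mem_indices (h.mem v) hi) with hf | hb
  · right
    obtain ⟨a, rfl⟩ := hj i hf
    refine ⟨a, ?_, rfl⟩
    by_contra hne
    exact notMem_bond_of_mem_free hf (h.mem_bond_of_mem hne (h.mem_leaf a) hi)
  · left
    have hc : 1 < (M.tensors.filter fun A => i ∈ A.idx).card := by
      have := mem_bond.1 hb
      unfold mult at this
      omega
    obtain ⟨B, hB, hne⟩ := Finset.exists_mem_ne hc (g v)
    rw [Finset.mem_filter] at hB
    obtain ⟨u, rfl⟩ := (h.mem_tensors B).1 hB.1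
    have hne' : v ≠ u := fun h => hne (by rw [h])
    exact ⟨u, h.adj v u hne' i hi hB.2, hB.2⟩

theorem card_inter_le_one (h : IsTreeShaped T M g j leaf) [DecidableEq Ind] (u v : V)
    (huv : u ≠ v) :
    ((g u).idx ∩ (g v).idx).card ≤ 1 := by
  by_cases hadj : T.Adj u v
  · obtain ⟨i, -, hu⟩ := h.existsUnique u v hadj
    refine Finset.card_le_one.2 fun k hk l hl => ?_
    rw [hu k (Finset.mem_inter.1 hk), hu l (Finset.mem_inter.1 hl)]
  · rw [Finset.card_eq_zero.2]
    · exact zero_le_one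
    · refine Finset.eq_empty_of_forall_notMem fun i hi => hadj ?_
      exact h.adj u v huv i (Finset.mem_inter.1 hi).1 (Finset.mem_inter.1 hi).2

theorem disjoint_inter (h : IsTreeShaped T M g j leaf) [DecidableEq Ind] {u v w : V} (huv : u ≠ v)
    (huw : u ≠ w) (hvw : v ≠ w) :
    Disjoint ((g u).idx ∩ (g v).idx) ((g u).idx ∩ (g w).idx) := by
  rw [Finset.disjoint_left]
  intro i hi hi'
  rw [Finset.mem_inter] at hi hi'
  exact hvw (h.eq_of_mem huv huw hi.1 hi.2 hi'.2)

end IsTreeShaped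

variable [∀ i, Fintype (dom i)]

/-- A factorization of a tensor with the shape of the rooted binary tree `R`: the node `S` carries
the tensor `G S`, and `b S` is (the indicator vector of) the index joining it to its parent. -/
structure IsRootedFactorization (A : Tensor dom) (R : RootedBinaryTree Ind)
    (M : TensorNetwork dom) (G : RootedBinaryTree Ind → Tensor dom)
    (b : RootedBinaryTree Ind → Ind →₀ ZMod 2) : Prop where
  contraction_eq : M.contraction = A
  injOn : Set.InjOn G R.subtrees
  mem_tensors : ∀ B, B ∈ M.tensors ↔ ∃ S ∈ R.subtrees, G S = B
  exists_bond : ∀ B ∈ M.tensors, ∃ i ∈ B.idx, i ∈ M.bond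
  bondDim_le : ∃ i ∈ A.idx, M.bondDim ≤ Fintype.card (dom i)
  root : b R = 0
  card_le : ∀ S, (b S).support.card ≤ 1
  leaf : ∀ a, RootedBinaryTree.leaf a ∈ R.subtrees →
    chi (G (RootedBinaryTree.leaf a)).idx = b (RootedBinaryTree.leaf a) + chi {a}
  node : ∀ l r, RootedBinaryTree.node l r ∈ R.subtrees →
    chi (G (RootedBinaryTree.node l r)).idx = b (RootedBinaryTree.node l r) + (b l + b r)

-- Away from the root, `b S` is the common index of the tensors at `S` and at its parent. Each index
-- of a node is shared with a neighbour or is the outer index of a leaf, and none lies in three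
-- tensors; so the index set of a node is the disjoint union of its connections and, at a leaf, the
-- outer index.
open RootedBinaryTree in
theorem Tensor.TreeFactorable.exists_isRootedFactorization
    (fresh : ∀ i : Ind, {j : Ind | Fintype.card (dom j) = Fintype.card (dom i)}.Infinite)
    {A : Tensor dom} (hA : A.TreeFactorable) {R : RootedBinaryTree Ind}
    (hR : R.leaves = A.idx.val) (h2 : 1 < A.rank) (X : Finset Ind) :
    ∃ M G b, IsRootedFactorization A R M G b ∧ Disjoint M.bond X := by
  classical
  have hd : R.leaves.Nodup := hR ▸ A.idx.nodup
  have hc : 1 < R.leaves.card := by rw [hR]; exact h2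
  have hlm (i : Ind) : i ∈ A.idx ↔ RootedBinaryTree.leaf i ∈ R.subtrees := by
    rw [leaf_mem_subtrees, hR]
    rfl
  let lf : A.idx ≃ {v // IsTreeLeaf R.graph v} := Equiv.ofBijective
    (fun i => ⟨⟨RootedBinaryTree.leaf i.1, (hlm _).1 i.2⟩,
      (isTreeLeaf_graph_iff hd hc).2 ⟨_, rfl⟩⟩) <| by
    refine ⟨fun i k hik => ?_, fun v => ?_⟩
    · have : RootedBinaryTree.leaf i.1 = RootedBinaryTree.leaf k.1 :=
        congrArg (fun v => v.1.1) hik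
      exact Subtype.ext (RootedBinaryTree.leaf.inj this)
    · obtain ⟨a, ha⟩ := (isTreeLeaf_graph_iff hd hc).1 v.2
      exact ⟨⟨a, (hlm a).2 (ha ▸ v.1.2)⟩, Subtype.ext (Subtype.ext ha.symm)⟩
  obtain ⟨M, g, hM, h, hb, hX⟩ := hA.exists_isTreeShaped fresh (graph_isTree hd) lf X
  have hfree : M.free = A.idx := congrArg Tensor.idx hM
  have hj : ∀ i ∈ M.free, ∃ a : A.idx, a.1 = i := fun i hi => ⟨⟨i, hfree ▸ hi⟩, rfl⟩
  have hne {c q : RootedBinaryTree Ind} (h : IsChild c q) : c ≠ q := by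
    rintro rfl
    exact lt_irrefl _ h.card_lt
  have hpar (S : RootedBinaryTree Ind) : ∃ p, S ∈ R.subtrees ∧ S ≠ R →
      p ∈ R.subtrees ∧ IsChild S p := by
    by_cases hS : S ∈ R.subtrees ∧ S ≠ R
    · obtain ⟨p, hp, hc⟩ := exists_isChild hS.1 hS.2
      exact ⟨p, fun _ => ⟨hp, hc⟩⟩
    · exact ⟨S, fun h => absurd h hS⟩
  choose p hp using hpar
  have hchild {c q : RootedBinaryTree Ind} (hq : q ∈ R.subtrees) (h : IsChild c q) :
      c ∈ R.subtrees ∧ c ≠ R := by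
    refine ⟨h.mem_subtrees hq, fun hcR => ?_⟩
    have := h.card_lt
    have := Multiset.card_le_card (RootedBinaryTree.leaves_le hq)
    rw [hcR] at *
    omega
  let G : RootedBinaryTree Ind → Tensor dom := fun S => if h : S ∈ R.subtrees then g ⟨S, h⟩ else A
  have hG (v : {S // S ∈ R.subtrees}) : G v.1 = g v := dif_pos v.2
  let b : RootedBinaryTree Ind → Ind →₀ ZMod 2 := fun S =>
    if S ∈ R.subtrees ∧ S ≠ R then chi ((G S).idx ∩ (G (p S)).idx) else 0
  have hbp {c q : RootedBinaryTree Ind} (hq : q ∈ R.subtrees) (h : IsChild c q) :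
      b c = chi ((G c).idx ∩ (G q).idx) := by
    have hcR := hchild hq h
    have := hp c hcR
    simp only [b]
    rw [if_pos hcR, isChild_unique hd this.1 hq this.2 h]
  -- There are at least two leaves, so every node has a neighbour and every tensor a bond index.
  have hexists (v : {S // S ∈ R.subtrees}) : ∃ u, R.graph.Adj v u := by
    by_cases hv : v.1 = R
    · obtain ⟨S, hS⟩ := v
      rcases S with a | ⟨l, r⟩
      · simp only at hv
        rw [← hv] at hc
        simp [leaves] at hc
      · exact ⟨⟨l, left_mem_subtrees hS⟩, Or.inr ⟨r, Or.inl rfl⟩⟩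
    · obtain ⟨q, hq, hcq⟩ := exists_isChild v.2 hv
      exact ⟨⟨q, hq⟩, Or.inl hcq⟩
  refine ⟨M, G, b, ⟨hM, ?_, ?_, ?_, ?_, ?_, ?_, ?_, ?_⟩, hX⟩
  · intro S hS S' hS' hSS
    have := h.injective (((hG ⟨S, hS⟩).symm.trans hSS).trans (hG ⟨S', hS'⟩))
    exact congrArg Subtype.val this
  · intro B
    rw [h.mem_tensors]
    exact ⟨fun ⟨v, hv⟩ => ⟨v.1, v.2, (hG v).trans hv⟩,
      fun ⟨S, hS, hSB⟩ => ⟨⟨S, hS⟩, (hG ⟨S, hS⟩).symm.trans hSB⟩⟩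
  · intro B hB
    obtain ⟨v, rfl⟩ := (h.mem_tensors B).1 hB
    obtain ⟨u, hu⟩ := hexists v
    obtain ⟨i, hi, -⟩ := h.existsUnique v u hu
    exact ⟨i, hi.1, h.mem_bond_of_mem hu.ne hi.1 hi.2⟩
  · exact hb (Finset.card_pos.1 (Nat.zero_lt_of_lt h2))
  · simp [b]
  · intro S
    simp only [b]
    split_ifs with hS
    · have := hp S hS
      rw [support_chi, hG ⟨S, hS.1⟩, hG ⟨p S, this.1⟩]
      exact h.card_inter_le_one _ _ fun h' => hne this.2 (congrArg Subtype.val h')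
    · simp
  · intro a ha
    have hq := hp _ ⟨ha, fun haR => by rw [← haR] at hc; simp [leaves] at hc⟩
    have haA : a ∈ (G (.leaf a)).idx := by
      rw [hG ⟨_, ha⟩]
      exact h.mem_leaf ⟨a, (hlm a).2 ha⟩
    -- The index `a` is free, so the parent cannot carry it too.
    have haq : a ∉ (G (p (.leaf a))).idx := by
      intro haq
      rw [hG ⟨_, ha⟩] at haA
      rw [hG ⟨_, hq.1⟩] at haq
      refine notMem_bond_of_mem_free (N := M) (i := a) (by rw [hfree]; exact (hlm a).2 ha)
        (h.mem_bond_of_mem (fun h' => hne hq.2 (congrArg Subtype.val h')) haA haq)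
    rw [hbp hq.1 hq.2, ← chi_union]
    · congr 1
      ext i
      simp only [Finset.mem_union, Finset.mem_inter, Finset.mem_singleton]
      refine ⟨fun hi => ?_, fun hi => hi.elim (fun h => h.1) fun h => h ▸ haA⟩
      rw [hG ⟨_, ha⟩] at hi
      rcases h.mem_idx_cases hj hi with ⟨⟨u, hu⟩, hau | ⟨d, hau | hau⟩, hiu⟩ | ⟨k, hk, hik⟩
      · obtain rfl := isChild_unique hd hu hq.1 hau hq.2
        left
        rw [hG ⟨_, ha⟩, hG ⟨_, hu⟩]
        exact ⟨hi, hiu⟩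
      · cases hau
      · cases hau
      · right
        have : RootedBinaryTree.leaf k.1 = RootedBinaryTree.leaf a := congrArg Subtype.val hk
        rw [hik, RootedBinaryTree.leaf.inj this]
    · simp [haq]
  · intro l r hlr
    have hl : IsChild l (.node l r) := ⟨r, Or.inl rfl⟩
    have hr : IsChild r (.node l r) := ⟨l, Or.inr rfl⟩
    have hlm := left_mem_subtrees hlr
    have hrm := right_mem_subtrees hlr
    have hlr_ne : l ≠ r := by
      rintro rfl
      exact false_of_leaves_le (Multiset.nodup_of_le (RootedBinaryTree.leaves_le hlr) hd) le_rfl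
        le_rfl
    have hcases {i : Ind} (hi : i ∈ (G (.node l r)).idx) : (i ∈ (G l).idx ∨ i ∈ (G r).idx) ∨
        ∃ q ∈ R.subtrees, IsChild (.node l r) q ∧ i ∈ (G q).idx := by
      rw [hG ⟨_, hlr⟩] at hi
      rcases h.mem_idx_cases hj hi with ⟨⟨u, hu⟩, hau | ⟨d, hau | hau⟩, hiu⟩ | ⟨k, hk, hik⟩
      · right
        exact ⟨u, hu, hau, (hG ⟨u, hu⟩).symm ▸ hiu⟩
      · left; left
        cases hau
        exact (hG ⟨u, hu⟩).symm ▸ hiu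
      · left; right
        cases hau
        exact (hG ⟨u, hu⟩).symm ▸ hiu
      · have : RootedBinaryTree.leaf k.1 = RootedBinaryTree.node l r := congrArg Subtype.val hk
        cases this
    have hdis {u v w : RootedBinaryTree Ind} (hu : u ∈ R.subtrees) (hv : v ∈ R.subtrees)
        (hw : w ∈ R.subtrees) (huv : u ≠ v) (huw : u ≠ w) (hvw : v ≠ w) :
        Disjoint ((G u).idx ∩ (G v).idx) ((G u).idx ∩ (G w).idx) := by
      rw [hG ⟨u, hu⟩, hG ⟨v, hv⟩, hG ⟨w, hw⟩]
      exact h.disjoint_inter (fun h => huv (congrArg Subtype.val h))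
        (fun h => huw (congrArg Subtype.val h)) (fun h => hvw (congrArg Subtype.val h))
    have hdlr := hdis hlr hlm hrm (hne hl).symm (hne hr).symm hlr_ne
    rw [hbp hlr hl, hbp hlr hr, Finset.inter_comm (G l).idx, Finset.inter_comm (G r).idx,
      ← chi_union hdlr]
    by_cases hroot : RootedBinaryTree.node l r = R
    · have hb0 : b (.node l r) = 0 := by simp [b, hroot]
      rw [hb0, zero_add]
      congr 1
      ext i
      simp only [Finset.mem_union, Finset.mem_inter]
      refine ⟨fun hi => ?_, fun hi => hi.elim (fun h => h.1) fun h => h.1⟩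
      rcases hcases hi with (h1 | h1) | ⟨q, hq, hcq, -⟩
      · exact Or.inl ⟨hi, h1⟩
      · exact Or.inr ⟨hi, h1⟩
      · exact absurd hroot (hchild hq hcq).2
    · have hq := hp _ ⟨hlr, hroot⟩
      have hlt := hq.2.card_lt
      have hlq : l ≠ p (.node l r) := fun h' => by
        have := hl.card_lt
        rw [← h'] at hlt
        omega
      have hrq : r ≠ p (.node l r) := fun h' => by
        have := hr.card_lt
        rw [← h'] at hlt
        omega
      rw [hbp hq.1 hq.2, ← chi_union]
      · congr 1
        ext i
        simp only [Finset.mem_union, Finset.mem_inter]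
        refine ⟨fun hi => ?_, fun hi => hi.elim (fun h => h.1) fun h => h.elim (·.1) (·.1)⟩
        rcases hcases hi with (h1 | h1) | ⟨q, hq', hcq, hiq⟩
        · exact Or.inr (Or.inl ⟨hi, h1⟩)
        · exact Or.inr (Or.inr ⟨hi, h1⟩)
        · rw [isChild_unique hd hq' hq.1 hcq hq.2] at hiq
          exact Or.inl ⟨hi, hiq⟩
      · rw [Finset.disjoint_union_right]
        exact ⟨hdis hlr hq.1 hlm (hne hq.2) (hne hl).symm hlq.symm,
          hdis hlr hq.1 hrm (hne hq.2) (hne hr).symm hrq.symm⟩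

end Factorization

/-! ### Contracting along a tree of edges with small ranks. -/

section Contractible

variable {Ind α ν : Type*}

/-- The set `s` of (abstract) tensors, whose index vectors are given by `c`, can be contracted such
that all intermediate results have rank at most `W`. -/
inductive Contractible (c : α → Ind →₀ ZMod 2) (W : ℕ) : Finset α → Prop
  | empty : Contractible c W ∅
  | single (x : α) : (c x).support.card ≤ W → Contractible c W {x}
  | union [DecidableEq α] (s t : Finset α) : Disjoint s t → Contractible c W s →
      Contractible c W t → (∑ x ∈ s ∪ t, c x).support.card ≤ W → Contractible c W (s ∪ t)

/-- The sets `D v` are attached to `s` one tensor at a time, so every intermediate result comes from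
some `J' ⊆ J`; this is why `hJ` runs over subsets. -/
theorem Contractible.biUnion [DecidableEq α] [DecidableEq ν] {c : α → Ind →₀ ZMod 2} {W : ℕ}
    {s : Finset α} (hs : Contractible c W s) (J : Finset ν) (D : ν → Finset α)
    (hD : ∀ v ∈ J, (D v).card ≤ 1) (hc : ∀ v ∈ J, ∀ x ∈ D v, (c x).support.card ≤ W)
    (hsD : ∀ v ∈ J, Disjoint s (D v))
    (hDD : ∀ v ∈ J, ∀ u ∈ J, v ≠ u → Disjoint (D v) (D u))
    (hJ : ∀ J' ⊆ J, (∑ x ∈ s ∪ J'.biUnion D, c x).support.card ≤ W) :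
    Contractible c W (s ∪ J.biUnion D) := by
  induction J using Finset.induction_on with
  | empty => simpa using hs
  | insert v J hv ih =>
    have ih := ih (fun u hu => hD u (by simp [hu])) (fun u hu => hc u (by simp [hu]))
      (fun u hu => hsD u (by simp [hu]))
      (fun u hu u' hu' => hDD u (by simp [hu]) u' (by simp [hu']))
      (fun J' hJ' => hJ J' (hJ'.trans (Finset.subset_insert _ _)))
    have heq : s ∪ (insert v J).biUnion D = (s ∪ J.biUnion D) ∪ D v := by
      rw [Finset.biUnion_insert, Finset.union_comm (D v), Finset.union_assoc]
    have hle := hJ _ subset_rfl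
    rw [heq] at hle ⊢
    refine Contractible.union _ _ ?_ ih ?_ hle
    · rw [Finset.disjoint_union_left, Finset.disjoint_biUnion_left]
      exact ⟨hsD v (by simp), fun u hu => hDD u (by simp [hu]) v (by simp) fun h => hv (h ▸ hu)⟩
    · rcases Nat.le_one_iff_eq_zero_or_eq_one.1 (hD v (by simp)) with h | h
      · rw [Finset.card_eq_zero.1 h]
        exact Contractible.empty
      · obtain ⟨x, hx⟩ := Finset.card_eq_one.1 h
        rw [hx]
        exact Contractible.single x (hc v (by simp) x (by simp [hx]))

/-- The accounting of ranks: each vertex of `U` pays for one index, those of `J` for a second one.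
-/
theorem card_support_sum_le [DecidableEq ν] (𝒱 U J : Finset ν) (f : ν → Ind →₀ ZMod 2)
    (hU : ∀ v ∈ 𝒱, v ∉ U → f v = 0) (h1 : ∀ v ∈ 𝒱, v ∉ J → (f v).support.card ≤ 1)
    (h2 : ∀ v ∈ 𝒱, (f v).support.card ≤ 2) :
    (∑ v ∈ 𝒱, f v).support.card ≤ U.card + J.card := by
  classical
  calc (∑ v ∈ 𝒱, f v).support.card ≤ (𝒱.biUnion fun v => (f v).support).card :=
        Finset.card_le_card Finsupp.support_finsetSum
    _ ≤ ∑ v ∈ 𝒱, (f v).support.card := Finset.card_biUnion_le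
    _ ≤ ∑ v ∈ 𝒱, ((if v ∈ U then 1 else 0) + (if v ∈ J then 1 else 0)) := by
        refine Finset.sum_le_sum fun v hv => ?_
        by_cases hvU : v ∈ U
        · by_cases hvJ : v ∈ J
          · simpa [hvU, hvJ] using h2 v hv
          · simpa [hvU, hvJ] using h1 v hv hvJ
        · simp [hU v hv hvU]
    _ ≤ U.card + J.card := by
        rw [Finset.sum_add_distrib, ← Finset.card_filter, ← Finset.card_filter]
        exact add_le_add (Finset.card_le_card fun v hv => (Finset.mem_filter.1 hv).2)
          (Finset.card_le_card fun v hv => (Finset.mem_filter.1 hv).2)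

theorem card_support_add_le (x y : Ind →₀ ZMod 2) :
    (x + y).support.card ≤ x.support.card + y.support.card := by
  classical
  exact (Finset.card_le_card Finsupp.support_add).trans (Finset.card_union_le _ _)

theorem Finset.exists_split_three [DecidableEq ν] (K : Finset ν) (q : ℕ) (h : K.card ≤ 3 * q) :
    ∃ J₁ J₂ J₃ : Finset ν, J₁ ∪ J₂ ∪ J₃ = K ∧ Disjoint J₁ J₂ ∧ Disjoint (J₁ ∪ J₂) J₃ ∧
      J₁.card ≤ q ∧ J₂.card ≤ q ∧ J₃.card ≤ q := by
  obtain ⟨J₁, h1, hc1⟩ := Finset.exists_subset_card_eq (min_le_right q K.card)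
  obtain ⟨J₂, h2, hc2⟩ := Finset.exists_subset_card_eq (min_le_right q (K \ J₁).card)
  have hs1 := Finset.card_sdiff_of_subset h1
  have hs2 := Finset.card_sdiff_of_subset h2
  have hd : Disjoint J₁ J₂ := Finset.disjoint_left.2 fun v hv hv' => (Finset.mem_sdiff.1 (h2 hv')).2 hv
  refine ⟨J₁, J₂, (K \ J₁) \ J₂, ?_, hd, ?_, by omega, by omega, by omega⟩
  · ext v
    have := @h1 v
    have := @h2 v
    simp only [Finset.mem_union, Finset.mem_sdiff] at *
    tauto
  · rw [Finset.disjoint_left]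
    intro v
    simp only [Finset.mem_union, Finset.mem_sdiff]
    tauto

/-- The parts of `K` are meant for absorption on the left (`J₁`), on the right (`J₂`) and after the
join (`J₃`). Vertices outside `K` are cheap and go left or right according to `p`. -/
theorem Finset.exists_split_relative [DecidableEq ν] {𝒱 K : Finset ν} (hK : K ⊆ 𝒱) (q : ℕ)
    (h : K.card ≤ 3 * q) (p : ν → Prop) :
    ∃ L Q J₁ J₂ J₃ : Finset ν, J₁.card ≤ q ∧ J₂.card ≤ q ∧ J₃.card ≤ q ∧ L ⊆ 𝒱 ∧ Q ⊆ 𝒱 ∧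
      J₃ ⊆ 𝒱 ∧ (∀ v ∈ 𝒱, v ∈ L ∨ v ∈ Q ∨ v ∈ J₃) ∧ (∀ v ∈ L, v ∉ Q) ∧ (∀ v ∈ L, v ∉ J₃) ∧
      (∀ v ∈ Q, v ∉ J₃) ∧ (∀ v ∈ L, v ∉ J₁ → v ∉ K ∧ p v) ∧
      ∀ v ∈ Q, v ∉ J₂ → v ∉ K ∧ ¬ p v := by
  classical
  obtain ⟨J₁, J₂, J₃, rfl, h12, h3, hc1, hc2, hc3⟩ := K.exists_split_three q h
  refine ⟨J₁ ∪ (𝒱 \ (J₁ ∪ J₂ ∪ J₃)).filter p, J₂ ∪ (𝒱 \ (J₁ ∪ J₂ ∪ J₃)).filter fun v => ¬ p v,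
    J₁, J₂, J₃, hc1, hc2, hc3, fun v hv => ?_, fun v hv => ?_,
    fun v hv => hK (by simp [hv]), fun v hv => ?_, fun v hv => ?_, fun v hv => ?_, fun v hv => ?_,
    fun v hv => ?_, fun v hv => ?_⟩
  all_goals
    have hK := @hK v
    have h12 : v ∈ J₁ → v ∉ J₂ := fun h => Finset.disjoint_left.1 h12 h
    have h3 : v ∈ J₁ ∪ J₂ → v ∉ J₃ := fun h => Finset.disjoint_left.1 h3 h
    simp only [Finset.mem_union, Finset.mem_filter, Finset.mem_sdiff] at *
    tauto

/-- The tensors replacing a vertex with edges `E` are spread over the rooted binary tree `R` of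
edges: `H S` are those placed inside the subtree `S`, and `b S` is their connection, if any, to the
remaining ones. -/
structure IsSpread [DecidableEq Ind] [DecidableEq α] (c : α → Ind →₀ ZMod 2) (E : Finset Ind)
    (R : RootedBinaryTree Ind) (H : RootedBinaryTree Ind → Finset α)
    (b : RootedBinaryTree Ind → Ind →₀ ZMod 2) : Prop where
  card_leaf : ∀ a, RootedBinaryTree.leaf a ∈ R.subtrees → (H (.leaf a)).card ≤ 1
  left_subset : ∀ l r, RootedBinaryTree.node l r ∈ R.subtrees → H l ⊆ H (.node l r)
  right_subset : ∀ l r, RootedBinaryTree.node l r ∈ R.subtrees → H r ⊆ H (.node l r)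
  disjoint : ∀ l r, RootedBinaryTree.node l r ∈ R.subtrees → Disjoint (H l) (H r)
  card_node : ∀ l r, RootedBinaryTree.node l r ∈ R.subtrees →
    (H (.node l r) \ (H l ∪ H r)).card ≤ 1
  sum_eq : ∀ S ∈ R.subtrees, ∑ x ∈ H S, c x = b S + chi (E ∩ S.leaves.toFinset)
  card_le : ∀ S ∈ R.subtrees, (b S).support.card ≤ 1
  boundary : ∀ S ∈ R.subtrees, b S ≠ 0 → (∃ i ∈ E, i ∈ S.leaves) ∧ ∃ i ∈ E, i ∉ S.leaves

theorem IsSpread.subset_root [DecidableEq Ind] [DecidableEq α] {c : α → Ind →₀ ZMod 2}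
    {E : Finset Ind} {R : RootedBinaryTree Ind} {H : RootedBinaryTree Ind → Finset α}
    {b : RootedBinaryTree Ind → Ind →₀ ZMod 2} (h : IsSpread c E R H b)
    {T S : RootedBinaryTree Ind} (hT : T ∈ R.subtrees) (hS : S ∈ T.subtrees) : H S ⊆ H T := by
  induction T with
  | leaf a => rw [RootedBinaryTree.mem_subtrees_leaf.1 hS]
  | node l r ihl ihr =>
    rcases RootedBinaryTree.mem_subtrees_node.1 hS with rfl | hS | hS
    · rfl
    · exact (ihl (RootedBinaryTree.left_mem_subtrees hT) hS).trans (h.left_subset l r hT)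
    · exact (ihr (RootedBinaryTree.right_mem_subtrees hT) hS).trans (h.right_subset l r hT)

/-- The edges at the leaves of the node are those of `l` and `r` together and cancel modulo two;
only the three connections remain. -/
theorem IsSpread.sum_sdiff [DecidableEq Ind] [DecidableEq α] {c : α → Ind →₀ ZMod 2}
    {E : Finset Ind} {R : RootedBinaryTree Ind} {H : RootedBinaryTree Ind → Finset α}
    {b : RootedBinaryTree Ind → Ind →₀ ZMod 2} (h : IsSpread c E R H b)
    (hd : R.leaves.Nodup) {l r : RootedBinaryTree Ind}
    (hlr : RootedBinaryTree.node l r ∈ R.subtrees) :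
    ∑ x ∈ H (.node l r) \ (H l ∪ H r), c x = b (.node l r) + (b l + b r) := by
  have h1 := h.sum_eq _ hlr
  rw [← Finset.sum_sdiff (Finset.union_subset (h.left_subset l r hlr) (h.right_subset l r hlr)),
    Finset.sum_union (h.disjoint l r hlr), h.sum_eq l (RootedBinaryTree.left_mem_subtrees hlr),
    h.sum_eq r (RootedBinaryTree.right_mem_subtrees hlr)] at h1
  have h2 : chi (E ∩ (RootedBinaryTree.node l r).leaves.toFinset) =
      chi (E ∩ l.leaves.toFinset) + chi (E ∩ r.leaves.toFinset) := by
    rw [RootedBinaryTree.leaves, Multiset.toFinset_add, Finset.inter_union_distrib_left, chi_union]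
    have hd' := Multiset.nodup_add.1 (Multiset.nodup_of_le (RootedBinaryTree.leaves_le hlr) hd)
    refine Finset.disjoint_left.2 fun i hi hi' => ?_
    simp only [Finset.mem_inter, Multiset.mem_toFinset] at hi hi'
    exact Multiset.disjoint_left.1 hd'.2.2 hi.2 hi'.2
  rw [h2] at h1
  have hl := add_self_finsupp_zmod_two (b l)
  have hr := add_self_finsupp_zmod_two (b r)
  set X := ∑ x ∈ H (.node l r) \ (H l ∪ H r), c x
  have hX : X = b (.node l r) - b l - b r := by
    rw [eq_sub_of_add_eq h1]
    abel
  rw [hX, sub_eq_add_neg, sub_eq_add_neg, neg_eq_of_add_eq_zero_left hl,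
    neg_eq_of_add_eq_zero_left hr, add_assoc]

/-- Every edge is counted at both ends, which is zero modulo two. -/
theorem sum_chi_inter_eq_zero [DecidableEq Ind] {𝒱 : Finset ν} {E : ν → Finset Ind}
    {X : Finset Ind} (hE : ∀ i ∈ X, (𝒱.filter fun v => i ∈ E v).card = 2) :
    ∑ v ∈ 𝒱, chi (E v ∩ X) = 0 := by
  ext i
  rw [Finsupp.finsetSum_apply]
  simp only [chi_apply, Finset.mem_inter, Finsupp.coe_zero, Pi.zero_apply]
  by_cases hi : i ∈ X
  · simp only [hi, and_true]
    rw [Finset.sum_boole]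
    have := hE i hi
    rw [this]
    rfl
  · simp [hi]

/-- Induction over `R`. Once all pieces inside a subtree are contracted, its leaves have cancelled
and the result has vector `∑ v, b v S`. At an inner node the pieces located there are absorbed in
three groups, before and after the two sides are joined. -/
theorem contractible_of_isSpread [DecidableEq Ind] [DecidableEq α] [DecidableEq ν]
    {c : α → Ind →₀ ZMod 2} {𝒱 : Finset ν} {E : ν → Finset Ind} {R : RootedBinaryTree Ind}
    {H : ν → RootedBinaryTree Ind → Finset α} {b : ν → RootedBinaryTree Ind → Ind →₀ ZMod 2}
    {w W : ℕ} (hW3 : 3 ≤ W) (hW : w + 1 + (w + 3) / 3 ≤ W) (hd : R.leaves.Nodup)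
    (hs : ∀ v ∈ 𝒱, IsSpread c (E v) R (H v) (b v))
    (hdisj : ∀ v ∈ 𝒱, ∀ u ∈ 𝒱, v ≠ u → Disjoint (H v R) (H u R))
    (hc : ∀ v ∈ 𝒱, ∀ x ∈ H v R, (c x).support.card ≤ 3)
    (hE : ∀ i ∈ R.leaves, (𝒱.filter fun v => i ∈ E v).card = 2)
    (hbag : ∀ l r, RootedBinaryTree.node l r ∈ R.subtrees →
      (𝒱.filter fun v => b v l ≠ 0 ∨ b v r ≠ 0 ∨ b v (.node l r) ≠ 0).card ≤ w + 1)
    (S : RootedBinaryTree Ind) (hS : S ∈ R.subtrees) :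
    Contractible c W (𝒱.biUnion fun v => H v S) := by
  have hHR {v} (hv : v ∈ 𝒱) {T} (hT : T ∈ R.subtrees) : H v T ⊆ H v R :=
    (hs v hv).subset_root R.self_mem_subtrees hT
  have hsum {T} (hT : T ∈ R.subtrees) : ∑ x ∈ 𝒱.biUnion (fun v => H v T), c x =
      ∑ v ∈ 𝒱, b v T := by
    rw [Finset.sum_biUnion fun v hv u hu hvu =>
      (hdisj v hv u hu hvu).mono (hHR hv hT) (hHR hu hT)]
    rw [Finset.sum_congr rfl fun v hv => (hs v hv).sum_eq T hT, Finset.sum_add_distrib,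
      sum_chi_inter_eq_zero, add_zero]
    intro i hi
    exact hE i (Multiset.mem_of_le (RootedBinaryTree.leaves_le hT) (Multiset.mem_toFinset.1 hi))
  induction S with
  | leaf a =>
    have hS' := hS
    rw [RootedBinaryTree.leaf_mem_subtrees] at hS'
    rw [← Finset.empty_union (𝒱.biUnion _)]
    refine Contractible.biUnion Contractible.empty _ _
      (fun v hv => (hs v hv).card_leaf a hS)
      (fun v hv x hx => (hc v hv x (hHR hv hS hx)).trans hW3)
      (fun v _ => Finset.disjoint_empty_left _)
      (fun v hv u hu hvu => (hdisj v hv u hu hvu).mono (hHR hv hS) (hHR hu hS)) fun J hJ => ?_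
    rw [Finset.empty_union, Finset.sum_biUnion fun v hv u hu hvu =>
      (hdisj v (hJ hv) u (hJ hu) hvu).mono (hHR (hJ hv) hS) (hHR (hJ hu) hS),
      Finset.sum_congr rfl fun v hv => (hs v (hJ hv)).sum_eq _ hS, Finset.sum_add_distrib]
    -- The two ends of `a` have at most one connection each, and `a` itself may still be open: three
    -- indices.
    refine (card_support_add_le _ _).trans (le_trans (add_le_add (b := 2) (d := 1) ?_ ?_) hW3)
    · refine (card_support_sum_le J (𝒱.filter fun v => a ∈ E v) ∅ _ ?_ ?_ ?_).trans ?_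
      · intro v hv hva
        by_contra hne
        obtain ⟨i, hi, hia⟩ := ((hs v (hJ hv)).boundary _ hS hne).1
        rw [RootedBinaryTree.leaves, Multiset.mem_singleton] at hia
        exact hva (Finset.mem_filter.2 ⟨hJ hv, hia ▸ hi⟩)
      · exact fun v hv _ => (hs v (hJ hv)).card_le _ hS
      · exact fun v hv => ((hs v (hJ hv)).card_le _ hS).trans one_le_two
      · simp [hE a hS']
    · refine (Finset.card_le_card (t := {a}) fun i hi => ?_).trans (by simp)
      rw [Finsupp.mem_support_iff, Finsupp.finsetSum_apply] at hi
      obtain ⟨v, -, hv⟩ := Finset.exists_ne_zero_of_sum_ne_zero hi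
      rw [← Finsupp.mem_support_iff, support_chi] at hv
      simpa [RootedBinaryTree.leaves] using (Finset.mem_inter.1 hv).2
  | node l r ihl ihr =>
    have hl := RootedBinaryTree.left_mem_subtrees hS
    have hr := RootedBinaryTree.right_mem_subtrees hS
    have ihl := ihl hl
    have ihr := ihr hr
    set S := RootedBinaryTree.node l r with hSdef
    let D : ν → Finset α := fun v => H v S \ (H v l ∪ H v r)
    have hDR {v} (hv : v ∈ 𝒱) : D v ⊆ H v R := Finset.sdiff_subset.trans (hHR hv hS)
    have hDD {v} (hv : v ∈ 𝒱) {u} (hu : u ∈ 𝒱) (hvu : v ≠ u) : Disjoint (D v) (D u) :=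
      (hdisj v hv u hu hvu).mono (hDR hv) (hDR hu)
    have hD1 (v) (hv : v ∈ 𝒱) : (D v).card ≤ 1 := (hs v hv).card_node l r hS
    have hDW (v) (hv : v ∈ 𝒱) (x) (hx : x ∈ D v) : (c x).support.card ≤ W :=
      (hc v hv x (hDR hv hx)).trans hW3
    have hHD {T} (hT : T = l ∨ T = r) {v} (hv : v ∈ 𝒱) :
        Disjoint (𝒱.biUnion fun v => H v T) (D v) := by
      rw [Finset.disjoint_biUnion_left]
      intro u hu
      by_cases huv : u = v
      · subst huv
        rw [Finset.disjoint_left]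
        intro x hx hx'
        refine (Finset.mem_sdiff.1 hx').2 (Finset.mem_union.2 ?_)
        rcases hT with rfl | rfl
        · exact Or.inl hx
        · exact Or.inr hx
      · refine (hdisj u hu v hv huv).mono (hHR hu ?_) (hDR hv)
        rcases hT with rfl | rfl <;> assumption
    have hDsum {J} (hJ : J ⊆ 𝒱) : ∑ x ∈ J.biUnion D, c x =
        ∑ v ∈ 𝒱, if v ∈ J then b v S + (b v l + b v r) else 0 := by
      rw [Finset.sum_biUnion fun v hv u hu hvu => hDD (hJ hv) (hJ hu) hvu, ← Finset.sum_filter,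
        Finset.filter_mem_eq_inter, Finset.inter_eq_right.2 hJ]
      exact Finset.sum_congr rfl fun v hv => (hs v (hJ hv)).sum_sdiff hd hS
    have hsumT {T} (hT : T = l ∨ T = r) {J} (hJ : J ⊆ 𝒱) :
        ∑ x ∈ 𝒱.biUnion (fun v => H v T) ∪ J.biUnion D, c x =
        ∑ v ∈ 𝒱, (b v T + if v ∈ J then b v S + (b v l + b v r) else 0) := by
      rw [Finset.sum_union, hsum, hDsum hJ, Finset.sum_add_distrib]
      · rcases hT with rfl | rfl <;> assumption
      · rw [Finset.disjoint_biUnion_right]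
        exact fun v hv => hHD hT (hJ hv)
    -- The only vertices that can contribute to a result formed at this node.
    let U := 𝒱.filter fun v => b v l ≠ 0 ∨ b v r ≠ 0 ∨ b v S ≠ 0
    have hU : U.card ≤ w + 1 := hbag l r hS
    have hUz {v} (hv : v ∈ 𝒱) (hvU : v ∉ U) : b v l = 0 ∧ b v r = 0 ∧ b v S = 0 := by
      simp only [U, Finset.mem_filter, hv, true_and, not_or, not_not] at hvU
      exact hvU
    -- Only these can have a piece of rank three here, whose absorption trades one index for two.
    let K := 𝒱.filter fun v => b v l ≠ 0 ∧ b v r ≠ 0 ∧ b v S ≠ 0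
    have hKU : K ⊆ U := fun v hv => by
      simp only [K, U, Finset.mem_filter] at hv ⊢
      exact ⟨hv.1, Or.inl hv.2.1⟩
    have hKc := Finset.card_le_card hKU
    have hKV : K ⊆ 𝒱 := Finset.filter_subset _ _
    -- Here `(w + 3) / 3` is `⌈(w + 1) / 3⌉`. Outside `K`, a piece connected to `l` goes left: one
    -- of its two other connections vanishes, so absorbing it adds no index.
    obtain ⟨L, Q, J₁, J₂, J₃, hc1, hc2, hc3, hLV, hQV, hJ3V, hcover, hLQ, hL3, hQ3, hL, hQ⟩ :=
      Finset.exists_split_relative hKV ((w + 3) / 3) (by omega) fun v => b v l ≠ 0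
    have hKmem {v} (hv : v ∈ 𝒱) (hvK : v ∉ K) : b v l = 0 ∨ b v r = 0 ∨ b v S = 0 := by
      by_contra hcon
      simp only [not_or] at hcon
      exact hvK (Finset.mem_filter.2 ⟨hv, hcon⟩)
    have hbl {v} (hv : v ∈ 𝒱) := (hs v hv).card_le l hl
    have hbr {v} (hv : v ∈ 𝒱) := (hs v hv).card_le r hr
    have hbS {v} (hv : v ∈ 𝒱) := (hs v hv).card_le S hS
    have cancel (x y z : Ind →₀ ZMod 2) : x + (y + (x + z)) = y + z := by
      rw [show x + (y + (x + z)) = (x + x) + (y + z) by abel, add_self_finsupp_zmod_two, zero_add]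
    have hadd {x y : Ind →₀ ZMod 2} (hx : x.support.card ≤ 1) (hy : y.support.card ≤ 1) :
        (x + y).support.card ≤ 2 := (card_support_add_le x y).trans (add_le_add hx hy)
    have step1 : Contractible c W (𝒱.biUnion (fun v => H v l) ∪ L.biUnion D) := by
      refine ihl.biUnion L D (fun v hv => hD1 v (hLV hv)) (fun v hv => hDW v (hLV hv))
        (fun v hv => hHD (Or.inl rfl) (hLV hv)) (fun v hv u hu => hDD (hLV hv) (hLV hu))
        fun J hJ => ?_
      rw [hsumT (Or.inl rfl) (hJ.trans hLV)]
      refine (card_support_sum_le 𝒱 U J₁ _ ?_ ?_ ?_).trans (by omega)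
      · intro v hv hvU
        simp [hUz hv hvU]
      · intro v hv hv1
        split_ifs with hvJ
        · rw [cancel]
          have h := hL v (hJ hvJ) hv1
          rcases hKmem hv h.1 with h0 | h0 | h0
          · exact absurd h0 h.2
          · rw [h0, add_zero]
            exact hbS hv
          · rw [h0, zero_add]
            exact hbr hv
        · rw [add_zero]
          exact hbl hv
      · intro v hv
        split_ifs with hvJ
        · rw [cancel]
          exact hadd (hbS hv) (hbr hv)
        · rw [add_zero]
          exact (hbl hv).trans one_le_two
    have step2 : Contractible c W (𝒱.biUnion (fun v => H v r) ∪ Q.biUnion D) := by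
      refine ihr.biUnion Q D (fun v hv => hD1 v (hQV hv)) (fun v hv => hDW v (hQV hv))
        (fun v hv => hHD (Or.inr rfl) (hQV hv)) (fun v hv u hu => hDD (hQV hv) (hQV hu))
        fun J hJ => ?_
      rw [hsumT (Or.inr rfl) (hJ.trans hQV)]
      refine (card_support_sum_le 𝒱 U J₂ _ ?_ ?_ ?_).trans (by omega)
      · intro v hv hvU
        simp [hUz hv hvU]
      · intro v hv hv1
        split_ifs with hvJ
        -- Since `b v l = 0`, absorbing the piece turns `b v r` into `b v S`.
        · rw [add_comm (b v l), cancel, not_not.1 (hQ v (hJ hvJ) hv1).2, add_zero]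
          exact hbS hv
        · rw [add_zero]
          exact hbr hv
      · intro v hv
        split_ifs with hvJ
        · rw [add_comm (b v l), cancel]
          exact hadd (hbS hv) (hbl hv)
        · rw [add_zero]
          exact (hbr hv).trans one_le_two
    have hLRdisj : Disjoint (𝒱.biUnion (fun v => H v l) ∪ L.biUnion D)
        (𝒱.biUnion (fun v => H v r) ∪ Q.biUnion D) := by
      rw [Finset.disjoint_union_left, Finset.disjoint_union_right, Finset.disjoint_union_right]
      refine ⟨⟨?_, ?_⟩, ?_, ?_⟩
      · rw [Finset.disjoint_biUnion_left]
        intro v hv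
        rw [Finset.disjoint_biUnion_right]
        intro u hu
        by_cases hvu : v = u
        · subst hvu
          exact (hs v hv).disjoint l r hS
        · exact (hdisj v hv u hu hvu).mono (hHR hv hl) (hHR hu hr)
      · rw [Finset.disjoint_biUnion_right]
        exact fun v hv => hHD (Or.inl rfl) (hQV hv)
      · rw [Finset.disjoint_biUnion_left]
        exact fun v hv => (hHD (Or.inr rfl) (hLV hv)).symm
      · rw [Finset.disjoint_biUnion_left]
        intro v hv
        rw [Finset.disjoint_biUnion_right]
        exact fun u hu => hDD (hLV hv) (hQV hu) fun h => hLQ v hv (h ▸ hu)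
    set HL := 𝒱.biUnion (fun v => H v l) ∪ L.biUnion D with hHL
    set HR := 𝒱.biUnion (fun v => H v r) ∪ Q.biUnion D with hHR'
    have hdisj3 {v} (hv : v ∈ J₃) : Disjoint (HL ∪ HR) (D v) := by
      rw [Finset.disjoint_union_left, hHL, hHR', Finset.disjoint_union_left,
        Finset.disjoint_union_left, Finset.disjoint_biUnion_left (t := D v) (s := L),
        Finset.disjoint_biUnion_left (t := D v) (s := Q)]
      exact ⟨⟨hHD (Or.inl rfl) (hJ3V hv), fun u hu => hDD (hLV hu) (hJ3V hv) fun h =>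
        hL3 u hu (h ▸ hv)⟩, hHD (Or.inr rfl) (hJ3V hv), fun u hu => hDD (hQV hu) (hJ3V hv) fun h =>
        hQ3 u hu (h ▸ hv)⟩
    -- After the join, a vertex whose piece has been absorbed shows only `b v S`. Only those of `J₃`
    -- still waiting show `b v l + b v r`.
    have hbound {J} (hJ : J ⊆ J₃) :
        (∑ x ∈ (HL ∪ HR) ∪ J.biUnion D, c x).support.card ≤ W := by
      have hsumJ : ∑ x ∈ (HL ∪ HR) ∪ J.biUnion D, c x =
          ∑ v ∈ 𝒱, if v ∈ L ∨ v ∈ Q ∨ v ∈ J then b v S else b v l + b v r := by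
        rw [Finset.sum_union, Finset.sum_union hLRdisj, hsumT (Or.inl rfl) hLV,
          hsumT (Or.inr rfl) hQV, hDsum (hJ.trans hJ3V), ← Finset.sum_add_distrib,
          ← Finset.sum_add_distrib]
        · refine Finset.sum_congr rfl fun v hv => ?_
          have key : b v l + (b v S + (b v l + b v r)) + b v r = b v S := by
            rw [cancel, add_assoc, add_self_finsupp_zmod_two, add_zero]
          have key2 : b v l + (b v r + (b v S + (b v l + b v r))) = b v S :=
            Eq.trans (by abel) key
          have key3 : b v l + b v r + (b v S + (b v l + b v r)) = b v S :=
            Eq.trans (by abel) key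
          by_cases h1 : v ∈ L
          · have h2 := hLQ v h1
            have h3 : v ∉ J := fun h => hL3 v h1 (hJ h)
            simpa [h1, h2, h3] using key
          · by_cases h2 : v ∈ Q
            · have h3 : v ∉ J := fun h => hQ3 v h2 (hJ h)
              simpa [h1, h2, h3] using key2
            · by_cases h3 : v ∈ J
              · simpa [h1, h2, h3] using key3
              · simp [h1, h2, h3]
        · rw [Finset.disjoint_biUnion_right]
          exact fun v hv => hdisj3 (hJ hv)
      rw [hsumJ]
      refine (card_support_sum_le 𝒱 U J₃ _ ?_ ?_ ?_).trans (by omega)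
      · intro v hv hvU
        simp [hUz hv hvU]
      · intro v hv hv3
        have := hcover v hv
        rw [if_pos (by tauto)]
        exact hbS hv
      · intro v hv
        split_ifs
        · exact (hbS hv).trans one_le_two
        · exact hadd (hbl hv) (hbr hv)
    have step3 : Contractible c W (HL ∪ HR) := by
      refine Contractible.union _ _ hLRdisj step1 step2 ?_
      simpa using hbound (Finset.empty_subset J₃)
    have step4 : Contractible c W ((HL ∪ HR) ∪ J₃.biUnion D) :=
      step3.biUnion J₃ D (fun v hv => hD1 v (hJ3V hv)) (fun v hv => hDW v (hJ3V hv))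
        (fun v hv => hdisj3 hv) (fun v hv u hu => hDD (hJ3V hv) (hJ3V hu)) fun J hJ => hbound hJ
    convert step4 using 1
    ext x
    simp only [hHL, hHR', Finset.mem_union, Finset.mem_biUnion]
    constructor
    · rintro ⟨v, hv, hx⟩
      by_cases hxl : x ∈ H v l
      · exact Or.inl (Or.inl (Or.inl ⟨v, hv, hxl⟩))
      by_cases hxr : x ∈ H v r
      · exact Or.inl (Or.inr (Or.inl ⟨v, hv, hxr⟩))
      have hxD : x ∈ D v := by
        simp only [D, Finset.mem_sdiff, Finset.mem_union, hxl, hxr, or_self, not_false_iff,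
          and_true]
        exact hx
      rcases hcover v hv with h | h | h
      · exact Or.inl (Or.inl (Or.inr ⟨v, h, hxD⟩))
      · exact Or.inl (Or.inr (Or.inr ⟨v, h, hxD⟩))
      · exact Or.inr ⟨v, h, hxD⟩
    · have hDS {v} (h : x ∈ D v) : x ∈ H v S := (Finset.mem_sdiff.1 h).1
      rintro (((⟨v, hv, hx⟩ | ⟨v, hv, hx⟩) | ⟨v, hv, hx⟩ | ⟨v, hv, hx⟩) | ⟨v, hv, hx⟩)
      · exact ⟨v, hv, (hs v hv).left_subset l r hS hx⟩
      · exact ⟨v, hLV hv, hDS hx⟩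
      · exact ⟨v, hv, (hs v hv).right_subset l r hS hx⟩
      · exact ⟨v, hQV hv, hDS hx⟩
      · exact ⟨v, hJ3V hv, hDS hx⟩

end Contractible

/-! ### Rerooting contraction trees, ranks of results, and restriction to a set of leaves. -/

namespace RootedBinaryTree

variable {α β Ind : Type*}

/-- All intermediate results of the contraction tree `t` have rank at most `W`, where `c` gives the
index vectors of the leaves. -/
def IsBounded (c : α → Ind →₀ ZMod 2) (W : ℕ) (t : RootedBinaryTree α) : Prop :=
  ∀ S ∈ t.subtrees, (S.leaves.map c).sum.support.card ≤ W

theorem isBounded_node {c : α → Ind →₀ ZMod 2} {W : ℕ} {l r : RootedBinaryTree α} :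
    (node l r).IsBounded c W ↔ ((l.leaves.map c).sum + (r.leaves.map c).sum).support.card ≤ W ∧
      l.IsBounded c W ∧ r.IsBounded c W := by
  simp only [IsBounded, mem_subtrees_node]
  constructor
  · intro h
    refine ⟨?_, fun S hS => h S (Or.inr (Or.inl hS)), fun S hS => h S (Or.inr (Or.inr hS))⟩
    simpa [leaves] using h _ (Or.inl rfl)
  · rintro ⟨h, hl, hr⟩ S (rfl | hS | hS)
    · simpa [leaves] using h
    · exact hl S hS
    · exact hr S hS

theorem exists_isBounded_of_contractible {c : α → Ind →₀ ZMod 2} {W : ℕ} {s : Finset α}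
    (h : Contractible c W s) :
    s = ∅ ∨ ∃ t : RootedBinaryTree α, t.leaves = s.val ∧ t.IsBounded c W := by
  induction h with
  | empty => exact Or.inl rfl
  | single x hx =>
    refine Or.inr ⟨leaf x, rfl, fun S hS => ?_⟩
    rw [mem_subtrees_leaf.1 hS]
    simpa [leaves] using hx
  | union s t hst _ _ hW ihs iht =>
    rcases ihs with rfl | ⟨l, hl, hlb⟩
    · simpa using iht
    rcases iht with rfl | ⟨r, hr, hrb⟩
    · simpa using Or.inr ⟨l, hl, hlb⟩
    refine Or.inr ⟨node l r, ?_, isBounded_node.2 ⟨?_, hlb, hrb⟩⟩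
    · rw [leaves, hl, hr, ← Finset.disjUnion_eq_union _ _ hst]
      rfl
    · rw [Finset.sum_union hst] at hW
      rw [hl, hr]
      exact hW

/-- The trees `t` and `U` are the two halves of an unrooted tree. As all vectors add up to zero,
both sides of an edge have the same vector in characteristic two, so moving the root preserves the
bound. The root moves towards `z`, and the siblings passed on the way are joined to `U`. -/
theorem exists_reroot {c : α → Ind →₀ ZMod 2} {W : ℕ} {z : α} (t U : RootedBinaryTree α)
    (hz : z ∈ t.leaves) (h0 : (t.leaves.map c).sum + (U.leaves.map c).sum = 0)
    (ht : t.IsBounded c W) (hU : U.IsBounded c W) :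
    ∃ t' : RootedBinaryTree α, t'.leaves + {z} = t.leaves + U.leaves ∧ t'.IsBounded c W := by
  induction t generalizing U with
  | leaf a =>
    rw [leaves, Multiset.mem_singleton] at hz
    subst hz
    exact ⟨U, add_comm _ _, hU⟩
  | node l r ihl ihr =>
    rw [isBounded_node] at ht
    rw [leaves, Multiset.map_add, Multiset.sum_add] at h0
    rcases Multiset.mem_add.1 hz with hz | hz
    · have e : (l.leaves.map c).sum + ((r.leaves.map c).sum + (U.leaves.map c).sum) = 0 := by
        rw [← h0]
        abel
      obtain ⟨t', ht', hb⟩ := ihl (node r U) hz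
        (by rw [leaves, Multiset.map_add, Multiset.sum_add, e]) ht.2.1
        (isBounded_node.2 ⟨by
          rw [← neg_eq_of_add_eq_zero_right e, Finsupp.support_neg]
          exact ht.2.1 l l.self_mem_subtrees, ht.2.2, hU⟩)
      exact ⟨t', by rw [ht', leaves, leaves, add_assoc], hb⟩
    · have e : (r.leaves.map c).sum + ((l.leaves.map c).sum + (U.leaves.map c).sum) = 0 := by
        rw [← h0]
        abel
      obtain ⟨t', ht', hb⟩ := ihr (node l U) hz
        (by rw [leaves, Multiset.map_add, Multiset.sum_add, e]) ht.2.2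
        (isBounded_node.2 ⟨by
          rw [← neg_eq_of_add_eq_zero_right e, Finsupp.support_neg]
          exact ht.2.2 r r.self_mem_subtrees, ht.2.1, hU⟩)
      exact ⟨t', by rw [ht', leaves, leaves, add_left_comm, add_assoc], hb⟩

/-- Meant for `z` the free vertex, which takes part in the combinatorics but is not a tensor of the
network. -/
theorem exists_isBounded_erase [DecidableEq α] {c : α → Ind →₀ ZMod 2} {W : ℕ} {s : Finset α}
    {z : α} (h : Contractible c W s) (hz : z ∈ s) (hs : s ≠ {z}) (h0 : ∑ x ∈ s, c x = 0) :
    ∃ t : RootedBinaryTree α, t.leaves = (s.erase z).val ∧ t.IsBounded c W := by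
  rcases exists_isBounded_of_contractible h with rfl | ⟨t, ht, hb⟩
  · simp at hz
  have key : ∃ t' : RootedBinaryTree α, t'.leaves + {z} = t.leaves ∧ t'.IsBounded c W := by
    have hz' : z ∈ t.leaves := by rw [ht]; exact hz
    have h0' : (t.leaves.map c).sum = 0 := by rw [ht]; exact h0
    rcases t with a | ⟨l, r⟩
    · rw [leaves, Multiset.mem_singleton] at hz'
      subst hz'
      exact absurd (Finset.val_injective ht.symm) hs
    · rw [isBounded_node] at hb
      rw [leaves, Multiset.map_add, Multiset.sum_add] at h0'
      rcases Multiset.mem_add.1 hz' with hz' | hz'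
      · exact exists_reroot l r hz' h0' hb.2.1 hb.2.2
      · rw [add_comm] at h0'
        obtain ⟨t', ht', hb'⟩ := exists_reroot r l hz' h0' hb.2.2 hb.2.1
        exact ⟨t', by rw [ht', leaves, add_comm], hb'⟩
  obtain ⟨t', ht', hb'⟩ := key
  refine ⟨t', ?_, hb'⟩
  rw [Finset.erase_val, ← ht, ← ht', add_comm, Multiset.singleton_add, Multiset.erase_cons_head]

/-- Apply a map to the leaf labels of a rooted binary tree. -/
def map (f : α → β) : RootedBinaryTree α → RootedBinaryTree β
  | leaf a => leaf (f a)
  | node l r => node (l.map f) (r.map f)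

theorem leaves_map (f : α → β) (t : RootedBinaryTree α) :
    (t.map f).leaves = t.leaves.map f := by
  induction t with
  | leaf a => rfl
  | node l r ihl ihr => simp [map, leaves, ihl, ihr]

theorem IsBounded.map {f : α → β} {c : α → Ind →₀ ZMod 2} {c' : β → Ind →₀ ZMod 2} {W : ℕ}
    {t : RootedBinaryTree α} (h : t.IsBounded c W) (hf : ∀ x ∈ t.leaves, c' (f x) = c x) :
    (t.map f).IsBounded c' W := by
  have hsum {s : RootedBinaryTree α} (hs : ∀ x ∈ s.leaves, c' (f x) = c x) :
      ((s.map f).leaves.map c').sum = (s.leaves.map c).sum := by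
    rw [leaves_map, Multiset.map_map, Multiset.map_congr rfl]
    exact hs
  induction t with
  | leaf a =>
    intro S hS
    rw [mem_subtrees_leaf.1 hS]
    have := h _ (self_mem_subtrees _)
    rw [← hsum hf] at this
    exact this
  | node l r ihl ihr =>
    rw [isBounded_node] at h
    have hl : ∀ x ∈ l.leaves, c' (f x) = c x := fun x hx => hf x (Multiset.mem_add.2 (Or.inl hx))
    have hr : ∀ x ∈ r.leaves, c' (f x) = c x := fun x hx => hf x (Multiset.mem_add.2 (Or.inr hx))
    exact isBounded_node.2 ⟨by rw [hsum hl, hsum hr]; exact h.1, ihl h.2.1 hl, ihr h.2.2 hr⟩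

section Contract

variable {dom : Ind → Type*} [∀ i, Fintype (dom i)]

theorem chi_contract (t : RootedBinaryTree (Tensor dom)) :
    chi t.contract.idx = (t.leaves.map fun A => chi A.idx).sum := by
  classical
  induction t with
  | leaf A => simp [contract, leaves]
  | node l r ihl ihr =>
    rw [leaves, Multiset.map_add, Multiset.sum_add, ← ihl, ← ihr, ← chi_symmDiff]
    simp only [contract, Tensor.mul]

theorem rank_contract (t : RootedBinaryTree (Tensor dom)) :
    t.contract.rank = (t.leaves.map fun A => chi A.idx).sum.support.card := by
  rw [← chi_contract, support_chi]
  rfl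

theorem IsBounded.maxRank_le {t : RootedBinaryTree (Tensor dom)} {W : ℕ}
    (h : t.IsBounded (fun A => chi A.idx) W) : t.maxRank ≤ W := by
  induction t with
  | leaf A =>
    have := h _ (self_mem_subtrees _)
    rw [← rank_contract] at this
    exact this
  | node l r ihl ihr =>
    have hroot := h _ (self_mem_subtrees _)
    rw [← rank_contract] at hroot
    rw [isBounded_node] at h
    exact max_le hroot (max_le (ihl h.2.1) (ihr h.2.2))

end Contract

open Classical in
/-- Restrict a rooted binary tree to the leaves whose labels satisfy `p`. -/
noncomputable def restrict (p : α → Prop) : RootedBinaryTree α → Option (RootedBinaryTree α)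
  | leaf a => if p a then some (leaf a) else none
  | node l r =>
    match l.restrict p, r.restrict p with
    | some l', some r' => some (node l' r')
    | some l', none => some l'
    | none, x => x

open Classical in
theorem leaves_restrict (p : α → Prop) (S : RootedBinaryTree α) :
    (S.restrict p).elim 0 leaves = S.leaves.filter p := by
  induction S with
  | leaf a => by_cases h : p a <;> simp [restrict, leaves, h, Multiset.filter_singleton]
  | node l r ihl ihr =>
    rw [leaves, Multiset.filter_add, ← ihl, ← ihr]
    rcases hl : l.restrict p with _ | l' <;> rcases hr : r.restrict p with _ | r' <;>
      simp [restrict, hl, hr, leaves]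

open Classical in
theorem leaves_of_restrict_eq_some {p : α → Prop} {S S' : RootedBinaryTree α}
    (h : S.restrict p = some S') : S'.leaves = S.leaves.filter p := by
  rw [← leaves_restrict, h]
  rfl

theorem exists_restrict_of_mem_subtrees {p : α → Prop} {S S' R : RootedBinaryTree α}
    (hS : S ∈ R.subtrees) (h : S.restrict p = some S') :
    ∃ R', R.restrict p = some R' ∧ S' ∈ R'.subtrees := by
  induction R with
  | leaf a =>
    rw [mem_subtrees_leaf.1 hS] at h
    exact ⟨S', h, self_mem_subtrees _⟩
  | node l r ihl ihr =>
    rcases mem_subtrees_node.1 hS with rfl | hS | hS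
    · exact ⟨S', h, self_mem_subtrees _⟩
    · obtain ⟨l', hl, hS'⟩ := ihl hS
      rcases hr : r.restrict p with _ | r'
      · exact ⟨l', by simp [restrict, hl, hr], hS'⟩
      · exact ⟨node l' r', by simp [restrict, hl, hr], mem_subtrees_node.2 (Or.inr (Or.inl hS'))⟩
    · obtain ⟨r', hr, hS'⟩ := ihr hS
      rcases hl : l.restrict p with _ | l'
      · exact ⟨r', by simp [restrict, hl, hr], hS'⟩
      · exact ⟨node l' r', by simp [restrict, hl, hr], mem_subtrees_node.2 (Or.inr (Or.inr hS'))⟩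

theorem mem_subtrees_of_restrict {p : α → Prop} {S S' R R' : RootedBinaryTree α}
    (hS : S ∈ R.subtrees) (h : S.restrict p = some S') (hR : R.restrict p = some R') :
    S' ∈ R'.subtrees := by
  obtain ⟨R'', hR'', hS'⟩ := exists_restrict_of_mem_subtrees hS h
  rw [hR] at hR''
  rwa [Option.some.inj hR'']

end RootedBinaryTree

/-! ### Spreading a vertex over the tree of edges. -/

section Spread

variable {Ind : Type*} {α : Type*}

theorem disjoint_leaves_of_node [DecidableEq Ind] {R l r : RootedBinaryTree Ind}
    (hd : R.leaves.Nodup) (hlr : RootedBinaryTree.node l r ∈ R.subtrees) :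
    Disjoint l.leaves.toFinset r.leaves.toFinset := by
  have hd' := Multiset.nodup_add.1 (Multiset.nodup_of_le (RootedBinaryTree.leaves_le hlr) hd)
  refine Finset.disjoint_left.2 fun i hi hi' => ?_
  rw [Multiset.mem_toFinset] at hi hi'
  exact Multiset.disjoint_left.1 hd'.2.2 hi hi'

/-- The vertex stays whole and belongs to the subtrees containing two of its edges, or its only
edge. With at most three edges, two disjoint subtrees cannot both qualify, and at most one edge is
left outside a qualifying one. The connection is that outer edge if the vertex is inside, and the
inner edge, if any, otherwise. -/
theorem exists_isSpread_of_card_le_three [DecidableEq Ind] [DecidableEq α]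
    {c : α → Ind →₀ ZMod 2} {E : Finset Ind} {R : RootedBinaryTree Ind} (hd : R.leaves.Nodup)
    (hE : E.Nonempty) (h3 : E.card ≤ 3) (hER : ∀ i ∈ E, i ∈ R.leaves) (x : α) (hx : c x = chi E) :
    ∃ H b, IsSpread c E R H b ∧ H R = {x} := by
  have h1 : 1 ≤ E.card := Finset.card_pos.2 hE
  let k (S : RootedBinaryTree Ind) : ℕ := (E ∩ S.leaves.toFinset).card
  let H : RootedBinaryTree Ind → Finset α := fun S => if min 2 E.card ≤ k S then {x} else ∅
  let b : RootedBinaryTree Ind → Ind →₀ ZMod 2 := fun S =>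
    if min 2 E.card ≤ k S then chi (E \ S.leaves.toFinset) else chi (E ∩ S.leaves.toFinset)
  have hsplit (S : RootedBinaryTree Ind) : (E \ S.leaves.toFinset).card + k S = E.card :=
    Finset.card_sdiff_add_card_inter _ _
  have hk (l r) (hlr : RootedBinaryTree.node l r ∈ R.subtrees) : k (.node l r) = k l + k r := by
    simp only [k]
    rw [RootedBinaryTree.leaves, Multiset.toFinset_add, Finset.inter_union_distrib_left,
      Finset.card_union_of_disjoint]
    exact (disjoint_leaves_of_node hd hlr).mono Finset.inter_subset_right Finset.inter_subset_right
  have hHx (S) : H S ⊆ {x} := by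
    simp only [H]
    split_ifs <;> simp
  refine ⟨H, b, ⟨?_, ?_, ?_, ?_, ?_, ?_, ?_, ?_⟩, ?_⟩
  · exact fun a _ => (Finset.card_le_card (hHx _)).trans (by simp)
  · intro l r hlr
    have := hk l r hlr
    simp only [H]
    split_ifs
    · rfl
    · omega
    · simp
    · rfl
  · intro l r hlr
    have := hk l r hlr
    simp only [H]
    split_ifs
    · rfl
    · omega
    · simp
    · rfl
  · intro l r hlr
    have := hk l r hlr
    have := hsplit (.node l r)
    simp only [H]
    split_ifs
    · omega
    all_goals simp
  · exact fun l r _ => (Finset.card_le_card (Finset.sdiff_subset.trans (hHx _))).trans (by simp)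
  · intro S hS
    simp only [H, b]
    split_ifs
    · rw [Finset.sum_singleton, hx, ← chi_union (Finset.disjoint_sdiff_inter _ _),
        Finset.sdiff_union_inter]
    · rw [Finset.sum_empty, add_self_finsupp_zmod_two]
  · intro S hS
    have := hsplit S
    simp only [b]
    split_ifs with h
    · rw [support_chi]
      omega
    · rw [support_chi]
      simp only [k] at h
      omega
  · intro S hS hb
    have h4 := hsplit S
    have hne : 0 < k S ∧ 0 < (E \ S.leaves.toFinset).card := by
      simp only [b] at hb
      split_ifs at hb with h
      · refine ⟨by omega, Finset.card_pos.2 (Finset.nonempty_iff_ne_empty.2 ?_)⟩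
        rintro h0
        exact hb (by rw [h0, chi_empty])
      · have : 0 < k S := by
          refine Finset.card_pos.2 (Finset.nonempty_iff_ne_empty.2 ?_)
          rintro h0
          exact hb (by rw [h0, chi_empty])
        omega
    obtain ⟨i, hi⟩ := Finset.card_pos.1 hne.1
    obtain ⟨j, hj⟩ := Finset.card_pos.1 hne.2
    simp only [Finset.mem_inter, Finset.mem_sdiff, Multiset.mem_toFinset] at hi hj
    exact ⟨⟨i, hi⟩, j, hj⟩
  · have : k R = E.card := by
      simp only [k]
      rw [Finset.inter_eq_left.2 fun i hi => Multiset.mem_toFinset.2 (hER i hi)]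
    simp only [H]
    rw [if_pos (by omega)]

variable {dom : Ind → Type*} [∀ i, Fintype (dom i)]

open RootedBinaryTree

theorem subtrees_disjoint {R l r : RootedBinaryTree Ind} (hd : R.leaves.Nodup)
    (hlr : RootedBinaryTree.node l r ∈ R.subtrees) : Disjoint l.subtrees r.subtrees :=
  Finset.disjoint_left.2 fun _ hl hr =>
    false_of_leaves_le (Multiset.nodup_of_le (RootedBinaryTree.leaves_le hlr) hd)
      (RootedBinaryTree.leaves_le hl) (RootedBinaryTree.leaves_le hr)

theorem node_notMem_subtrees {l r : RootedBinaryTree Ind} :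
    RootedBinaryTree.node l r ∉ l.subtrees ∧ RootedBinaryTree.node l r ∉ r.subtrees := by
  have hl := l.card_leaves_pos
  have hr := r.card_leaves_pos
  constructor <;> intro h <;> have h := Multiset.card_le_card (RootedBinaryTree.leaves_le h) <;>
    rw [leaves, Multiset.card_add] at h <;> omega

/-- Bonds between two tensors of the subtree are counted twice and cancel. -/
theorem IsRootedFactorization.sum_chi [DecidableEq Ind] {A : Tensor dom}
    {R : RootedBinaryTree Ind} {M : TensorNetwork dom} {G : RootedBinaryTree Ind → Tensor dom}
    {b : RootedBinaryTree Ind → Ind →₀ ZMod 2} (h : IsRootedFactorization A R M G b)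
    (hd : R.leaves.Nodup) {S : RootedBinaryTree Ind} (hS : S ∈ R.subtrees) :
    ∑ T ∈ S.subtrees, chi (G T).idx = b S + chi S.leaves.toFinset := by
  classical
  induction S with
  | leaf a => simpa [subtrees, leaves] using h.leaf a hS
  | node l r ihl ihr =>
    have hl := add_self_finsupp_zmod_two (b l)
    have hr := add_self_finsupp_zmod_two (b r)
    rw [subtrees, Finset.sum_insert (by
      rw [Finset.mem_union]
      exact not_or.2 node_notMem_subtrees), Finset.sum_union (subtrees_disjoint hd hS),
      ihl (left_mem_subtrees hS), ihr (right_mem_subtrees hS), h.node l r hS, leaves,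
      Multiset.toFinset_add, chi_union (disjoint_leaves_of_node hd hS)]
    calc _ = b (.node l r) + (chi l.leaves.toFinset + chi r.leaves.toFinset) + (b l + b l) +
          (b r + b r) := by abel
      _ = _ := by rw [hl, hr, add_zero, add_zero]

/-- The index vector of an element of `Option (Tensor dom)`, where `none` stands for the free
vertex, whose indices are `F`. -/
noncomputable def optionChi (F : Finset Ind) : Option (Tensor dom) → Ind →₀ ZMod 2 :=
  fun x => chi (x.elim F Tensor.idx)

/-- A subtree of `R` restricts to a subtree of `R'` or to nothing, and it receives the pieces of its
restriction. An inner node gets a piece of its own only if both its children contain indices of `A`.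
-/
theorem IsRootedFactorization.exists_isSpread [DecidableEq Ind] [DecidableEq (Option (Tensor dom))]
    {A : Tensor dom} {R R' : RootedBinaryTree Ind} {M : TensorNetwork dom}
    {G : RootedBinaryTree Ind → Tensor dom} {b : RootedBinaryTree Ind → Ind →₀ ZMod 2}
    (h : IsRootedFactorization A R' M G b)
    (hR : R.restrict (· ∈ A.idx) = some R') (hR' : R'.leaves = A.idx.val) (F : Finset Ind) :
    ∃ H b, IsSpread (optionChi F) A.idx R H b ∧ H R = M.tensors.map Function.Embedding.some := by
  classical
  have hd' : R'.leaves.Nodup := hR' ▸ A.idx.nodup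
  let f : RootedBinaryTree Ind → Option (Tensor dom) := fun T => some (G T)
  have hf : Set.InjOn f R'.subtrees := fun S hS T hT hST => h.injOn hS hT (Option.some.inj hST)
  let ρ (S : RootedBinaryTree Ind) := S.restrict (· ∈ A.idx)
  let H : RootedBinaryTree Ind → Finset (Option (Tensor dom)) := fun S =>
    (ρ S).elim ∅ fun S' => S'.subtrees.image f
  let b' : RootedBinaryTree Ind → Ind →₀ ZMod 2 := fun S => (ρ S).elim 0 b
  have hmem {S S'} (hS : S ∈ R.subtrees) (h : ρ S = some S') : S' ∈ R'.subtrees :=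
    mem_subtrees_of_restrict hS h hR
  have hsub {S S'} (hS : S ∈ R.subtrees) (h : ρ S = some S') : S'.subtrees ⊆ R'.subtrees :=
    subtrees_subset (hmem hS h)
  have hleaves {S S'} (h : ρ S = some S') : S'.leaves = S.leaves.filter (· ∈ A.idx) :=
    (leaves_of_restrict_eq_some h).trans (by congr)
  have hnode (l r : RootedBinaryTree Ind) (hlr : RootedBinaryTree.node l r ∈ R.subtrees) :
      H l ⊆ H (.node l r) ∧ H r ⊆ H (.node l r) ∧ Disjoint (H l) (H r) ∧
        (H (.node l r) \ (H l ∪ H r)).card ≤ 1 := by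
    rcases hl : ρ l with _ | l' <;> rcases hr : ρ r with _ | r'
    · have hn : ρ (.node l r) = none := by simp only [ρ] at *; simp [restrict, hl, hr]
      simp [H, hl, hr, hn]
    · have hn : ρ (.node l r) = some r' := by simp only [ρ] at *; simp [restrict, hl, hr]
      simp [H, hl, hr, hn]
    · have hn : ρ (.node l r) = some l' := by simp only [ρ] at *; simp [restrict, hl, hr]
      simp [H, hl, hr, hn]
    · have hn : ρ (.node l r) = some (.node l' r') := by
        simp only [ρ] at *; simp [restrict, hl, hr]
      have hn' := hmem hlr hn
      have e : H (.node l r) = insert (f (.node l' r')) (H l ∪ H r) := by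
        simp only [H, hl, hr, hn, Option.elim_some, subtrees]
        rw [Finset.image_insert, Finset.image_union]
      refine ⟨?_, ?_, ?_, ?_⟩
      · rw [e]
        exact Finset.subset_union_left.trans (Finset.subset_insert _ _)
      · rw [e]
        exact Finset.subset_union_right.trans (Finset.subset_insert _ _)
      · simp only [H, hl, hr, Option.elim_some]
        rw [Finset.disjoint_left]
        intro x hx hx'
        obtain ⟨S, hS, rfl⟩ := Finset.mem_image.1 hx
        obtain ⟨T, hT, hTS⟩ := Finset.mem_image.1 hx'
        obtain rfl := hf (subtrees_subset (right_mem_subtrees hn') hT)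
          (subtrees_subset (left_mem_subtrees hn') hS) hTS
        exact Finset.disjoint_left.1 (subtrees_disjoint hd' hn') hS hT
      · rw [e]
        refine (Finset.card_le_card (t := {f (.node l' r')}) fun x hx => ?_).trans (by simp)
        rw [Finset.mem_sdiff, Finset.mem_insert] at hx
        rw [Finset.mem_singleton]
        tauto
  refine ⟨H, b', ⟨?_, fun l r h => (hnode l r h).1, fun l r h => (hnode l r h).2.1,
    fun l r h => (hnode l r h).2.2.1, fun l r h => (hnode l r h).2.2.2, ?_, ?_, ?_⟩, ?_⟩
  · intro a ha
    by_cases haA : a ∈ A.idx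
    · have : ρ (.leaf a) = some (.leaf a) := by simp [ρ, restrict, haA]
      simp [H, this, subtrees]
    · have : ρ (.leaf a) = none := by simp [ρ, restrict, haA]
      simp [H, this]
  · intro S hS
    have hE := leaves_restrict (· ∈ A.idx) S
    rcases hρ : ρ S with _ | S'
    · have : A.idx ∩ S.leaves.toFinset = ∅ := by
        have hE : (ρ S).elim 0 leaves = _ := hE
        rw [hρ, Option.elim_none] at hE
        refine Finset.eq_empty_of_forall_notMem fun i hi => ?_
        rw [Finset.mem_inter, Multiset.mem_toFinset] at hi
        refine Multiset.notMem_zero i ?_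
        rw [hE, @Multiset.mem_filter]
        exact ⟨hi.2, hi.1⟩
      simp [H, b', hρ, this, chi_empty]
    · have e : A.idx ∩ S.leaves.toFinset = S'.leaves.toFinset := by
        ext i
        rw [hleaves hρ]
        simp [and_comm]
      simp only [H, b', hρ, Option.elim_some, e]
      rw [Finset.sum_image (hf.mono (hsub hS hρ)), ← h.sum_chi hd' (hmem hS hρ)]
      rfl
  · intro S hS
    rcases hρ : ρ S with _ | S'
    · simp [b', hρ]
    · simpa [b', hρ] using h.card_le S'
  · intro S hS hb
    rcases hρ : ρ S with _ | S'
    · simp [b', hρ] at hb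
    -- The root of `R'` has no connection, so a nonzero one forces `S'` to miss some index of `A`.
    · have hne : S' ≠ R' := by
        rintro rfl
        simp [b', hρ, h.root] at hb
      have hS' := hmem hS hρ
      constructor
      · obtain ⟨i, hi⟩ := Multiset.card_pos_iff_exists_mem.1 S'.card_leaves_pos
        rw [hleaves hρ, Multiset.mem_filter] at hi
        exact ⟨i, hi.2, hi.1⟩
      · by_contra hcon
        push Not at hcon
        obtain ⟨p, hp, hc⟩ := exists_isChild hS' hne
        have h1 := hc.card_lt
        have h2 := Multiset.card_le_card (RootedBinaryTree.leaves_le hp)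
        have h3 : R'.leaves ≤ S'.leaves := by
          rw [Multiset.le_iff_subset hd', hR', hleaves hρ]
          exact fun i hi => Multiset.mem_filter.2 ⟨hcon i hi, hi⟩
        have := Multiset.card_le_card h3
        omega
  · ext x
    have hρ : ρ R = some R' := hR
    simp only [H, hρ, Option.elim_some, Finset.mem_image, Finset.mem_map, h.mem_tensors]
    constructor
    · rintro ⟨S, hS, rfl⟩
      exact ⟨G S, ⟨S, hS, rfl⟩, rfl⟩
    · rintro ⟨B, ⟨S, hS, rfl⟩, rfl⟩
      exact ⟨S, hS, rfl⟩

end Spread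

/-! ### From a tree decomposition to a tree of edges. -/

section Decomposition

variable {Ind ν : Type*}

/-- The vertices that have an edge in `X` and an edge outside `X`, where `E v` is the set of the
edges of `v`. -/
def edgeBoundary (E : ν → Finset Ind) (X : Set Ind) : Set ν :=
  {v | (∃ i ∈ E v, i ∈ X) ∧ ∃ i ∈ E v, i ∉ X}

theorem edgeBoundary_union_subset (E : ν → Finset Ind) (X Y : Set Ind) :
    edgeBoundary E (X ∪ Y) ⊆ edgeBoundary E X ∪ edgeBoundary E Y := by
  rintro v ⟨⟨i, hi, hiX | hiY⟩, j, hj, hjX⟩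
  · exact Or.inl ⟨⟨i, hi, hiX⟩, j, hj, fun h => hjX (Or.inl h)⟩
  · exact Or.inr ⟨⟨i, hi, hiY⟩, j, hj, fun h => hjX (Or.inr h)⟩

/-- At each inner node of the tree of edges `R`, the boundaries of the two subtrees are contained in
a set of at most `k` vertices. -/
def HasMiddleSets (E : ν → Finset Ind) (k : ℕ) (R : RootedBinaryTree Ind) : Prop :=
  ∀ l r, RootedBinaryTree.node l r ∈ R.subtrees → ∃ C : Finset ν, C.card ≤ k ∧
    edgeBoundary E {i | i ∈ l.leaves} ⊆ C ∧ edgeBoundary E {i | i ∈ r.leaves} ⊆ C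

/-- The set `X` of edges is empty or the set of the leaves of a tree with small middle sets. -/
def IsBranchDecomposable (E : ν → Finset Ind) (k : ℕ) (X : Finset Ind) : Prop :=
  X = ∅ ∨ ∃ R : RootedBinaryTree Ind, R.leaves = X.val ∧ HasMiddleSets E k R

theorem isBranchDecomposable_singleton (E : ν → Finset Ind) (k : ℕ) (i : Ind) :
    IsBranchDecomposable E k {i} := by
  refine Or.inr ⟨.leaf i, rfl, fun l r h => ?_⟩
  cases RootedBinaryTree.mem_subtrees_leaf.1 h

theorem IsBranchDecomposable.union [DecidableEq Ind] {E : ν → Finset Ind} {k : ℕ}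
    {X Y : Finset Ind} (hX : IsBranchDecomposable E k X) (hY : IsBranchDecomposable E k Y)
    (hd : Disjoint X Y) {C : Finset ν} (hC : C.card ≤ k) (hXC : edgeBoundary E (X : Set Ind) ⊆ C)
    (hYC : edgeBoundary E (Y : Set Ind) ⊆ C) : IsBranchDecomposable E k (X ∪ Y) := by
  rcases hX with rfl | ⟨l, hl, hlm⟩
  · simpa using hY
  rcases hY with rfl | ⟨r, hr, hrm⟩
  · rw [Finset.union_empty]
    exact Or.inr ⟨l, hl, hlm⟩
  refine Or.inr ⟨.node l r, ?_, fun l' r' h => ?_⟩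
  · rw [RootedBinaryTree.leaves, hl, hr, ← Finset.disjUnion_eq_union _ _ hd]
    rfl
  · rcases RootedBinaryTree.mem_subtrees_node.1 h with h | h | h
    · cases h
      refine ⟨C, hC, ?_, ?_⟩
      · rw [hl]
        exact hXC
      · rw [hr]
        exact hYC
    · exact hlm l' r' h
    · exact hrm l' r' h

/-- Edges with all their ends in one bag may be joined in any order: every boundary stays in `C`. -/
theorem isBranchDecomposable_of_subset [DecidableEq Ind] {E : ν → Finset Ind} {k : ℕ}
    {C : Finset ν} (hC : C.card ≤ k) (X : Finset Ind) (hX : ∀ i ∈ X, ∀ v, i ∈ E v → v ∈ C) :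
    IsBranchDecomposable E k X := by
  have key {Y : Finset Ind} (hY : ∀ i ∈ Y, ∀ v, i ∈ E v → v ∈ C) :
      edgeBoundary E (Y : Set Ind) ⊆ C := by
    rintro v ⟨⟨i, hi, hiY⟩, -⟩
    exact hY i hiY v hi
  induction X using Finset.induction_on with
  | empty => exact Or.inl rfl
  | insert i X hi ih =>
    have hX' := fun j hj => hX j (Finset.mem_insert_of_mem hj)
    rw [Finset.insert_eq]
    refine (isBranchDecomposable_singleton E k i).union (ih hX') (by simpa using hi) hC
      (key fun j hj => ?_) (key hX')
    rw [Finset.mem_singleton.1 hj]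
    exact hX i (Finset.mem_insert_self _ _)

theorem SimpleGraph.path_induce {V : Type*} {T : SimpleGraph V} {s : Set V} {m n : s}
    {q : (T.induce s).Walk m n} (hq : q.IsPath) :
    ∃ q' : T.Walk m n, q'.IsPath ∧ ∀ p, p ∈ q'.support ↔ ∃ h : p ∈ s, (⟨p, h⟩ : s) ∈ q.support := by
  refine ⟨q.map (SimpleGraph.Embedding.induce s).toHom,
    hq.map Subtype.val_injective, fun p => ?_⟩
  have e := SimpleGraph.Walk.support_map (SimpleGraph.Embedding.induce (G := T) s).toHom q
  refine Iff.trans (iff_of_eq (congrArg (p ∈ ·) e)) ?_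
  rw [List.mem_map]
  constructor
  · rintro ⟨x, hx, rfl⟩
    exact ⟨x.2, hx⟩
  · rintro ⟨h, hp⟩
    exact ⟨_, hp, rfl⟩

/-- A node `x` whose removal keeps `T` connected is merged into a neighbour `m`. A vertex with an
edge at `x` and another one elsewhere lies in the bags at both places, and a path between them runs
through `m`; so it lies in the bag of `m`. Thus `χ m` contains the boundaries of both sets being
joined, and the hypotheses persist with one node fewer. -/
theorem isBranchDecomposable_of_connected [DecidableEq Ind] {E : ν → Finset Ind} {k : ℕ}
    {𝓔 : Finset Ind} (hE : ∀ v, E v ⊆ 𝓔) (N : ℕ) (V : Type) [Fintype V] [DecidableEq V]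
    (hN : Fintype.card V = N) (T : SimpleGraph V) (hT : T.Connected) (χ : V → Finset ν)
    (hχ : ∀ n, (χ n).card ≤ k)
    (hpath : ∀ (n o p : V) (q : T.Walk n o), q.IsPath → p ∈ q.support →
      ∀ v, v ∈ χ n → v ∈ χ o → v ∈ χ p)
    (loc : Ind → V) (hdec : ∀ n, IsBranchDecomposable E k (𝓔.filter fun i => loc i = n))
    (hbd : ∀ n, edgeBoundary E (𝓔.filter fun i => loc i = n : Finset Ind) ⊆ (χ n : Set ν)) :
    IsBranchDecomposable E k 𝓔 := by
  induction N generalizing V with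
  | zero =>
    have := hT.nonempty
    exact absurd hN Fintype.card_ne_zero
  | succ N ih =>
    by_cases hV : Nontrivial V
    · obtain ⟨x, hx⟩ := hT.exists_connected_induce_compl_singleton_of_finite_nontrivial
      obtain ⟨m, hm⟩ := hT.preconnected.exists_adj_of_nontrivial x
      let m' : ({x}ᶜ : Set V) := ⟨m, hm.ne'⟩
      let loc' : Ind → ({x}ᶜ : Set V) := fun i => if h : loc i = x then m' else ⟨loc i, h⟩
      have hfib (n : ({x}ᶜ : Set V)) (hn : n ≠ m') :
          (𝓔.filter fun i => loc' i = n) = 𝓔.filter fun i => loc i = n.1 := by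
        refine Finset.filter_congr fun i _ => ?_
        simp only [loc']
        split_ifs with h
        · exact iff_of_false (fun h' => hn h'.symm) fun h' => n.2 (h'.symm.trans h)
        · exact Subtype.ext_iff
      have hfibm : (𝓔.filter fun i => loc' i = m') =
          (𝓔.filter fun i => loc i = m) ∪ 𝓔.filter fun i => loc i = x := by
        rw [← Finset.filter_or]
        refine Finset.filter_congr fun i _ => ?_
        simp only [loc']
        split_ifs with h
        · simp [h]
        · simp only [h, or_false]
          exact Subtype.ext_iff
      have hmx : Disjoint (𝓔.filter fun i => loc i = m) (𝓔.filter fun i => loc i = x) :=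
        Finset.disjoint_filter.2 fun i _ h h' => hm.ne (h'.symm.trans h)
      have hbx : edgeBoundary E (𝓔.filter fun i => loc i = x : Finset Ind) ⊆ (χ m : Set ν) := by
        intro v hv
        have hvx := hbd x hv
        obtain ⟨⟨i, hi, hix⟩, j, hj, hjx⟩ := hv
        rw [Finset.mem_coe, Finset.mem_filter] at hix hjx
        have hjx : loc j ≠ x := fun h => hjx ⟨hE v hj, h⟩
        have hvj : v ∈ χ (loc j) := hbd (loc j) ⟨⟨j, hj, by simp [hE v hj]⟩, i, hi, by
          simp [hix.2, hjx.symm]⟩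
        -- A path from `m` that avoids `x`, so that it can be prolonged to start at `x`.
        obtain ⟨q, hq⟩ := hx.exists_isPath m' ⟨loc j, hjx⟩
        obtain ⟨q', hq', hs⟩ := SimpleGraph.path_induce hq
        refine hpath x (loc j) m (SimpleGraph.Walk.cons hm q')
          ((SimpleGraph.Walk.cons_isPath_iff _ _).2 ⟨hq', fun h => ?_⟩) ?_ v hvx hvj
        · obtain ⟨h, -⟩ := (hs x).1 h
          exact h rfl
        · rw [SimpleGraph.Walk.support_cons]
          exact List.mem_cons_of_mem _ q'.start_mem_support
      refine ih ({x}ᶜ : Set V) ?_ (T.induce {x}ᶜ) hx (fun n => χ n) (fun n => hχ n) ?_ loc' ?_ ?_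
      · rw [Fintype.card_compl_set]
        simp [hN]
      · intro n o p q hq hp v hn ho
        obtain ⟨q', hq', hs⟩ := SimpleGraph.path_induce hq
        exact hpath n o p q' hq' ((hs p).2 ⟨p.2, hp⟩) v hn ho
      · intro n
        by_cases hn : n = m'
        · rw [hn, hfibm]
          exact (hdec m).union (hdec x) hmx (hχ m) (hbd m) hbx
        · rw [hfib n hn]
          exact hdec n
      · intro n
        by_cases hn : n = m'
        · rw [hn, hfibm, Finset.coe_union]
          exact (edgeBoundary_union_subset E _ _).trans (Set.union_subset (hbd m) hbx)
        · rw [hfib n hn]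
          exact hbd n
    · rw [not_nontrivial_iff_subsingleton] at hV
      have := hT.nonempty.some
      have h := hdec this
      rwa [Finset.filter_true_of_mem fun i _ => Subsingleton.elim _ _] at h

/-- Each edge is placed at one node whose label contains its ends, so the edges at a node involve
only vertices of its label. -/
theorem TreeDecomposition.isBranchDecomposable [DecidableEq Ind] {G : Graph ν Ind}
    (D : TreeDecomposition G) {w : ℕ} (hw : D.width = w) {E : ν → Finset Ind} {𝓔 : Finset Ind}
    (hE : ∀ v, E v ⊆ 𝓔) (hG : G.edgeSet = 𝓔) (hinc : ∀ v i, i ∈ E v → G.Inc i v) :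
    IsBranchDecomposable E (w + 1) 𝓔 := by
  classical
  have := D.fintypeNode
  have hcard (n) : (D.label n).card ≤ w + 1 := by
    have h : (D.label n).card ≤ Finset.univ.sup fun n => (D.label n).card :=
      Finset.le_sup (f := fun n => (D.label n).card) (Finset.mem_univ n)
    have hw' : (Finset.univ.sup fun n => (D.label n).card) - 1 = w := by
      rw [← hw]
      unfold TreeDecomposition.width
      congr!
    omega
  have hloc (i : Ind) : ∃ n, i ∈ 𝓔 → ∀ v, G.Inc i v → v ∈ D.label n := by
    by_cases hi : i ∈ 𝓔
    · obtain ⟨n, hn⟩ := D.edge_mem i (hG ▸ hi)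
      exact ⟨n, fun _ => hn⟩
    · exact ⟨D.isBinary.1.connected.nonempty.some, fun h => absurd h hi⟩
  choose loc hloc using hloc
  have key (n) : ∀ i ∈ 𝓔.filter fun i => loc i = n, ∀ v, i ∈ E v → v ∈ D.label n := by
    intro i hi v hv
    rw [Finset.mem_filter] at hi
    rw [← hi.2]
    exact hloc i hi.1 v (hinc v i hv)
  refine isBranchDecomposable_of_connected hE _ D.node rfl D.tree D.isBinary.1.connected D.label
    hcard D.path_mem loc (fun n => isBranchDecomposable_of_subset (hcard n) _ (key n)) fun n => ?_
  rintro v ⟨⟨i, hi, hin⟩, -⟩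
  exact key n i hin v hi

end Decomposition

/-! ### The structure graph, the choice of factors and the final contraction tree. -/

section Assembly

variable {Ind : Type*} {dom : Ind → Type*}

open RootedBinaryTree

open Classical in
/-- The network consisting of a single tensor. -/
def TensorNetwork.single (A : Tensor dom) : TensorNetwork dom where
  tensors := {A}
  nonempty := Finset.singleton_nonempty A
  le_two _ := (Finset.card_filter_le _ _).trans (by simp)

namespace TensorNetwork

open Classical in
theorem mult_single (A : Tensor dom) (i : Ind) :
    (single A).mult i = if i ∈ A.idx then 1 else 0 := by
  unfold mult single
  rw [Finset.filter_singleton]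
  split_ifs <;> rfl

theorem free_single (A : Tensor dom) : (single A).free = A.idx := by
  classical
  ext i
  rw [mem_free, mult_single]
  split_ifs with h <;> simp [h]

theorem bond_single (A : Tensor dom) : (single A).bond = ∅ := by
  classical
  refine Finset.eq_empty_of_forall_notMem fun i hi => ?_
  rw [mem_bond, mult_single] at hi
  split_ifs at hi
  omega

theorem contraction_single [∀ i, Fintype (dom i)] (A : Tensor dom) :
    (single A).contraction = A := by
  refine Tensor.ext_ev (free_single A) fun σ => ?_
  rw [ev_contraction, bond_single, sumOut_empty]
  exact Finset.prod_singleton _ _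

theorem sum_chi_idx (M : TensorNetwork dom) : ∑ B ∈ M.tensors, chi B.idx = chi M.free := by
  classical
  ext i
  rw [Finsupp.finsetSum_apply]
  simp only [chi_apply]
  simp only [Finset.sum_boole, mem_free]
  change ((M.mult i : ℕ) : ZMod 2) = _
  have h : M.mult i ≤ 2 := M.le_two i
  interval_cases M.mult i
  · simp
  · simp
  · rfl

theorem idx_subset (N : TensorNetwork dom) {A : Tensor dom} (hA : A ∈ N.tensors) :
    A.idx ⊆ N.indices := fun _ hi => N.mem_indices hA hi

variable {N : TensorNetwork dom}

/-- The vertices of the structure graph. -/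
noncomputable def vertices (N : TensorNetwork dom) : Finset (Option (Tensor dom)) :=
  Finset.insertNone N.tensors

/-- The edges of a vertex of the structure graph. -/
noncomputable def edgesAt (N : TensorNetwork dom) (v : Option (Tensor dom)) : Finset Ind :=
  open Classical in if v ∈ N.vertices then v.elim N.free Tensor.idx else ∅

theorem edgesAt_none (N : TensorNetwork dom) : N.edgesAt none = N.free := by
  simp [edgesAt, vertices]

theorem edgesAt_some {A : Tensor dom} (hA : A ∈ N.tensors) : N.edgesAt (some A) = A.idx := by
  simp [edgesAt, vertices, hA]

theorem mem_edgesAt {v : Option (Tensor dom)} {i : Ind} : i ∈ N.edgesAt v ↔ N.Incident i v := by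
  rcases v with _ | A
  · rw [edgesAt_none]
    rfl
  · by_cases hA : A ∈ N.tensors
    · rw [edgesAt_some hA]
      simp [Incident, hA]
    · simp [edgesAt, vertices, hA, Incident]

theorem edgesAt_subset (v : Option (Tensor dom)) : N.edgesAt v ⊆ N.indices :=
  fun _ hi => Incident.mem_indices N (mem_edgesAt.1 hi)

theorem inc_structureGraph {v : Option (Tensor dom)} {i : Ind} (hi : i ∈ N.edgesAt v) :
    N.structureGraph.Inc i v := by
  rw [mem_edgesAt] at hi
  obtain ⟨x, y, hxy, hx, hy⟩ := N.exists_incident_pair (Incident.mem_indices N hi)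
  by_cases hv : v = x
  · subst hv
    exact ⟨y, hxy, hx, hy⟩
  · exact ⟨x, hv, hi, hx⟩

-- The free vertex is the second end of each free index.
open Classical in
theorem card_filter_edgesAt {i : Ind} (hi : i ∈ N.indices) :
    (N.vertices.filter fun v => i ∈ N.edgesAt v).card = 2 := by
  have h1 : (N.vertices.filter fun v => i ∈ N.edgesAt v) =
      (if i ∈ N.free then {none} else ∅) ∪
      (N.tensors.filter fun A => i ∈ A.idx).map Function.Embedding.some := by
    ext v
    rcases v with _ | A
    · simp only [vertices, Finset.mem_filter, Finset.mem_union, edgesAt_none]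
      split_ifs with h <;> simp [h]
    · by_cases hA : A ∈ N.tensors
      · simp only [vertices, Finset.mem_filter, Finset.mem_union, edgesAt_some hA]
        split_ifs with h <;> simp [hA]
      · simp only [vertices, Finset.mem_filter, Finset.mem_union]
        split_ifs with h <;> simp [hA]
  rw [h1, Finset.card_union_of_disjoint, Finset.card_map]
  · change _ + N.mult i = 2
    rcases N.mult_eq_one_or_two hi with h | h
    · simp [mem_free, h]
    · simp [mem_free, h]
  · split_ifs <;> simp

end TensorNetwork

/-- Vertices of degree zero are not spread over the tree; being scalars, they can be multiplied in
at the end. -/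
theorem Contractible.of_subset {α : Type*} {c : α → Ind →₀ ZMod 2} {W : ℕ} {s t : Finset α}
    (hs : Contractible c W s) (hst : s ⊆ t) (h0 : ∀ x ∈ t, x ∉ s → c x = 0)
    (hsum : ∑ x ∈ t, c x = 0) : Contractible c W t := by
  classical
  have h0' : ∀ x ∈ t \ s, c x = 0 := fun x hx =>
    h0 x (Finset.mem_sdiff.1 hx).1 (Finset.mem_sdiff.1 hx).2
  have key := hs.biUnion (t \ s) (fun x => {x}) (by simp)
    (fun x hx y hy => by simp [Finset.mem_singleton.1 hy, h0' x hx])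
    (fun x hx => Finset.disjoint_singleton_right.2 (Finset.mem_sdiff.1 hx).2)
    (fun x _ y _ hxy => Finset.disjoint_singleton.2 hxy) fun J hJ => by
      rw [Finset.biUnion_singleton_eq_self, Finset.sum_subset (s₂ := t), hsum]
      · simp
      · exact Finset.union_subset hst (hJ.trans Finset.sdiff_subset)
      · exact fun x hx hx' => h0 x hx fun h => hx' (Finset.mem_union_left _ h)
  rwa [Finset.biUnion_singleton_eq_self, Finset.union_sdiff_of_subset hst] at key

variable [∀ i, Fintype (dom i)]

/-- `M` factors `A` into tensors of rank at most three. -/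
structure IsFactorOf (A : Tensor dom) (M : TensorNetwork dom) : Prop where
  contraction_eq : M.contraction = A
  rank_le : ∀ B ∈ M.tensors, B.rank ≤ 3
  eq_single : A.rank ≤ 3 → M = .single A
  bond_or : 3 < A.rank → (∀ B ∈ M.tensors, ∃ i ∈ B.idx, i ∈ M.bond) ∧
    ∃ i ∈ A.idx, M.bondDim ≤ Fintype.card (dom i)

theorem isFactorOf_single {A : Tensor dom} (h : A.rank ≤ 3) : IsFactorOf A (.single A) where
  contraction_eq := TensorNetwork.contraction_single A
  rank_le B hB := by
    rw [show B = A from Finset.mem_singleton.1 hB]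
    exact h
  eq_single _ := rfl
  bond_or h' := absurd h h'.not_ge

theorem IsRootedFactorization.rank_le_three {A : Tensor dom} {R : RootedBinaryTree Ind}
    {M : TensorNetwork dom} {G : RootedBinaryTree Ind → Tensor dom}
    {b : RootedBinaryTree Ind → Ind →₀ ZMod 2} (h : IsRootedFactorization A R M G b)
    {B : Tensor dom} (hB : B ∈ M.tensors) : B.rank ≤ 3 := by
  obtain ⟨S, hS, rfl⟩ := (h.mem_tensors B).1 hB
  unfold Tensor.rank
  rw [← support_chi (G S).idx]
  rcases S with a | ⟨l, r⟩
  · rw [h.leaf a hS]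
    refine (card_support_add_le _ _).trans ?_
    rw [support_chi, Finset.card_singleton]
    have := h.card_le (.leaf a)
    omega
  · rw [h.node l r hS]
    have h1 := card_support_add_le (b (.node l r)) (b l + b r)
    have h2 := card_support_add_le (b l) (b r)
    have := h.card_le (.node l r)
    have := h.card_le l
    have := h.card_le r
    omega

/-- One tree `R` serves all tensors: its restriction to the indices of `A` prescribes the shape of
the factorization of `A`. -/
theorem Tensor.TreeFactorable.exists_isFactorOf [DecidableEq Ind]
    [DecidableEq (Option (Tensor dom))]
    (fresh : ∀ i : Ind, {j : Ind | Fintype.card (dom j) = Fintype.card (dom i)}.Infinite)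
    {A : Tensor dom} (hA : A.TreeFactorable) {R : RootedBinaryTree Ind} (hd : R.leaves.Nodup)
    (hAR : ∀ i ∈ A.idx, i ∈ R.leaves) (F X : Finset Ind) :
    ∃ M, (IsFactorOf A M ∧ (A.idx.Nonempty → ∃ H b, IsSpread (optionChi F) A.idx R H b ∧
      H R = M.tensors.map Function.Embedding.some)) ∧ Disjoint M.bond X := by
  classical
  by_cases h3 : A.rank ≤ 3
  · refine ⟨.single A, ⟨isFactorOf_single h3, fun hne => ?_⟩, ?_⟩
    · exact exists_isSpread_of_card_le_three hd hne h3 hAR (some A) rfl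
    · rw [TensorNetwork.bond_single]
      exact Finset.disjoint_empty_left _
  · have hlr := leaves_restrict (· ∈ A.idx) R
    have hfil : R.leaves.filter (· ∈ A.idx) = A.idx.val := by
      refine (Multiset.Nodup.ext (hd.filter _) A.idx.nodup).2 fun i => ?_
      rw [Multiset.mem_filter]
      exact ⟨fun h => h.2, fun h => ⟨hAR i h, h⟩⟩
    rcases hR : R.restrict (· ∈ A.idx) with _ | R'
    · rw [hR] at hlr
      have : A.idx.val = 0 := by
        rw [← hfil]
        refine Eq.trans ?_ hlr.symm
        congr
      unfold Tensor.rank at h3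
      rw [Finset.card_def, this] at h3
      simp at h3
    · have hR' : R'.leaves = A.idx.val := by
        rw [← hfil, leaves_of_restrict_eq_some hR]
        congr
      obtain ⟨M, G, b, h, hX⟩ := hA.exists_isRootedFactorization fresh hR' (by omega) X
      refine ⟨M, ⟨⟨h.contraction_eq, fun B hB => h.rank_le_three hB, fun h => absurd h h3,
        fun _ => ⟨h.exists_bond, h.bondDim_le⟩⟩, fun _ => ?_⟩, hX⟩
      exact h.exists_isSpread hR hR' F

namespace TensorNetwork

variable {N : TensorNetwork dom} {F : Tensor dom → TensorNetwork dom}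

theorem isFactoring_of_isFactorOf (hF : ∀ A ∈ N.tensors, IsFactorOf A (F A))
    (hN : ∀ A ∈ N.tensors, Disjoint (F A).bond N.indices)
    (hd : ∀ A ∈ N.tensors, ∀ B ∈ N.tensors, A ≠ B → Disjoint (F A).bond (F B).bond) :
    N.IsFactoring F where
  contraction_eq A hA := (hF A hA).contraction_eq
  disjoint_indices := hN
  disjoint_bond := hd
  eq_or_exists_bond A hA := by
    by_cases h : A.rank ≤ 3
    · left
      rw [(hF A hA).eq_single h]
      rfl
    · exact Or.inr ((hF A hA).bond_or (not_le.1 h)).1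

open Classical in
/-- The vertices into which the vertices of positive degree are split by the factorizations `F`. -/
noncomputable def spreadVertices (N : TensorNetwork dom) (F : Tensor dom → TensorNetwork dom) :
    Finset (Option (Tensor dom)) :=
  (N.vertices.filter fun v => (N.edgesAt v).Nonempty).biUnion fun v =>
    v.elim {none} fun A => (F A).tensors.map Function.Embedding.some

-- A connection is nonzero only at boundary vertices, so the middle sets bound the number of
-- vertices active at a node.
open Classical in
theorem contractible_of_hasMiddleSets {w W : ℕ} (hW3 : 3 ≤ W) (hW : w + 1 + (w + 3) / 3 ≤ W)
    (hF : N.IsFactoring F) (hfac : ∀ A ∈ N.tensors, IsFactorOf A (F A)) (hfree : N.free.card ≤ 3)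
    {R : RootedBinaryTree Ind} (hR : R.leaves = N.indices.val)
    (hmid : HasMiddleSets N.edgesAt (w + 1) R)
    (hs : ∀ A ∈ N.tensors, A.idx.Nonempty → ∃ H b, IsSpread (optionChi N.free) A.idx R H b ∧
      H R = (F A).tensors.map Function.Embedding.some) :
    Contractible (optionChi N.free) W (N.spreadVertices F) := by
  unfold spreadVertices
  have hd : R.leaves.Nodup := hR ▸ N.indices.nodup
  have hmemR {i : Ind} : i ∈ R.leaves ↔ i ∈ N.indices := by rw [hR]; rfl
  set 𝒱 := N.vertices.filter fun v => (N.edgesAt v).Nonempty with h𝒱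
  set L : Option (Tensor dom) → Finset (Option (Tensor dom)) := fun v =>
    v.elim {none} fun A => (F A).tensors.map Function.Embedding.some with hL
  have hmemT {A : Tensor dom} (h : some A ∈ 𝒱) : A ∈ N.tensors := by
    simpa [vertices] using (Finset.mem_filter.1 h).1
  have hex (v : Option (Tensor dom)) : ∃ H b, v ∈ 𝒱 →
      IsSpread (optionChi N.free) (N.edgesAt v) R H b ∧ H R = L v := by
    by_cases hv : v ∈ 𝒱
    · have hne := (Finset.mem_filter.1 hv).2
      rcases v with _ | A
      · rw [edgesAt_none] at hne ⊢
        obtain ⟨H, b, h⟩ := exists_isSpread_of_card_le_three (c := optionChi (dom := dom) N.free)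
          hd hne hfree (fun i hi => hmemR.2 (N.free_subset hi)) none rfl
        exact ⟨H, b, fun _ => h⟩
      · rw [edgesAt_some (hmemT hv)] at hne ⊢
        obtain ⟨H, b, h⟩ := hs A (hmemT hv) hne
        exact ⟨H, b, fun _ => h⟩
    · exact ⟨fun _ => ∅, fun _ => 0, fun h => absurd h hv⟩
  choose H b hHb using hex
  have hdisj : ∀ v ∈ 𝒱, ∀ u ∈ 𝒱, v ≠ u → Disjoint (L v) (L u) := by
    intro v hv u hu hvu
    rcases v with _ | A <;> rcases u with _ | B
    · exact absurd rfl hvu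
    · simp [L]
    · simp [L]
    · simp only [L, Option.elim_some, Finset.disjoint_map]
      exact hF.disjoint_tensors (hmemT hv) (hmemT hu) fun h => hvu (by rw [h])
  have key := contractible_of_isSpread (𝒱 := 𝒱) (E := N.edgesAt) (H := H) (b := b) (w := w)
    hW3 hW hd (fun v hv => (hHb v hv).1)
    (fun v hv u hu hvu => by rw [(hHb v hv).2, (hHb u hu).2]; exact hdisj v hv u hu hvu)
    (fun v hv x hx => by
      rw [(hHb v hv).2] at hx
      simp only [optionChi, support_chi]
      rcases v with _ | A
      · rw [Finset.mem_singleton.1 hx]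
        exact hfree
      · obtain ⟨B, hB, rfl⟩ := Finset.mem_map.1 hx
        exact (hfac A (hmemT hv)).rank_le B hB)
    (fun i hi => by
      rw [← card_filter_edgesAt (hmemR.1 hi), h𝒱, Finset.filter_filter]
      congr 1
      refine Finset.filter_congr fun v _ => ⟨fun h => h.2, fun h => ⟨⟨i, h⟩, h⟩⟩)
    (fun l r hlr => by
      obtain ⟨C, hC, hlC, hrC⟩ := hmid l r hlr
      refine (Finset.card_le_card fun v hv => ?_).trans hC
      rw [Finset.mem_filter] at hv
      have hsp := (hHb v hv.1).1
      rcases hv.2 with h | h | h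
      · exact hlC (hsp.boundary l (left_mem_subtrees hlr) h)
      · exact hrC (hsp.boundary r (right_mem_subtrees hlr) h)
      -- The boundary of the node is covered by the boundaries of its two children.
      · have hb := hsp.boundary _ hlr h
        have : v ∈ edgeBoundary N.edgesAt ({i | i ∈ l.leaves} ∪ {i | i ∈ r.leaves}) := by
          simpa [edgeBoundary, leaves] using hb
        exact (edgeBoundary_union_subset _ _ _ this).elim (fun h => hlC h) fun h => hrC h)
    R R.self_mem_subtrees
  rwa [Finset.biUnion_congr rfl fun v hv => (hHb v hv).2] at key

open Classical in
theorem contractible_insertNone {W : ℕ} (hfac : ∀ A ∈ N.tensors, IsFactorOf A (F A))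
    {M : TensorNetwork dom} (hM : ∀ B, B ∈ M.tensors ↔ ∃ A ∈ N.tensors, B ∈ (F A).tensors)
    (hMN : M.free = N.free)
    (h : Contractible (optionChi N.free) W (N.spreadVertices F)) :
    Contractible (optionChi N.free) W (Finset.insertNone M.tensors) ∧
      ∑ x ∈ Finset.insertNone M.tensors, optionChi N.free x = 0 := by
  have hsum : ∑ x ∈ Finset.insertNone M.tensors, optionChi N.free x = 0 := by
    rw [Finset.sum_insertNone]
    simp only [optionChi, Option.elim_none, Option.elim_some]
    rw [sum_chi_idx, hMN, add_self_finsupp_zmod_two]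
  unfold spreadVertices at h
  refine ⟨h.of_subset ?_ ?_ hsum, hsum⟩
  · intro x hx
    obtain ⟨v, hv, hx⟩ := Finset.mem_biUnion.1 hx
    have hv := (Finset.mem_filter.1 hv).1
    rcases v with _ | A
    · rw [Finset.mem_singleton.1 hx]
      simp
    · obtain ⟨B, hB, rfl⟩ := Finset.mem_map.1 hx
      have hA : A ∈ N.tensors := by simpa [vertices] using hv
      simp only [Function.Embedding.some_apply, Finset.some_mem_insertNone, hM]
      exact ⟨A, hA, hB⟩
  · intro x hx hx'
    rcases x with _ | B
    · have : N.free = ∅ := by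
        by_contra hne
        refine hx' (Finset.mem_biUnion.2 ⟨none, Finset.mem_filter.2 ⟨by simp [vertices], ?_⟩,
          by simp⟩)
        rw [edgesAt_none]
        exact Finset.nonempty_iff_ne_empty.2 hne
      simp [optionChi, this, chi_empty]
    · rw [Finset.some_mem_insertNone, hM] at hx
      obtain ⟨A, hA, hB⟩ := hx
      have hA0 : A.idx = ∅ := by
        by_contra hne
        refine hx' (Finset.mem_biUnion.2 ⟨some A, Finset.mem_filter.2 ⟨by simp [vertices, hA], ?_⟩,
          by simpa using hB⟩)
        rw [edgesAt_some hA]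
        exact Finset.nonempty_iff_ne_empty.2 hne
      -- A scalar is its own factor network.
      rw [(hfac A hA).eq_single (by simp [Tensor.rank, hA0])] at hB
      rw [show B = A from Finset.mem_singleton.1 hB]
      simp [optionChi, hA0, chi_empty]

theorem exists_contractionTree {W : ℕ} {M : TensorNetwork dom} {E : Finset Ind}
    (h : Contractible (optionChi E) W (Finset.insertNone M.tensors))
    (h0 : ∑ x ∈ Finset.insertNone M.tensors, optionChi E x = 0) :
    ∃ t : RootedBinaryTree (Tensor dom), t.IsContractionTree M ∧ t.maxRank ≤ W := by
  classical
  obtain ⟨A, hA⟩ := M.nonempty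
  obtain ⟨t, ht, hb⟩ := exists_isBounded_erase h (z := none) (by simp) (fun h' => by
    have : some A ∈ Finset.insertNone M.tensors := by simpa using hA
    rw [h'] at this
    simp at this) h0
  have hv : ((Finset.insertNone M.tensors).erase none).val = M.tensors.val.map some := by
    rw [show (Finset.insertNone M.tensors).erase none = M.tensors.map Function.Embedding.some by
      ext x
      rcases x with _ | B <;> simp]
    rfl
  rw [hv] at ht
  -- The default `A` is never used, as `none` is no longer a leaf.
  refine ⟨t.map fun x => x.getD A, ?_, ?_⟩
  · unfold IsContractionTree
    rw [leaves_map, ht, Multiset.map_map]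
    simp
  · have hf : ∀ x ∈ t.leaves, chi (x.getD A).idx = optionChi E x := by
      intro x hx
      rw [ht, Multiset.mem_map] at hx
      obtain ⟨B, -, rfl⟩ := hx
      rfl
    have h1 := IsBounded.map (f := fun x : Option (Tensor dom) => x.getD A)
      (c' := fun A : Tensor dom => chi A.idx) (c := optionChi E) hb hf
    exact IsBounded.maxRank_le h1

theorem exists_of_factoring {W : ℕ} (hF : N.IsFactoring F)
    (hfac : ∀ A ∈ N.tensors, IsFactorOf A (F A))
    (h : Contractible (optionChi N.free) W (N.spreadVertices F)) :
    ∃ F : Tensor dom → TensorNetwork dom,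
      (∀ A ∈ N.tensors, (F A).contraction = A ∧ ∀ B ∈ (F A).tensors, B.rank ≤ 3) ∧
      (∀ A ∈ N.tensors, ∀ B ∈ N.tensors, A ≠ B → Disjoint (F A).tensors (F B).tensors) ∧
      ∃ M : TensorNetwork dom,
        (∀ B : Tensor dom, B ∈ M.tensors ↔ ∃ A ∈ N.tensors, B ∈ (F A).tensors) ∧
        M.contraction = N.contraction ∧
        ((∀ A ∈ N.tensors, 3 < A.rank → ∀ i ∈ A.idx, i ∈ N.free →
            Fintype.card (dom i) ≤ N.bondDim) → M.bondDim = N.bondDim) ∧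
        N.bondDim ≤ M.bondDim ∧
        M.bondDim ≤ max N.bondDim (N.free.sup fun i => Fintype.card (dom i)) ∧
        ∃ t : RootedBinaryTree (Tensor dom), t.IsContractionTree M ∧ t.maxRank ≤ W := by
  classical
  obtain ⟨M, hM, hMb, hMc⟩ := hF.exists_union
  have hle : N.bondDim ≤ M.bondDim := by
    unfold bondDim
    rw [hMb]
    exact Finset.sup_mono Finset.subset_union_left
  -- The bonds of a factored `A` are no larger than some index of `A`, which is a bond of `N` or a
  -- free index covered by `hj`.
  have hnew {K : ℕ} (hK : N.bondDim ≤ K) (hj : ∀ A ∈ N.tensors, 3 < A.rank → ∀ j ∈ A.idx,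
      j ∈ N.free → Fintype.card (dom j) ≤ K) : M.bondDim ≤ K := by
    unfold bondDim
    rw [hMb, Finset.sup_union, Finset.sup_biUnion]
    refine sup_le hK (Finset.sup_le fun A hA => ?_)
    change (F A).bondDim ≤ K
    by_cases h3 : A.rank ≤ 3
    · rw [(hfac A hA).eq_single h3]
      simp [bondDim, bond_single]
    · obtain ⟨j, hjA, hjb⟩ := ((hfac A hA).bond_or (not_le.1 h3)).2
      refine hjb.trans ?_
      rcases mem_free_or_mem_bond (N.mem_indices hA hjA) with h | h
      · exact hj A hA (not_le.1 h3) j hjA h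
      · exact (Finset.le_sup (f := fun i => Fintype.card (dom i)) h).trans hK
  refine ⟨F, fun A hA => ⟨(hfac A hA).contraction_eq, (hfac A hA).rank_le⟩,
    fun A hA B hB => hF.disjoint_tensors hA hB, M, fun B => ?_, hMc, fun hj => ?_, hle, ?_, ?_⟩
  · rw [hM, Finset.mem_biUnion]
  · exact le_antisymm (hnew le_rfl hj) hle
  · exact hnew (le_max_left _ _) fun A _ _ j _ hj =>
      (Finset.le_sup (f := fun i => Fintype.card (dom i)) hj).trans (le_max_right _ _)
  · have hMN : M.free = N.free := congrArg Tensor.idx hMc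
    have hc := contractible_insertNone hfac (fun B => by rw [hM, Finset.mem_biUnion]) hMN h
    exact exists_contractionTree hc.1 hc.2

end TensorNetwork

end Assembly

theorem mainTheorem4 {Ind : Type*} {dom : Ind → Type*} [∀ i, Fintype (dom i)]
    -- there are enough fresh indices of each occurring domain size
    (fresh : ∀ i : Ind, {j : Ind | Fintype.card (dom j) = Fintype.card (dom i)}.Infinite)
    (N : TensorNetwork dom) (hfac : ∀ A ∈ N.tensors, A.TreeFactorable)
    (hfree : N.free.card ≤ 3)
    (w : ℕ) (hw : 1 ≤ w) (hwidth : ∃ D : TreeDecomposition N.structureGraph, D.width = w) :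
    ∃ F : Tensor dom → TensorNetwork dom,
      -- each tensor `A` of `N` is factored into the network `F A` of tensors of rank at most 3
      (∀ A ∈ N.tensors, (F A).contraction = A ∧ ∀ B ∈ (F A).tensors, B.rank ≤ 3) ∧
      -- these networks are disjoint, and their union `M` is a tensor network
      (∀ A ∈ N.tensors, ∀ B ∈ N.tensors, A ≠ B → Disjoint (F A).tensors (F B).tensors) ∧
      ∃ M : TensorNetwork dom,
        (∀ B : Tensor dom, B ∈ M.tensors ↔ ∃ A ∈ N.tensors, B ∈ (F A).tensors) ∧
        M.contraction = N.contraction ∧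
        -- the bond dimension
        ((∀ A ∈ N.tensors, 3 < A.rank → ∀ i ∈ A.idx, i ∈ N.free →
            Fintype.card (dom i) ≤ N.bondDim) → M.bondDim = N.bondDim) ∧
        N.bondDim ≤ M.bondDim ∧
        M.bondDim ≤ max N.bondDim (N.free.sup fun i => Fintype.card (dom i)) ∧
        -- the contraction tree
        ∃ t : RootedBinaryTree (Tensor dom),
          t.IsContractionTree M ∧ t.maxRank ≤ ⌈(4 * ((w : ℚ) + 1)) / 3⌉₊ := by
  classical
  set W := ⌈(4 * ((w : ℚ) + 1)) / 3⌉₊ with hWdef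
  -- This gives `w + 1 + ⌈(w + 1) / 3⌉ ≤ W` and, with `1 ≤ w`, also `3 ≤ W`, the room needed for
  -- single factors and at the leaves of `R`.
  have hW : 4 * (w + 1) ≤ 3 * W := by
    have h : (4 * ((w : ℚ) + 1)) / 3 ≤ W := Nat.le_ceil _
    rw [div_le_iff₀ (by norm_num)] at h
    have h' : ((4 * (w + 1) : ℕ) : ℚ) ≤ ((3 * W : ℕ) : ℚ) := by
      push_cast
      linarith
    exact_mod_cast h'
  obtain ⟨D, hD⟩ := hwidth
  rcases D.isBranchDecomposable hD (E := N.edgesAt) (𝓔 := N.indices) N.edgesAt_subset rfl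
    (fun v i hi => TensorNetwork.inc_structureGraph hi) with h0 | ⟨R, hR, hmid⟩
  -- Without indices all tensors are scalars and are left whole.
  · have hidx {A : Tensor dom} (hA : A ∈ N.tensors) : A.idx = ∅ :=
      Finset.subset_empty.1 (h0 ▸ N.idx_subset hA)
    have hfac : ∀ A ∈ N.tensors, IsFactorOf A (TensorNetwork.single A) := fun A hA =>
      isFactorOf_single (by simp [Tensor.rank, hidx hA])
    refine TensorNetwork.exists_of_factoring (TensorNetwork.isFactoring_of_isFactorOf hfac
      (fun A _ => ?_) fun A _ B _ _ => ?_) hfac ?_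
    · simp [TensorNetwork.bond_single]
    · simp [TensorNetwork.bond_single]
    · unfold TensorNetwork.spreadVertices
      rw [Finset.filter_false_of_mem, Finset.biUnion_empty]
      · exact Contractible.empty
      · rintro v - ⟨i, hi⟩
        exact Finset.notMem_empty i (h0 ▸ N.edgesAt_subset v hi)
  · have hd : R.leaves.Nodup := hR ▸ N.indices.nodup
    have : Inhabited (TensorNetwork dom) := ⟨N⟩
    -- The factors are chosen one after another, with bonds avoiding `N` and the factors already
    -- chosen.
    obtain ⟨F, hF, hdisj⟩ := exists_pairwise_disjoint_choice N.tensors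
      (fun A M => (IsFactorOf A M ∧ (A.idx.Nonempty → ∃ H b,
        IsSpread (optionChi N.free) A.idx R H b ∧
        H R = M.tensors.map Function.Embedding.some)) ∧ Disjoint M.bond N.indices)
      (fun M => M.bond) fun A hA X => by
        obtain ⟨M, hM, hX⟩ := (hfac A hA).exists_isFactorOf fresh hd
          (fun i hi => by rw [hR]; exact N.mem_indices hA hi) N.free (X ∪ N.indices)
        rw [Finset.disjoint_union_right] at hX
        exact ⟨M, ⟨hM, hX.2⟩, hX.1⟩
    have hfac' : ∀ A ∈ N.tensors, IsFactorOf A (F A) := fun A hA => (hF A hA).1.1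
    have hF' := TensorNetwork.isFactoring_of_isFactorOf hfac' (fun A hA => (hF A hA).2) hdisj
    exact TensorNetwork.exists_of_factoring hF' hfac'
      (TensorNetwork.contractible_of_hasMiddleSets (w := w) (by omega) (by omega) hF' hfac' hfree
        hR hmid fun A hA => (hF A hA).1.2)
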